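/- Setting. An $N$-mode bosonic system has Hilbert space $L^2(\mathbb R^N)$ with quadratures $R=(q_1,\dots,q_N,p_1,\dots,p_N)$, $[q_k,p_l]=i\delta_{kl}$, and Hamiltonian $H=\tfrac12\sum_{i=1}^N(q_i^2+p_i^2)$. A (displacement-free) pure Gaussian state is $\rho=|\psi\rangle\langle\psi|$ with $\langle\psi,e^{i\xi\cdot R}\psi\rangle=e^{-\frac14\xi^{T}\Sigma\xi}$ for all $\xi\in\mathbb R^{2N}$ and some real symmetric matrix $\Sigma$ (the covariance matrix). A Gaussian unitary is a unitary $U$ with $U^\dagger RU=SR+d$ for a symplectic matrix $S$ and a vector $d$. A $k$-partition $\mathcal A_1|\cdots|\mathcal A_k$ splits the $N$ modes into $k$ non-empty disjoint sets. The $k$-local ergotropic gap is the difference of the global and the $k$-local Gaussian ergotropies, $$\delta^{\mathcal A_1|\cdots|\mathcal A_k}(\rho)=\Big[\operatorname{Tr}(\rho H)-\min_{U}\operatorname{Tr}(U\rho U^\dagger H)\Big]-\Big[\operatorname{Tr}(\rho H)-\min_{U=\otimes_jU_{\mathcal A_j}}\operatorname{Tr}(U\rho U^\dagger H)\Big],$$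 where the first minimum is over all Gaussian unitaries and the second over all tensor products of Gaussian unitaries $U_{\mathcal A_j}$ on the modes in $\mathcal A_j$. The $k$-ergotropic score $\Delta^k(\rho)$ is the minimum of $\delta^{\mathcal A_1|\cdots|\mathcal A_k}(\rho)$ over all $k$-partitions of the modes. For a composite of an $N$-mode and an $N'$-mode system, a pooled $k$-partition is one of the form $\tilde{\mathcal A}_1|\cdots|\tilde{\mathcal A}_k$ with $\tilde{\mathcal A}_j=\mathcal A_j\cup\mathcal A'_j$, where $\mathcal A_1|\cdots|\mathcal A_k$ and $\mathcal A'_1|\cdots|\mathcal A'_k$ are $k$-partitions of the modes of the first and of the second system (each of the $k$ parties holds modes of both systems). Let $\tilde\Delta^k$ denote the minimum of the $k$-local ergotropic gap over all pooled $k$-partitions. Corollary. Let $k\ge1$. (i) Faithfulness. For every pure $N$-mode Gaussian state $\rho$ with $N\ge k$: $\Delta^k(\rho)=0$ if and only if there is a $k$-partition $\mathcal A_1|\cdots|\mathcal A_k$ of the modes across which $\rho$ is a product state, $\rho=\bigotimes_{j=1}^k\rho_{\mathcal A_j}$. (ii) Additivity. For all pure Gaussian states $\rho$ of $N\ge k$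 modes and $\rho'$ of $N'\ge k$ modes, and all $k$-partitions of their modes, $$\delta^{\tilde{\mathcal A}_1|\cdots|\tilde{\mathcal A}_k}(\rho\otimes\rho')=\delta^{\mathcal A_1|\cdots|\mathcal A_k}(\rho)+\delta^{\mathcal A'_1|\cdots|\mathcal A'_k}(\rho'),\qquad \tilde{\mathcal A}_j=\mathcal A_j\cup\mathcal A'_j,$$ and consequently the score of the composite is additive, $$\tilde\Delta^k(\rho\otimes\rho')=\Delta^k(\rho)+\Delta^k(\rho').$$ For the score over all $k$-partitions of the $N+N'$ modes one has $\Delta^k(\rho\otimes\rho')\le\Delta^k(\rho)+\Delta^k(\rho')$. -/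

import Mathlib

open MeasureTheory Matrix
open scoped FourierTransform ENNReal

noncomputable section

/-- The configuration space `ℝ^ι` of a system of bosonic modes labelled by `ι`. -/
abbrev Config (ι : Type) : Type := EuclideanSpace ℝ ι

/-- The Hilbert space `L²(ℝ^ι)` of the modes labelled by `ι` (Schrödinger representation:
`q i` is multiplication by `x i` and `p i = -i ∂/∂(x i)`, so that `[q k, p l] = i δ_{kl}`). -/
abbrev ModeSpace (ι : Type) [Fintype ι] : Type := Lp ℂ 2 (volume : Measure (Config ι))

section Modes

variable {ι : Type} [Fintype ι]

/-- The wave function of `exp (i ∑ (ξ (inl i) q_i + ξ (inr i) p_i)) ψ`. -/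
def weylFun (ξ : ι ⊕ ι → ℝ) (ψ : Config ι → ℂ) (x : Config ι) : ℂ :=
  Complex.exp (Complex.I *
      (((∑ i, ξ (Sum.inl i) * x i) + (1 / 2) * ∑ i, ξ (Sum.inl i) * ξ (Sum.inr i) : ℝ) : ℂ)) *
    ψ (x + WithLp.toLp 2 (fun i => ξ (Sum.inr i)))

theorem memLp_weylFun (ξ : ι ⊕ ι → ℝ) (ψ : ModeSpace ι) :
    MemLp (weylFun ξ ψ) 2 (volume : Measure (Config ι)) := by
  have h1 : MemLp (fun x : Config ι => ψ (x + WithLp.toLp 2 (fun i => ξ (Sum.inr i)))) 2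
      (volume : Measure (Config ι)) :=
    (Lp.memLp ψ).comp_measurePreserving (measurePreserving_add_right volume _)
  refine MemLp.of_le h1 ?_ (Filter.Eventually.of_forall fun x => ?_)
  · refine AEStronglyMeasurable.mul (Continuous.aestronglyMeasurable ?_) h1.aestronglyMeasurable
    fun_prop
  · rw [weylFun, norm_mul, mul_comm Complex.I, Complex.norm_exp_ofReal_mul_I, one_mul]

/-- The Weyl operator `exp (i ξ · R)`, with `R = (q, p)` the vector of quadrature operators. -/
def weyl (ξ : ι ⊕ ι → ℝ) (ψ : ModeSpace ι) : ModeSpace ι :=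
  (memLp_weylFun ξ ψ).toLp (weylFun ξ ψ)

/-- `ψ` is the state vector of a displacement-free pure Gaussian state: its characteristic
function is that of a centred Gaussian with covariance matrix `V`, normalised by
`V k l = ⟨R k R l + R l R k⟩` (so that the vacuum has `V = 1`).
At `ξ = 0` the condition says that `ψ` is a unit vector. -/
def IsPureGaussian (ψ : ModeSpace ι) : Prop :=
  ∃ V : Matrix (ι ⊕ ι) (ι ⊕ ι) ℝ, V.IsSymm ∧
    ∀ ξ : ι ⊕ ι → ℝ,
      inner ℂ ψ (weyl ξ ψ) = ((Real.exp (-(1 / 4) * (ξ ⬝ᵥ (V *ᵥ ξ))) : ℝ) : ℂ)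

/-- The mean energy `Tr (|ψ⟩⟨ψ| H)` for the harmonic Hamiltonian `H = ½ ∑ (q_i² + p_i²)`,
as a quadratic form (`∞` outside the form domain of `H`). The momentum part is read off the
Fourier transform, under which `p_i` is multiplication by `2 π k_i`. -/
def energy (ψ : ModeSpace ι) : ℝ≥0∞ :=
  ∑ i, ((∫⁻ x : Config ι, ENNReal.ofReal ((1 / 2) * (x i) ^ 2 * ‖ψ x‖ ^ 2)) +
    ∫⁻ k : Config ι,
      ENNReal.ofReal ((1 / 2) * (2 * Real.pi * k i) ^ 2 * ‖(𝓕 ψ : ModeSpace ι) k‖ ^ 2))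

/-- `U` is a Gaussian unitary: in the Heisenberg picture it acts on the quadratures by an affine
symplectic map `U† R U = S R + d`, that is, `U† exp(i ξ·R) U = exp(i ξ·d) exp(i (Sᵀ ξ)·R)`. -/
def IsGaussianUnitary [DecidableEq ι] (U : ModeSpace ι ≃ₗᵢ[ℂ] ModeSpace ι) : Prop :=
  ∃ S ∈ Matrix.symplecticGroup ι ℝ, ∃ d : ι ⊕ ι → ℝ, ∀ (ξ : ι ⊕ ι → ℝ) (φ : ModeSpace ι),
    weyl ξ (U φ) =
      Complex.exp (Complex.I * ((ξ ⬝ᵥ d : ℝ) : ℂ)) • U (weyl (Sᵀ *ᵥ ξ) φ)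

/-- The modes that the labelling `P` assigns to the part `j`. -/
abbrev ModesOf {k : ℕ} (P : ι → Fin k) (j : Fin k) : Type := {i : ι // P i = j}

/-- The `k`-partitions of the set of modes: labellings by `Fin k` that leave no part empty. -/
def kPartitions (ι : Type) (k : ℕ) : Set (ι → Fin k) := {P | Function.Surjective P}

/-- `Ψ = ⨂ j, φ j` with respect to the splitting of the modes given by `P`. -/
def IsProductOf {k : ℕ} (P : ι → Fin k) (φ : (j : Fin k) → ModeSpace (ModesOf P j))
    (Ψ : ModeSpace ι) : Prop :=
  (Ψ : Config ι → ℂ) =ᵐ[volume]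
    fun x => ∏ j, φ j (WithLp.toLp 2 (fun i : ModesOf P j => x i.1))

/-- The pure state `ψ` is a product state across the partition `P`. -/
def IsProductAcross {k : ℕ} (P : ι → Fin k) (ψ : ModeSpace ι) : Prop :=
  ∃ φ : (j : Fin k) → ModeSpace (ModesOf P j), (∀ j, ‖φ j‖ = 1) ∧ IsProductOf P φ ψ

/-- `U = ⨂ j, U_j` where `U_j` is a Gaussian unitary on the modes of the part `j` of `P`. -/
def IsLocalGaussianUnitary [DecidableEq ι] {k : ℕ} (P : ι → Fin k)
    (U : ModeSpace ι ≃ₗᵢ[ℂ] ModeSpace ι) : Prop :=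
  ∃ u : (j : Fin k) → (ModeSpace (ModesOf P j) ≃ₗᵢ[ℂ] ModeSpace (ModesOf P j)),
    (∀ j, IsGaussianUnitary (u j)) ∧
    ∀ φ : (j : Fin k) → ModeSpace (ModesOf P j),
      ∃ Ψ : ModeSpace ι, IsProductOf P φ Ψ ∧ IsProductOf P (fun j => u j (φ j)) (U Ψ)

/-- Global Gaussian ergotropy: the energy minus the least energy under Gaussian unitaries. -/
def globalErgotropy [DecidableEq ι] (ψ : ModeSpace ι) : ℝ :=
  (energy ψ).toReal -
    (⨅ (U : ModeSpace ι ≃ₗᵢ[ℂ] ModeSpace ι) (_ : IsGaussianUnitary U), energy (U ψ)).toReal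

/-- `k`-local Gaussian ergotropy with respect to the partition `P`. -/
def localErgotropy [DecidableEq ι] {k : ℕ} (P : ι → Fin k) (ψ : ModeSpace ι) : ℝ :=
  (energy ψ).toReal -
    (⨅ (U : ModeSpace ι ≃ₗᵢ[ℂ] ModeSpace ι) (_ : IsLocalGaussianUnitary P U),
      energy (U ψ)).toReal

/-- The `k`-local ergotropic gap with respect to the partition `P`. -/
def ergotropicGap [DecidableEq ι] {k : ℕ} (P : ι → Fin k) (ψ : ModeSpace ι) : ℝ :=
  globalErgotropy ψ - localErgotropy P ψ

/-- The least `k`-local ergotropic gap over a (finite) set of admissible partitions. -/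
def minGap [DecidableEq ι] {k : ℕ} (C : Set (ι → Fin k)) (ψ : ModeSpace ι) : ℝ :=
  sInf ((fun P => ergotropicGap P ψ) '' C)

/-- The `k`-ergotropic score `Δ^k`: the least gap over all `k`-partitions of the modes. -/
def ergotropicScore [DecidableEq ι] (k : ℕ) (ψ : ModeSpace ι) : ℝ :=
  minGap (kPartitions ι k) ψ

end Modes

section Composite

variable {ι ι' : Type} [Fintype ι] [Fintype ι']

/-- The wave function of `ψ ⊗ ψ'`. -/
def tensorFun (ψ : Config ι → ℂ) (ψ' : Config ι' → ℂ) (x : Config (ι ⊕ ι')) : ℂ :=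
  ψ (WithLp.toLp 2 (fun i => x (Sum.inl i))) * ψ' (WithLp.toLp 2 (fun i => x (Sum.inr i)))

theorem measurePreserving_split :
    MeasurePreserving (fun x : Config (ι ⊕ ι') =>
      ((WithLp.toLp 2 (fun i => x (Sum.inl i)) : Config ι),
        (WithLp.toLp 2 (fun i => x (Sum.inr i)) : Config ι')))
      volume ((volume : Measure (Config ι)).prod (volume : Measure (Config ι'))) := by
  have h1 := PiLp.volume_preserving_ofLp (ι ⊕ ι')
  have h2 := volume_measurePreserving_sumPiEquivProdPi (fun _ : ι ⊕ ι' => ℝ)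
  have h3 := (PiLp.volume_preserving_toLp ι).prod (PiLp.volume_preserving_toLp ι')
  exact h3.comp (h2.comp h1)

theorem memLp_tensorFun (ψ : ModeSpace ι) (ψ' : ModeSpace ι') :
    MemLp (tensorFun ψ ψ') 2 (volume : Measure (Config (ι ⊕ ι'))) := by
  have hψ := Lp.memLp ψ
  have hψ' := Lp.memLp ψ'
  have key : MemLp (fun z : Config ι × Config ι' => ψ z.1 * ψ' z.2) 2
      ((volume : Measure (Config ι)).prod (volume : Measure (Config ι'))) := by
    refine ⟨hψ.1.comp_fst.mul hψ'.1.comp_snd, ?_⟩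
    have a := (eLpNorm_lt_top_iff_lintegral_rpow_enorm_lt_top (by norm_num) (by norm_num)).1 hψ.2
    have b := (eLpNorm_lt_top_iff_lintegral_rpow_enorm_lt_top (by norm_num) (by norm_num)).1 hψ'.2
    rw [eLpNorm_lt_top_iff_lintegral_rpow_enorm_lt_top (by norm_num) (by norm_num)]
    have : ∀ z : Config ι × Config ι', ‖ψ z.1 * ψ' z.2‖ₑ ^ (2 : ℝ≥0∞).toReal =
        ‖ψ z.1‖ₑ ^ (2 : ℝ≥0∞).toReal * ‖ψ' z.2‖ₑ ^ (2 : ℝ≥0∞).toReal := fun z => by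
      rw [enorm_mul, ENNReal.mul_rpow_of_nonneg _ _ (by norm_num)]
    simp_rw [this]
    rw [lintegral_prod_mul (hψ.1.enorm.pow_const _) (hψ'.1.enorm.pow_const _)]
    exact ENNReal.mul_lt_top a b
  exact key.comp_measurePreserving measurePreserving_split

/-- The tensor product `ψ ⊗ ψ'`, a state of the modes `ι ⊕ ι'`. -/
def tensor (ψ : ModeSpace ι) (ψ' : ModeSpace ι') : ModeSpace (ι ⊕ ι') :=
  (memLp_tensorFun ψ ψ').toLp (tensorFun ψ ψ')

/-- The `k`-partitions of a composite system obtained by pooling: the part `j` is the union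
`A_j ∪ A'_j`, where `A_1|…|A_k` is a `k`-partition of the modes of the first system and
`A'_1|…|A'_k` is a `k`-partition of the modes of the second one. -/
def pooledPartitions (ι ι' : Type) (k : ℕ) : Set (ι ⊕ ι' → Fin k) :=
  {Q | ∃ P ∈ kPartitions ι k, ∃ P' ∈ kPartitions ι' k, Q = Sum.elim P P'}

/-- The `k`-ergotropic score of a composite system shared by `k` parties, each of which holds
modes of both systems: the least gap over all pooled `k`-partitions. -/
def pooledErgotropicScore [DecidableEq ι] [DecidableEq ι'] (k : ℕ)
    (Ψ : ModeSpace (ι ⊕ ι')) : ℝ :=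
  minGap (pooledPartitions ι ι' k) Ψ

end Composite

end

set_option linter.unusedSectionVars false

noncomputable section

/-! ### Block matrices -/

/-! A Gaussian state with covariance matrix `V` and displacement `d` has energy `tr V / 4 + |d|² /
2`, and a Gaussian unitary with symplectic matrix `S` turns `V` into `S V Sᵀ`. The least global
energy is therefore a quarter of the least `tr (S V Sᵀ)` over symplectic `S`, the least local energy
a quarter of the least value over those `S` that are block diagonal for the partition, and the gap
is the difference of the two (`ergotropicGap_eq`).

Two facts translate between unitaries and matrices. A local Gaussian unitary implements a block
symplectic matrix, because product vectors span a dense subspace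
(`IsLocalGaussianUnitary.exists_implements`). Conversely `tr (S V Sᵀ)` depends on `S` only through
`Sᵀ S`, so block lower triangular matrices suffice (`exists_shearMatrix`); these are implemented by
explicit linear substitutions and chirps, and the full metaplectic representation is not needed.

Additivity rests on a criterion: a block symplectic `S` is minimal exactly when the block diagonal
part of `S V Sᵀ` commutes with `J`. Necessity is the first-order condition along symplectic
transvections (`commute_pinch_of_isMin`), sufficiency a trace inequality
(`trace_le_trace_symplectic`). The criterion passes to direct sums, so least traces add.

For faithfulness, the covariance matrix of a product state is block diagonal, the pinching does
nothing, and a local minimiser meets the global criterion. If conversely the gap is zero, then `W =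
S V Sᵀ` at a local minimiser commutes with `J`; purity makes `W` symplectic
(`HasGaussianChar.exists_symplectic_eq_one`), and a positive definite symplectic matrix commuting
with `J` is `1`. A local unitary thus carries the state to a multiple of the vacuum, which is a
product. Purity enters through the rank-one form `ψ (x + b) * conj (ψ x)` of the correlation kernel,
which forces the normal form of the covariance matrix to be `1`. -/

theorem trace_conj_eq {n : Type*} [Fintype n] (S V : Matrix n n ℝ) :
    (S * V * Sᵀ).trace = (V * (Sᵀ * S)).trace := by
  rw [Matrix.mul_assoc, trace_mul_comm, Matrix.mul_assoc]

section Block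

variable {n : Type*} [Fintype n] [DecidableEq n]

/-- `M` is block diagonal with respect to the level sets of the labelling `c`. -/
def IsBlock (c : n → ℝ) (M : Matrix n n ℝ) : Prop := Commute M (diagonal c)

/-- Commutation with a diagonal matrix makes products, inverses and functional calculus immediate;
the entrywise form serves for computations. -/
theorem isBlock_iff {c : n → ℝ} {M : Matrix n n ℝ} :
    IsBlock c M ↔ ∀ x y, c x ≠ c y → M x y = 0 := by
  simp only [IsBlock, Commute, SemiconjBy, ← Matrix.ext_iff, mul_diagonal, diagonal_mul]
  refine forall₂_congr fun x y => ?_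
  constructor
  · intro h hne
    have : (c x - c y) * M x y = 0 := by linear_combination -h
    exact (mul_eq_zero.1 this).resolve_left (sub_ne_zero.2 hne)
  · intro h
    by_cases hne : c x = c y
    · rw [hne, mul_comm]
    · simp [h hne]

theorem IsBlock.mul {c : n → ℝ} {M N : Matrix n n ℝ} (hM : IsBlock c M) (hN : IsBlock c N) :
    IsBlock c (M * N) := Commute.mul_left hM hN

theorem IsBlock.transpose {c : n → ℝ} {M : Matrix n n ℝ} (hM : IsBlock c M) : IsBlock c Mᵀ :=
  isBlock_iff.2 fun x y h => isBlock_iff.1 hM y x (Ne.symm h)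

theorem IsBlock.inv {c : n → ℝ} {M : Matrix n n ℝ} (hM : IsBlock c M) : IsBlock c M⁻¹ := by
  by_cases h : IsUnit M.det
  · have hM' : M * diagonal c = diagonal c * M := hM
    calc M⁻¹ * diagonal c = M⁻¹ * (diagonal c * M) * M⁻¹ := by
          rw [Matrix.mul_assoc, Matrix.mul_assoc, mul_nonsing_inv _ h, Matrix.mul_one]
      _ = diagonal c * M⁻¹ := by
          rw [← hM', ← Matrix.mul_assoc, nonsing_inv_mul _ h, Matrix.one_mul]
  · rw [nonsing_inv_apply_not_isUnit _ h]
    exact Commute.zero_left _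

theorem isBlock_one (c : n → ℝ) : IsBlock c (1 : Matrix n n ℝ) := Commute.one_left _

theorem isBlock_const (a : ℝ) (M : Matrix n n ℝ) : IsBlock (fun _ => a) M :=
  isBlock_iff.2 fun _ _ h => absurd rfl h

theorem isClosed_isBlock (c : n → ℝ) : IsClosed {M : Matrix n n ℝ | IsBlock c M} :=
  isClosed_eq (by fun_prop) (by fun_prop)

/-- A positive definite block matrix has a block diagonal symmetric square root. -/
theorem IsBlock.exists_sqrt {c : n → ℝ} {W : Matrix n n ℝ} (hc : IsBlock c W) (hW : W.PosDef) :
    ∃ A : Matrix n n ℝ, IsBlock c A ∧ Aᵀ = A ∧ A * A = W := by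
  open scoped MatrixOrder in
  refine ⟨cfc Real.sqrt W, ?_, ?_, ?_⟩
  -- The functional calculus of `W` commutes with everything that `W` commutes with, so the root
  -- inherits the blocks.
  · exact IsSelfAdjoint.commute_cfc hW.isHermitian.isSelfAdjoint hc Real.sqrt
  · have : IsSelfAdjoint (cfc Real.sqrt W) := cfc_predicate _ _
    simpa [IsSelfAdjoint, star_eq_conjTranspose, conjTranspose_eq_transpose_of_trivial] using this
  · have hs : IsSelfAdjoint W := hW.isHermitian.isSelfAdjoint
    have hfin : (spectrum ℝ W).Finite := Matrix.finite_real_spectrum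
    rw [← cfc_mul (R := ℝ) Real.sqrt Real.sqrt W]
    conv_rhs => rw [← cfc_id ℝ W]
    refine cfc_congr fun x hx => ?_
    have : 0 ≤ x := spectrum_nonneg_of_nonneg hW.posSemidef.nonneg hx
    simp [Real.mul_self_sqrt this]

/-- The block diagonal part of a matrix. -/
def pinch (c : n → ℝ) (M : Matrix n n ℝ) : Matrix n n ℝ := of fun x y => if c x = c y then M x y else 0

theorem IsBlock.pinch_eq {c : n → ℝ} {M : Matrix n n ℝ} (hM : IsBlock c M) : pinch c M = M := by
  ext x y
  by_cases h : c x = c y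
  · simp [pinch, h]
  · simp [pinch, h, isBlock_iff.1 hM x y h]

/-- In `tr (M N)` the entries of `M` outside the blocks meet only zeros of `N`. -/
theorem trace_pinch_mul {c : n → ℝ} {M N : Matrix n n ℝ} (hN : IsBlock c N) :
    (pinch c M * N).trace = (M * N).trace := by
  simp only [trace, diag, mul_apply]
  refine Finset.sum_congr rfl fun x _ => Finset.sum_congr rfl fun y _ => ?_
  by_cases h : c x = c y
  · simp [pinch, h]
  · simp [isBlock_iff.1 hN y x (Ne.symm h)]

theorem trace_pinch (c : n → ℝ) (M : Matrix n n ℝ) : (pinch c M).trace = M.trace := by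
  simpa using trace_pinch_mul (M := M) (isBlock_one c)

/-- As `Sᵀ S` is again block diagonal, the trace of a block congruence does not see the off-diagonal
blocks of `V`. -/
theorem IsBlock.trace_conj_pinch {c : n → ℝ} {S V : Matrix n n ℝ} (hS : IsBlock c S) :
    (S * pinch c V * Sᵀ).trace = (S * V * Sᵀ).trace := by
  rw [trace_conj_eq, trace_conj_eq, trace_pinch_mul (hS.transpose.mul hS)]

/-- The pinching is the sum of the compressions of `V` by the coordinate projections onto the level
sets of `c`. -/
theorem posSemidef_pinch {c : n → ℝ} {V : Matrix n n ℝ} (hV : V.PosSemidef) :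
    (pinch c V).PosSemidef := by
  classical
  have key : pinch c V = ∑ a ∈ Finset.univ.image c,
      (diagonal fun x => if c x = a then (1 : ℝ) else 0) * V *
        (diagonal fun x => if c x = a then (1 : ℝ) else 0)ᴴ := by
    ext x y
    simp only [pinch, of_apply, Matrix.sum_apply, diagonal_conjTranspose, mul_diagonal, diagonal_mul,
      star_trivial]
    rw [Finset.sum_eq_single (c x)]
    · simp [eq_comm]
    · intro a _ ha
      simp [Ne.symm ha]
    · intro h
      exact absurd (Finset.mem_image_of_mem c (Finset.mem_univ x)) h
  rw [key]
  exact posSemidef_sum _ fun a _ => hV.mul_mul_conjTranspose_same _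

end Block

/-! ### Minimal trace on symplectic orbits -/

section Symplectic

variable {ι : Type*} [Fintype ι] [DecidableEq ι]

theorem J_mul_self : J ι ℝ * J ι ℝ = -1 := J_squared ι ℝ

theorem isBlock_J (c : ι → ℝ) : IsBlock (Sum.elim c c) (J ι ℝ) :=
  isBlock_iff.2 fun x y h => by
    rcases x with x | x <;> rcases y with y | y <;> simp only [J, fromBlocks_apply₁₁,
      fromBlocks_apply₁₂, fromBlocks_apply₂₁, fromBlocks_apply₂₂, Matrix.zero_apply,
      Matrix.neg_apply, Sum.elim_inl, Sum.elim_inr] at h ⊢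
    · rw [one_apply_ne (fun e => h (by rw [e])), neg_zero]
    · rw [one_apply_ne (fun e => h (by rw [e]))]

theorem transpose_mul_J_mul {T : Matrix (ι ⊕ ι) (ι ⊕ ι) ℝ} (hT : T ∈ symplecticGroup ι ℝ) :
    Tᵀ * J ι ℝ * T = J ι ℝ := SymplecticGroup.mem_iff'.1 hT

/-- If a positive matrix commutes with `J`, no symplectic congruence lowers its trace. -/
theorem trace_le_trace_symplectic {M T : Matrix (ι ⊕ ι) (ι ⊕ ι) ℝ} (hM : M.PosSemidef)
    (hJ : Commute M (J ι ℝ)) (hT : T ∈ symplecticGroup ι ℝ) :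
    M.trace ≤ (T * M * Tᵀ).trace := by
  have hT' := transpose_mul_J_mul hT
  have hJ' : M * J ι ℝ = J ι ℝ * M := hJ
  have hJJ := J_mul_self (ι := ι)
  -- For symplectic `T` one has `J T J = -(Tᵀ)⁻¹`, so this matrix measures how far `T` is from
  -- orthogonal. Expanding the trace gives `2 tr (T M Tᵀ) - 2 tr M`: the second square equals the
  -- first because `M` commutes with `J`, and each cross term is `-tr M`.
  have h0 : 0 ≤ ((T + J ι ℝ * T * J ι ℝ) * M * (T + J ι ℝ * T * J ι ℝ)ᵀ).trace := by
    simpa only [conjTranspose_eq_transpose_of_trivial] using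
      (hM.mul_mul_conjTranspose_same (T + J ι ℝ * T * J ι ℝ)).trace_nonneg
  have e1 : (J ι ℝ * T * J ι ℝ * M * (J ι ℝ * T * J ι ℝ)ᵀ).trace = (T * M * Tᵀ).trace := by
    have : J ι ℝ * T * J ι ℝ * M * (J ι ℝ * T * J ι ℝ)ᵀ
        = J ι ℝ * (T * (J ι ℝ * M * (-J ι ℝ)) * Tᵀ * (J ι ℝ)ᵀ) := by
      simp only [transpose_mul, J_transpose]; noncomm_ring
    rw [this, trace_mul_comm, Matrix.mul_assoc, Matrix.mul_assoc, J_transpose, ← hJ',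
      Matrix.mul_assoc M, Matrix.mul_neg, hJJ, neg_neg, Matrix.neg_mul, hJJ]
    simp [Matrix.mul_assoc]
  have e2 : (T * M * (J ι ℝ * T * J ι ℝ)ᵀ).trace = -M.trace := by
    have : T * M * (J ι ℝ * T * J ι ℝ)ᵀ = T * (M * J ι ℝ * (Tᵀ * J ι ℝ)) := by
      simp only [transpose_mul, J_transpose]; noncomm_ring
    rw [this, trace_mul_comm, Matrix.mul_assoc, hT', Matrix.mul_assoc, hJJ]
    simp
  have e3 : (J ι ℝ * T * J ι ℝ * M * Tᵀ).trace = -M.trace := by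
    rw [← e2, ← trace_transpose]
    have hs : Mᵀ = M := by simpa using hM.isHermitian.eq
    simp only [transpose_mul, transpose_transpose, hs, Matrix.mul_assoc]
  rw [transpose_add, Matrix.add_mul, Matrix.mul_add, Matrix.add_mul, Matrix.add_mul] at h0
  simp only [trace_add, e1, e2, e3] at h0
  linarith

theorem exists_transpose_mul_self_of_posDef {n : Type*} [Fintype n] [DecidableEq n]
    {V : Matrix n n ℝ} (hV : V.PosDef) : ∃ B : Matrix n n ℝ, IsUnit B ∧ V = Bᵀ * B := by
  obtain ⟨A, -, hA, h⟩ := (isBlock_const (0 : ℝ) V).exists_sqrt hV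
  refine ⟨A, ?_, by rw [hA, h]⟩
  have : IsUnit (A * A) := h ▸ hV.isUnit
  exact isUnit_of_mul_isUnit_left this

/-- With `V = Bᵀ B`, the trace is the squared Frobenius norm of `S Bᵀ`. Its sublevel sets are
bounded because `B` is invertible, the block symplectic matrices form a closed set, and a minimum
exists by compactness. -/
theorem exists_minimizer {c : ι → ℝ} {V : Matrix (ι ⊕ ι) (ι ⊕ ι) ℝ} (hV : V.PosDef) :
    ∃ S ∈ symplecticGroup ι ℝ, IsBlock (Sum.elim c c) S ∧
      ∀ T ∈ symplecticGroup ι ℝ, IsBlock (Sum.elim c c) T →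
        (S * V * Sᵀ).trace ≤ (T * V * Tᵀ).trace := by
  obtain ⟨B, hB, rfl⟩ := exists_transpose_mul_self_of_posDef hV
  set V := Bᵀ * B with hVdef
  let K : Set (Matrix (ι ⊕ ι) (ι ⊕ ι) ℝ) := {S | S * J ι ℝ * Sᵀ = J ι ℝ ∧
    IsBlock (Sum.elim c c) S ∧ (S * V * Sᵀ).trace ≤ V.trace}
  have hclosed : IsClosed K :=
    (isClosed_eq (f := fun S : Matrix (ι ⊕ ι) (ι ⊕ ι) ℝ => S * J ι ℝ * Sᵀ) (by fun_prop)
      continuous_const).inter ((isClosed_isBlock _).inter (isClosed_le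
        (f := fun S : Matrix (ι ⊕ ι) (ι ⊕ ι) ℝ => (S * V * Sᵀ).trace) (by fun_prop)
        continuous_const))
  -- An entry of `S Bᵀ` has square at most `tr V`, hence modulus at most `tr V + 1`, whether or not
  -- `tr V` exceeds `1`.
  let C : Set (Matrix (ι ⊕ ι) (ι ⊕ ι) ℝ) :=
    Set.univ.pi fun _ => Set.univ.pi fun _ => Set.Icc (-(V.trace + 1)) (V.trace + 1)
  have hC : IsCompact C := isCompact_univ_pi fun _ => isCompact_univ_pi fun _ => isCompact_Icc
  have hdet : IsUnit Bᵀ.det := by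
    rw [det_transpose]; exact (Matrix.isUnit_iff_isUnit_det B).1 hB
  have hsub : K ⊆ (fun R : Matrix (ι ⊕ ι) (ι ⊕ ι) ℝ => R * (Bᵀ)⁻¹) '' C := by
    rintro S ⟨-, -, hS⟩
    refine ⟨S * Bᵀ, ?_, by simp [Matrix.mul_assoc, Matrix.mul_nonsing_inv _ hdet]⟩
    intro x _ y _
    have e : (S * V * Sᵀ).trace = ∑ x, ∑ y, (S * Bᵀ) x y ^ 2 := by
      have : S * V * Sᵀ = (S * Bᵀ) * (S * Bᵀ)ᵀ := by
        simp [hVdef, Matrix.mul_assoc]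
      rw [this]
      simp only [trace, diag, mul_apply (M := S * Bᵀ), transpose_apply, sq]
    have h1 : (S * Bᵀ) x y ^ 2 ≤ V.trace := by
      refine le_trans ?_ (e ▸ hS)
      refine le_trans ?_ (Finset.single_le_sum
        (f := fun x => ∑ y, (S * Bᵀ) x y ^ 2) (fun _ _ => by positivity) (Finset.mem_univ x))
      exact Finset.single_le_sum (f := fun y => (S * Bᵀ) x y ^ 2)
        (fun _ _ => by positivity) (Finset.mem_univ y)
    exact abs_le.1 (abs_le_of_sq_le_sq (by nlinarith [sq_nonneg ((S * Bᵀ) x y)])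
      (by nlinarith [sq_nonneg ((S * Bᵀ) x y)]))
  have hK : IsCompact K := (hC.image (by fun_prop)).of_isClosed_subset hclosed hsub
  have h1K : (1 : Matrix (ι ⊕ ι) (ι ⊕ ι) ℝ) ∈ K := ⟨by simp, isBlock_one _, by simp⟩
  obtain ⟨S, hS, hmin⟩ := hK.exists_isMinOn ⟨1, h1K⟩
    (f := fun S => (S * V * Sᵀ).trace) (by fun_prop)
  refine ⟨S, SymplecticGroup.mem_iff.2 hS.1, hS.2.1, fun T hT hTb => ?_⟩
  by_cases h : (T * V * Tᵀ).trace ≤ V.trace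
  · exact hmin ⟨SymplecticGroup.mem_iff.1 hT, hTb, h⟩
  · exact hS.2.2.trans (not_le.1 h).le

/-- The symplectic transvection along `v` with parameter `t`. -/
def transvec (v : ι ⊕ ι → ℝ) (t : ℝ) : Matrix (ι ⊕ ι) (ι ⊕ ι) ℝ :=
  1 + t • vecMulVec v (J ι ℝ *ᵥ v)

theorem dotProduct_J_mulVec_self (v : ι ⊕ ι → ℝ) : v ⬝ᵥ (J ι ℝ *ᵥ v) = 0 := by
  have h : v ⬝ᵥ (J ι ℝ *ᵥ v) = -(v ⬝ᵥ (J ι ℝ *ᵥ v)) := by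
    conv_lhs => rw [dotProduct_mulVec, ← mulVec_transpose, J_transpose, neg_mulVec,
      neg_dotProduct, dotProduct_comm]
  linarith

theorem transvec_mem (v : ι ⊕ ι → ℝ) (t : ℝ) : transvec v t ∈ symplecticGroup ι ℝ := by
  rw [SymplecticGroup.mem_iff, transvec]
  have a : vecMulVec v (J ι ℝ *ᵥ v) * J ι ℝ = vecMulVec v v := by
    rw [vecMulVec_mul, ← mulVec_transpose, J_transpose, mulVec_mulVec, Matrix.neg_mul, J_squared]
    simp
  have b : (vecMulVec v (J ι ℝ *ᵥ v))ᵀ = vecMulVec (J ι ℝ *ᵥ v) v := transpose_vecMulVec _ _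
  have d : J ι ℝ * vecMulVec (J ι ℝ *ᵥ v) v = -vecMulVec v v := by
    rw [mul_vecMulVec, mulVec_mulVec, J_squared]
    simp [neg_mulVec, neg_vecMulVec]
  have e : vecMulVec v v * vecMulVec (J ι ℝ *ᵥ v) v = 0 := by
    rw [vecMulVec_mul_vecMulVec, dotProduct_J_mulVec_self]
    simp
  simp only [transpose_add, transpose_one, transpose_smul, b, Matrix.add_mul, Matrix.mul_add,
    Matrix.one_mul, Matrix.mul_one, Matrix.smul_mul, Matrix.mul_smul, a, d, e]
  simp

/-- A quadratic polynomial in `t`; at a minimum its linear coefficient must vanish. -/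
theorem trace_transvec (V : Matrix (ι ⊕ ι) (ι ⊕ ι) ℝ) (hV : Vᵀ = V) (v : ι ⊕ ι → ℝ) (t : ℝ) :
    (transvec v t * V * (transvec v t)ᵀ).trace = V.trace + 2 * t * (v ⬝ᵥ (V *ᵥ (J ι ℝ *ᵥ v)))
      + t ^ 2 * ((v ⬝ᵥ v) * ((J ι ℝ *ᵥ v) ⬝ᵥ (V *ᵥ (J ι ℝ *ᵥ v)))) := by
  have b : (vecMulVec v (J ι ℝ *ᵥ v))ᵀ = vecMulVec (J ι ℝ *ᵥ v) v := transpose_vecMulVec _ _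
  simp only [transvec, transpose_add, transpose_one, transpose_smul, b, Matrix.add_mul,
    Matrix.mul_add, Matrix.one_mul, Matrix.mul_one, Matrix.smul_mul, Matrix.mul_smul, trace_add,
    trace_smul, vecMulVec_mul, mul_vecMulVec, trace_vecMulVec, ← mulVec_transpose, hV, smul_eq_mul]
  set w := J ι ℝ *ᵥ v
  have h1 : (V *ᵥ w) ⬝ᵥ v = v ⬝ᵥ (V *ᵥ w) := dotProduct_comm _ _
  have h2 : vecMulVec v (V *ᵥ w) *ᵥ w = (w ⬝ᵥ (V *ᵥ w)) • v := by
    rw [vecMulVec_mulVec, dotProduct_comm]; simp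
  rw [add_mulVec, add_dotProduct, smul_mulVec, h2, h1, smul_dotProduct, smul_dotProduct]
  simp only [smul_eq_mul]
  ring

theorem isBlock_transvec {c : ι → ℝ} {v : ι ⊕ ι → ℝ} {a : ℝ}
    (hv : ∀ x, Sum.elim c c x ≠ a → v x = 0) (t : ℝ) :
    IsBlock (Sum.elim c c) (transvec v t) := by
  have hw : ∀ x, Sum.elim c c x ≠ a → (J ι ℝ *ᵥ v) x = 0 := fun x hx =>
    Finset.sum_eq_zero fun y _ => by
      by_cases h : Sum.elim c c x = Sum.elim c c y
      · rw [hv y (h ▸ hx), mul_zero]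
      · exact mul_eq_zero_of_left (isBlock_iff.1 (isBlock_J c) x y h) _
  refine isBlock_iff.2 fun x y h => ?_
  rw [transvec, Matrix.add_apply, Matrix.smul_apply, vecMulVec_apply,
    one_apply_ne (fun e => h (by rw [e]))]
  by_cases hx : Sum.elim c c x = a
  · rw [hw y (fun e => h (hx.trans e.symm))]; simp
  · rw [hv x hx]; simp

theorem eq_zero_of_forall_quadratic_nonneg {b d : ℝ} (h : ∀ t : ℝ, 0 ≤ 2 * t * b + t ^ 2 * d) :
    b = 0 := by
  have hd : 0 ≤ d := by
    have h1 := h 1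
    have h2 := h (-1)
    linarith
  -- The natural choice `-b / d` fails for `d = 0`; `d + 1` covers that case and still gives a
  -- negative value when `b ≠ 0`.
  have := h (-b / (d + 1))
  have hpos : 0 < d + 1 := by linarith
  have e : 2 * (-b / (d + 1)) * b + (-b / (d + 1)) ^ 2 * d
      = -(b ^ 2 * (d + 2)) / (d + 1) ^ 2 := by
    field_simp; ring
  rw [e] at this
  by_contra hb
  have hb2 : 0 < b ^ 2 := by positivity
  have : -(b ^ 2 * (d + 2)) / (d + 1) ^ 2 < 0 := by
    apply div_neg_of_neg_of_pos
    · nlinarith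
    · positivity
  linarith

/-- Transvections along vectors supported in one block are admissible, and their first-order
condition is `vᵀ V J v = 0`. Hence the diagonal blocks of `V J` are antisymmetric, which for the
symmetric pinching of `V` means that it commutes with `J`. -/
theorem commute_pinch_of_isMin {c : ι → ℝ} {V : Matrix (ι ⊕ ι) (ι ⊕ ι) ℝ} (hV : Vᵀ = V)
    (hmin : ∀ T ∈ symplecticGroup ι ℝ, IsBlock (Sum.elim c c) T →
        V.trace ≤ (T * V * Tᵀ).trace) :
    Commute (pinch (Sum.elim c c) V) (J ι ℝ) := by
  have key : ∀ (a : ℝ) (v : ι ⊕ ι → ℝ), (∀ x, Sum.elim c c x ≠ a → v x = 0) →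
      v ⬝ᵥ ((V * J ι ℝ) *ᵥ v) = 0 := fun a v hv => by
    rw [← mulVec_mulVec]
    refine eq_zero_of_forall_quadratic_nonneg
      (d := (v ⬝ᵥ v) * ((J ι ℝ *ᵥ v) ⬝ᵥ (V *ᵥ (J ι ℝ *ᵥ v)))) fun t => ?_
    have := hmin _ (transvec_mem v t) (isBlock_transvec hv t)
    rw [trace_transvec V hV] at this
    linarith
  have hsingle : ∀ x y, (Pi.single x (1 : ℝ)) ⬝ᵥ ((V * J ι ℝ) *ᵥ Pi.single y 1)
      = (V * J ι ℝ) x y := fun x y => by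
    rw [mulVec_single_one, single_one_dotProduct]; rfl
  -- Polarisation of the quadratic identity on two basis vectors of one block.
  have hpair : ∀ x y, Sum.elim c c x = Sum.elim c c y →
      (V * J ι ℝ) x y + (V * J ι ℝ) y x = 0 := fun x y hxy => by
    have hx := key (Sum.elim c c x) (Pi.single x 1) fun z hz =>
      Pi.single_eq_of_ne (fun e => hz (by rw [e])) _
    have hy := key (Sum.elim c c x) (Pi.single y 1) fun z hz =>
      Pi.single_eq_of_ne (fun e => hz (by rw [e, hxy])) _
    have hs := key (Sum.elim c c x) (Pi.single x 1 + Pi.single y 1) fun z hz => by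
      rw [Pi.add_apply, Pi.single_eq_of_ne (fun e => hz (by rw [e])) _,
        Pi.single_eq_of_ne (fun e => hz (by rw [e, hxy])) _, add_zero]
    rw [mulVec_add, add_dotProduct, dotProduct_add, dotProduct_add] at hs
    simp only [hsingle] at hx hy hs
    linarith
  have hpin : pinch (Sum.elim c c) V * J ι ℝ = pinch (Sum.elim c c) (V * J ι ℝ) := by
    ext x y
    simp only [mul_apply, pinch, of_apply]
    split_ifs with h
    · refine Finset.sum_congr rfl fun z _ => ?_
      split_ifs with h'
      · rfl
      · rw [isBlock_iff.1 (isBlock_J c) z y (fun e => h' (h.trans e.symm)), mul_zero, mul_zero]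
    · refine Finset.sum_eq_zero fun z _ => ?_
      split_ifs with h'
      · rw [isBlock_iff.1 (isBlock_J c) z y (fun e => h (h'.trans e)), mul_zero]
      · rw [zero_mul]
  have hanti : (pinch (Sum.elim c c) V * J ι ℝ)ᵀ = -(pinch (Sum.elim c c) V * J ι ℝ) := by
    rw [hpin]
    ext x y
    simp only [transpose_apply, Matrix.neg_apply, pinch, of_apply]
    by_cases h : Sum.elim c c x = Sum.elim c c y
    · rw [if_pos h, if_pos h.symm]
      have := hpair x y h
      linarith
    · rw [if_neg h, if_neg (Ne.symm h), neg_zero]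
  have hsymm : (pinch (Sum.elim c c) V)ᵀ = pinch (Sum.elim c c) V := by
    ext x y
    simp only [transpose_apply, pinch, of_apply, eq_comm (a := Sum.elim c c y)]
    rw [show V y x = V x y from congrFun₂ hV x y]
  rw [transpose_mul, hsymm, J_transpose, Matrix.neg_mul, neg_inj] at hanti
  exact hanti.symm

/-- A block symplectic matrix that brings the diagonal blocks of `V` to a form commuting with `J`
realises the least trace among block symplectic congruences. -/
theorem exists_isBlock_commute_pinch {c : ι → ℝ} {V : Matrix (ι ⊕ ι) (ι ⊕ ι) ℝ} (hV : V.PosDef) :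
    ∃ S ∈ symplecticGroup ι ℝ, IsBlock (Sum.elim c c) S ∧
      Commute (pinch (Sum.elim c c) (S * V * Sᵀ)) (J ι ℝ) := by
  obtain ⟨S, hS, hSb, hmin⟩ := exists_minimizer (c := c) hV
  have hs : Vᵀ = V := by simpa using hV.isHermitian.eq
  -- Replacing `V` by `S V Sᵀ` moves the minimiser to the identity, where the first-order condition
  -- applies.
  refine ⟨S, hS, hSb, commute_pinch_of_isMin (by simp [Matrix.mul_assoc, hs]) fun T hT hTb => ?_⟩
  have := hmin (T * S) (Submonoid.mul_mem _ hT hS) (hTb.mul hSb)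
  simpa [Matrix.mul_assoc] using this

/-- The least trace of a congruence of `V` by a block symplectic matrix. -/
def IsMinTrace (c : ι → ℝ) (V : Matrix (ι ⊕ ι) (ι ⊕ ι) ℝ) (m : ℝ) : Prop :=
  IsLeast {r | ∃ S ∈ symplecticGroup ι ℝ, IsBlock (Sum.elim c c) S ∧ (S * V * Sᵀ).trace = r} m

theorem inv_mem_symplectic {S : Matrix (ι ⊕ ι) (ι ⊕ ι) ℝ} (hS : S ∈ symplecticGroup ι ℝ) :
    S⁻¹ ∈ symplecticGroup ι ℝ := by
  have := (⟨S, hS⟩ : symplecticGroup ι ℝ)⁻¹.2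
  rwa [SymplecticGroup.coe_inv'] at this

/-- Any competitor is `T = (T S⁻¹) S`. The block matrix `T S⁻¹` acts on `S V Sᵀ` with the same trace
as on its pinching, and there the trace inequality for matrices commuting with `J` applies. -/
theorem isMinTrace_of_commute {c : ι → ℝ} {V S : Matrix (ι ⊕ ι) (ι ⊕ ι) ℝ} (hV : V.PosSemidef)
    (hS : S ∈ symplecticGroup ι ℝ) (hSb : IsBlock (Sum.elim c c) S)
    (hJ : Commute (pinch (Sum.elim c c) (S * V * Sᵀ)) (J ι ℝ)) :
    IsMinTrace c V (S * V * Sᵀ).trace := by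
  refine ⟨⟨S, hS, hSb, rfl⟩, ?_⟩
  rintro _ ⟨T, hT, hTb, rfl⟩
  have hdet := SymplecticGroup.symplectic_det hS
  have hpsd : (S * V * Sᵀ).PosSemidef := by
    simpa using hV.mul_mul_conjTranspose_same S
  have h := trace_le_trace_symplectic (posSemidef_pinch hpsd) hJ
    (Submonoid.mul_mem _ hT (inv_mem_symplectic hS))
  rw [trace_pinch, (hTb.mul hSb.inv).trace_conj_pinch] at h
  refine h.trans_eq ?_
  congr 1
  have h2 : S⁻¹ * S = 1 := nonsing_inv_mul _ hdet
  calc T * S⁻¹ * (S * V * Sᵀ) * (T * S⁻¹)ᵀ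
      = T * (S⁻¹ * S) * V * (S⁻¹ * S)ᵀ * Tᵀ := by
        simp only [transpose_mul, Matrix.mul_assoc]
    _ = T * V * Tᵀ := by simp [h2]

/-! ### Direct sums -/

section DirectSum

variable {ι' : Type*} [Fintype ι'] [DecidableEq ι']

/-- The regrouping of the quadratures of a composite system. -/
def quadEquiv (ι ι' : Type*) : (ι ⊕ ι') ⊕ (ι ⊕ ι') ≃ (ι ⊕ ι) ⊕ (ι' ⊕ ι') :=
  Equiv.sumSumSumComm ι ι' ι ι'

/-- The direct sum of two matrices on phase spaces. -/
def phaseSum (V : Matrix (ι ⊕ ι) (ι ⊕ ι) ℝ) (V' : Matrix (ι' ⊕ ι') (ι' ⊕ ι') ℝ) :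
    Matrix ((ι ⊕ ι') ⊕ (ι ⊕ ι')) ((ι ⊕ ι') ⊕ (ι ⊕ ι')) ℝ :=
  (fromBlocks V 0 0 V').submatrix (quadEquiv ι ι') (quadEquiv ι ι')

theorem phaseSum_mul (V W : Matrix (ι ⊕ ι) (ι ⊕ ι) ℝ) (V' W' : Matrix (ι' ⊕ ι') (ι' ⊕ ι') ℝ) :
    phaseSum V V' * phaseSum W W' = phaseSum (V * W) (V' * W') := by
  simp [phaseSum, submatrix_mul_equiv, fromBlocks_multiply]

theorem phaseSum_transpose (V : Matrix (ι ⊕ ι) (ι ⊕ ι) ℝ) (V' : Matrix (ι' ⊕ ι') (ι' ⊕ ι') ℝ) :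
    (phaseSum V V')ᵀ = phaseSum Vᵀ V'ᵀ := by
  simp [phaseSum, fromBlocks_transpose]

theorem phaseSum_J : phaseSum (J ι ℝ) (J ι' ℝ) = J (ι ⊕ ι') ℝ := by
  ext x y
  rcases x with (x | x) | (x | x) <;> rcases y with (y | y) | (y | y) <;>
    simp [phaseSum, quadEquiv, J, one_apply]

theorem trace_phaseSum (V : Matrix (ι ⊕ ι) (ι ⊕ ι) ℝ) (V' : Matrix (ι' ⊕ ι') (ι' ⊕ ι') ℝ) :
    (phaseSum V V').trace = V.trace + V'.trace := by
  simp only [phaseSum, trace, diag, submatrix_apply]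
  rw [Equiv.sum_comp (quadEquiv ι ι') (fun x => fromBlocks V 0 0 V' x x)]
  simp

theorem phaseSum_mem {S : Matrix (ι ⊕ ι) (ι ⊕ ι) ℝ} {S' : Matrix (ι' ⊕ ι') (ι' ⊕ ι') ℝ}
    (hS : S ∈ symplecticGroup ι ℝ) (hS' : S' ∈ symplecticGroup ι' ℝ) :
    phaseSum S S' ∈ symplecticGroup (ι ⊕ ι') ℝ := by
  rw [SymplecticGroup.mem_iff] at *
  rw [← phaseSum_J, phaseSum_transpose, phaseSum_mul, phaseSum_mul, hS, hS']

theorem isBlock_phaseSum {c : ι → ℝ} {c' : ι' → ℝ} {S : Matrix (ι ⊕ ι) (ι ⊕ ι) ℝ}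
    {S' : Matrix (ι' ⊕ ι') (ι' ⊕ ι') ℝ}
    (hS : IsBlock (Sum.elim c c) S) (hS' : IsBlock (Sum.elim c' c') S') :
    IsBlock (Sum.elim (Sum.elim c c') (Sum.elim c c')) (phaseSum S S') := by
  rw [isBlock_iff] at *
  intro x y h
  rcases x with (x | x) | (x | x) <;> rcases y with (y | y) | (y | y) <;>
    first
      | rfl
      | exact hS _ _ h
      | exact hS' _ _ h

/-- Modes of the two systems may carry the same label, and then the pinching keeps their cross
entries; in a direct sum these are zero anyway. This is why pooling parts costs nothing. -/
theorem pinch_phaseSum (c : ι → ℝ) (c' : ι' → ℝ) (V : Matrix (ι ⊕ ι) (ι ⊕ ι) ℝ)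
    (V' : Matrix (ι' ⊕ ι') (ι' ⊕ ι') ℝ) :
    pinch (Sum.elim (Sum.elim c c') (Sum.elim c c')) (phaseSum V V') =
      phaseSum (pinch (Sum.elim c c) V) (pinch (Sum.elim c' c') V') := by
  ext x y
  rcases x with (x | x) | (x | x) <;> rcases y with (y | y) | (y | y) <;>
    first
      | rfl
      | exact ite_self _

theorem posSemidef_phaseSum {V : Matrix (ι ⊕ ι) (ι ⊕ ι) ℝ} {V' : Matrix (ι' ⊕ ι') (ι' ⊕ ι') ℝ}
    (hV : V.PosSemidef) (hV' : V'.PosSemidef) : (phaseSum V V').PosSemidef := by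
  refine PosSemidef.submatrix ?_ _
  refine .of_dotProduct_mulVec_nonneg ?_ fun x => ?_
  · exact IsHermitian.fromBlocks hV.isHermitian (by simp) hV'.isHermitian
  · have h1 := hV.dotProduct_mulVec_nonneg (x ∘ Sum.inl)
    have h2 := hV'.dotProduct_mulVec_nonneg (x ∘ Sum.inr)
    have : star x ⬝ᵥ (fromBlocks V 0 0 V' *ᵥ x) =
        star (x ∘ Sum.inl) ⬝ᵥ (V *ᵥ (x ∘ Sum.inl)) + star (x ∘ Sum.inr) ⬝ᵥ (V' *ᵥ (x ∘ Sum.inr)) := by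
      rw [fromBlocks_mulVec]
      simp [dotProduct, Fintype.sum_sum_type]
    rw [this]
    exact add_nonneg h1 h2

theorem IsMinTrace.unique {c : ι → ℝ} {V : Matrix (ι ⊕ ι) (ι ⊕ ι) ℝ} {m m' : ℝ}
    (h : IsMinTrace c V m) (h' : IsMinTrace c V m') : m = m' := IsLeast.unique h h'

theorem exists_isMinTrace {c : ι → ℝ} {V : Matrix (ι ⊕ ι) (ι ⊕ ι) ℝ} (hV : V.PosDef) :
    ∃ m, IsMinTrace c V m := by
  obtain ⟨S, hS, hSb, hJ⟩ := exists_isBlock_commute_pinch (c := c) hV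
  exact ⟨_, isMinTrace_of_commute hV.posSemidef hS hSb hJ⟩

/-- The least trace is additive under direct sums. -/
theorem IsMinTrace.phaseSum {c : ι → ℝ} {c' : ι' → ℝ} {V : Matrix (ι ⊕ ι) (ι ⊕ ι) ℝ}
    {V' : Matrix (ι' ⊕ ι') (ι' ⊕ ι') ℝ} {m m' : ℝ} (hV : V.PosDef) (hV' : V'.PosDef)
    (h : IsMinTrace c V m) (h' : IsMinTrace c' V' m') :
    IsMinTrace (Sum.elim c c') (phaseSum V V') (m + m') := by
  obtain ⟨S, hS, hSb, hJ⟩ := exists_isBlock_commute_pinch (c := c) hV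
  obtain ⟨S', hS', hSb', hJ'⟩ := exists_isBlock_commute_pinch (c := c') hV'
  rw [h.unique (isMinTrace_of_commute hV.posSemidef hS hSb hJ),
    h'.unique (isMinTrace_of_commute hV'.posSemidef hS' hSb' hJ'), ← trace_phaseSum,
    ← phaseSum_mul, ← phaseSum_mul, ← phaseSum_transpose]
  -- The direct sum of the two minimisers satisfies the commutation criterion, so it is minimal
  -- among all block matrices, including those that mix the systems.
  refine isMinTrace_of_commute (posSemidef_phaseSum hV.posSemidef hV'.posSemidef)
    (phaseSum_mem hS hS') (isBlock_phaseSum hSb hSb') ?_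
  have e : _ * _ = _ * _ := hJ
  have e' : _ * _ = _ * _ := hJ'
  rw [phaseSum_transpose, phaseSum_mul, phaseSum_mul, pinch_phaseSum, ← phaseSum_J]
  change _ * _ = _ * _
  rw [phaseSum_mul, phaseSum_mul, e, e']

end DirectSum

/-! ### Lower triangular representatives -/

/-- The symplectic matrix of `q ↦ B q`, `p ↦ Q B q + Aᵀ p`, where `B = A⁻¹`. -/
def shearMatrix (A Q : Matrix ι ι ℝ) : Matrix (ι ⊕ ι) (ι ⊕ ι) ℝ :=
  fromBlocks A⁻¹ 0 (Q * A⁻¹) Aᵀ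

theorem shearMatrix_mem {A Q : Matrix ι ι ℝ} (hA : IsUnit A.det) (hQ : Qᵀ = Q) :
    shearMatrix A Q ∈ symplecticGroup ι ℝ := by
  rw [shearMatrix, SymplecticGroup.fromBlocks_mem_iff]
  refine ⟨by simp [hQ, Matrix.mul_assoc], by simp, ?_⟩
  rw [← transpose_mul, mul_nonsing_inv _ hA]
  simp

/-- For a symmetric symplectic matrix the block relations express the upper row through the lower
one, provided the lower right block is invertible. -/
theorem eq_of_symplectic_symm {W W' : Matrix (ι ⊕ ι) (ι ⊕ ι) ℝ} (hW : W ∈ symplecticGroup ι ℝ)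
    (hW' : W' ∈ symplecticGroup ι ℝ) (hs : Wᵀ = W) (hs' : W'ᵀ = W')
    (h21 : W.toBlocks₂₁ = W'.toBlocks₂₁) (h22 : W.toBlocks₂₂ = W'.toBlocks₂₂)
    (hu : IsUnit W.toBlocks₂₂.det) : W = W' := by
  have key : ∀ X : Matrix (ι ⊕ ι) (ι ⊕ ι) ℝ, X ∈ symplecticGroup ι ℝ → Xᵀ = X →
      X.toBlocks₁₂ = X.toBlocks₂₁ᵀ ∧
        X.toBlocks₁₁ * X.toBlocks₂₂ = 1 + X.toBlocks₂₁ᵀ * X.toBlocks₂₁ᵀ := by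
    intro X hX hs
    rw [← fromBlocks_toBlocks X, SymplecticGroup.fromBlocks_mem_iff] at hX
    rw [← fromBlocks_toBlocks X, fromBlocks_transpose, fromBlocks_inj] at hs
    refine ⟨hs.2.1.symm, ?_⟩
    have := hX.2.2
    rw [hs.1, ← hs.2.1] at this
    rw [← this]
    simp
  obtain ⟨a, b⟩ := key W hW hs
  obtain ⟨a', b'⟩ := key W' hW' hs'
  have h12 : W.toBlocks₁₂ = W'.toBlocks₁₂ := by rw [a, a', h21]
  have h11 : W.toBlocks₁₁ = W'.toBlocks₁₁ := by
    have : W.toBlocks₁₁ * W.toBlocks₂₂ = W'.toBlocks₁₁ * W.toBlocks₂₂ := by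
      rw [b, h22, b', h21]
    have h := congrArg (· * W.toBlocks₂₂⁻¹) this
    simpa [Matrix.mul_assoc, mul_nonsing_inv _ hu] using h
  rw [← fromBlocks_toBlocks W, ← fromBlocks_toBlocks W', h11, h12, h21, h22]

/-- Every block symplectic matrix agrees with a block lower triangular one up to an orthogonal
factor on the left. -/
theorem exists_shearMatrix {c : ι → ℝ} {S : Matrix (ι ⊕ ι) (ι ⊕ ι) ℝ}
    (hS : S ∈ symplecticGroup ι ℝ) (hSb : IsBlock (Sum.elim c c) S) :
    ∃ A Q : Matrix ι ι ℝ, IsUnit A.det ∧ Qᵀ = Q ∧ IsBlock c A ∧ IsBlock c Q ∧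
      (shearMatrix A Q)ᵀ * shearMatrix A Q = Sᵀ * S := by
  set W := Sᵀ * S with hWdef
  have hW : W ∈ symplecticGroup ι ℝ := Submonoid.mul_mem _ (SymplecticGroup.transpose_mem hS) hS
  have hWs : Wᵀ = W := by simp [hWdef]
  have hWb : IsBlock (Sum.elim c c) W := hSb.transpose.mul hSb
  have hWp : W.PosDef := by
    have := Matrix.PosDef.conjTranspose_mul_self S
      (mulVec_injective_of_isUnit ((isUnit_iff_isUnit_det S).2 (SymplecticGroup.symplectic_det hS)))
    simpa using this
  have h22 : W.toBlocks₂₂.PosDef := hWp.submatrix Sum.inr_injective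
  have hb22 : IsBlock c W.toBlocks₂₂ :=
    isBlock_iff.2 fun x y h => isBlock_iff.1 hWb (Sum.inr x) (Sum.inr y) h
  have hb21 : IsBlock c W.toBlocks₂₁ :=
    isBlock_iff.2 fun x y h => isBlock_iff.1 hWb (Sum.inr x) (Sum.inl y) h
  -- `Tᵀ T` for `T = shearMatrix A Q` has lower row `A Q A⁻¹`, `A Aᵀ`. Matching it with `W` dictates
  -- `A` as the root of the lower right block and `Q = A⁻¹ W₂₁ A`.
  obtain ⟨A, hAb, hAs, hAA⟩ := hb22.exists_sqrt h22
  have hA : IsUnit A.det := by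
    have : IsUnit (A * A).det := by rw [hAA]; exact (isUnit_iff_isUnit_det _).1 h22.isUnit
    rw [det_mul] at this
    exact isUnit_of_mul_isUnit_left this
  have hi1 : A⁻¹ * A = 1 := nonsing_inv_mul _ hA
  have hi2 : A * A⁻¹ = 1 := mul_nonsing_inv _ hA
  have hAis : (A⁻¹)ᵀ = A⁻¹ := by rw [transpose_nonsing_inv, hAs]
  -- This relation among the blocks of a symplectic `W` is what makes `Q` symmetric.
  have hrel : W.toBlocks₂₁ * (A * A) = A * A * W.toBlocks₂₁ᵀ := by
    rw [hAA]
    have h1 := hW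
    have h2 := hWs
    rw [← fromBlocks_toBlocks W, SymplecticGroup.fromBlocks_mem_iff] at h1
    rw [← fromBlocks_toBlocks W, fromBlocks_transpose, fromBlocks_inj] at h2
    have h3 := h1.2.1
    rw [h2.2.2.1, h2.2.2.2, ← h2.2.1] at h3
    exact h3
  have hQs : (A⁻¹ * W.toBlocks₂₁ * A)ᵀ = A⁻¹ * W.toBlocks₂₁ * A := by
    calc (A⁻¹ * W.toBlocks₂₁ * A)ᵀ = A * W.toBlocks₂₁ᵀ * A⁻¹ := by
          simp only [transpose_mul, hAs, hAis, Matrix.mul_assoc]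
      _ = A⁻¹ * (A * A * W.toBlocks₂₁ᵀ) * A⁻¹ := by
          simp only [← Matrix.mul_assoc, hi1, Matrix.one_mul]
      _ = A⁻¹ * W.toBlocks₂₁ * A := by
          rw [← hrel]; simp only [Matrix.mul_assoc, hi2, Matrix.mul_one]
  refine ⟨A, A⁻¹ * W.toBlocks₂₁ * A, hA, hQs, hAb, (hAb.inv.mul hb21).mul hAb, ?_⟩
  have hmem := shearMatrix_mem hA hQs
  refine (eq_of_symplectic_symm hW (Submonoid.mul_mem _ (SymplecticGroup.transpose_mem hmem) hmem)
    hWs (by simp) ?_ ?_ ((isUnit_iff_isUnit_det _).1 h22.isUnit)).symm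
  · simp only [shearMatrix, fromBlocks_transpose, fromBlocks_multiply, toBlocks_fromBlocks₂₁, hAs]
    simp only [← Matrix.mul_assoc, hi2, transpose_zero, Matrix.zero_mul, zero_add, Matrix.one_mul]
    simp only [Matrix.mul_assoc, hi2, Matrix.mul_one]
  · simp [shearMatrix, fromBlocks_transpose, fromBlocks_multiply, hAs, hAA]

end Symplectic

/-! ### Weyl operators -/

section Weyl

variable {ι : Type} [Fintype ι]

theorem weyl_coeFn (ξ : ι ⊕ ι → ℝ) (ψ : ModeSpace ι) :
    (weyl ξ ψ : Config ι → ℂ) =ᵐ[volume] weylFun ξ ψ := MemLp.coeFn_toLp _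

/-- The translation by the momentum part of `ξ`. -/
abbrev weylShift (ξ : ι ⊕ ι → ℝ) : Config ι := WithLp.toLp 2 fun i => ξ (Sum.inr i)

theorem ae_shift {p : Config ι → Prop} (h : ∀ᵐ x, p x) (b : Config ι) : ∀ᵐ x, p (x + b) :=
  (measurePreserving_add_right volume b).quasiMeasurePreserving.ae h

theorem weylFun_congr {f g : Config ι → ℂ} (h : f =ᵐ[volume] g) (ξ : ι ⊕ ι → ℝ) :
    weylFun ξ f =ᵐ[volume] weylFun ξ g := by
  filter_upwards [ae_shift h (weylShift ξ)] with x hx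
  simp only [weylFun] at hx ⊢
  rw [hx]

theorem weyl_eq_of_ae {f : Config ι → ℂ} {ψ φ : ModeSpace ι} {ξ : ι ⊕ ι → ℝ}
    (h : (ψ : Config ι → ℂ) =ᵐ[volume] f) (h' : (φ : Config ι → ℂ) =ᵐ[volume] weylFun ξ f) :
    weyl ξ ψ = φ :=
  Lp.ext ((weyl_coeFn ξ ψ).trans ((weylFun_congr h ξ).trans h'.symm))

theorem weyl_add (ξ : ι ⊕ ι → ℝ) (ψ φ : ModeSpace ι) : weyl ξ (ψ + φ) = weyl ξ ψ + weyl ξ φ := by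
  refine weyl_eq_of_ae (Lp.coeFn_add ψ φ) ?_
  filter_upwards [Lp.coeFn_add (weyl ξ ψ) (weyl ξ φ), weyl_coeFn ξ ψ, weyl_coeFn ξ φ]
    with x h1 h2 h3
  rw [h1, Pi.add_apply, h2, h3]
  simp only [weylFun, Pi.add_apply, mul_add]

theorem weyl_smul (ξ : ι ⊕ ι → ℝ) (c : ℂ) (ψ : ModeSpace ι) :
    weyl ξ (c • ψ) = c • weyl ξ ψ := by
  refine weyl_eq_of_ae (Lp.coeFn_smul c ψ) ?_
  filter_upwards [Lp.coeFn_smul c (weyl ξ ψ), weyl_coeFn ξ ψ] with x h1 h2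
  rw [h1, Pi.smul_apply, h2]
  simp only [weylFun, Pi.smul_apply, smul_eq_mul]
  ring

theorem norm_weylFun (ξ : ι ⊕ ι → ℝ) (f : Config ι → ℂ) (x : Config ι) :
    ‖weylFun ξ f x‖ = ‖f (x + weylShift ξ)‖ := by
  rw [weylFun, norm_mul, mul_comm Complex.I, Complex.norm_exp_ofReal_mul_I, one_mul]

theorem norm_weyl (ξ : ι ⊕ ι → ℝ) (ψ : ModeSpace ι) : ‖weyl ξ ψ‖ = ‖ψ‖ := by
  have h1 : MemLp (fun x : Config ι => ψ (x + weylShift ξ)) 2 volume :=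
    (Lp.memLp ψ).comp_measurePreserving (measurePreserving_add_right volume _)
  rw [weyl, Lp.norm_toLp, Lp.norm_def]
  congr 1
  rw [eLpNorm_congr_norm_ae (g := fun x => ψ (x + weylShift ξ))
    (Filter.Eventually.of_forall fun x => norm_weylFun ξ ψ x)]
  exact eLpNorm_comp_measurePreserving (Lp.aestronglyMeasurable ψ)
    (measurePreserving_add_right volume (weylShift ξ))

/-- The Weyl operator as a linear isometry. -/
def weylIsometry (ξ : ι ⊕ ι → ℝ) : ModeSpace ι →ₗᵢ[ℂ] ModeSpace ι where
  toFun := weyl ξ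
  map_add' := weyl_add ξ
  map_smul' := weyl_smul ξ
  norm_map' := norm_weyl ξ

theorem inner_weyl_weyl (ξ : ι ⊕ ι → ℝ) (ψ φ : ModeSpace ι) :
    inner ℂ (weyl ξ ψ) (weyl ξ φ) = inner ℂ ψ φ := (weylIsometry ξ).inner_map_map ψ φ

theorem continuous_weyl (ξ : ι ⊕ ι → ℝ) : Continuous (weyl (ι := ι) ξ) :=
  (weylIsometry ξ).continuous

theorem inner_weyl (ξ : ι ⊕ ι → ℝ) (φ ψ : ModeSpace ι) :
    inner ℂ φ (weyl ξ ψ) = ∫ x, weylFun ξ ψ x * starRingEnd ℂ (φ x) := by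
  rw [L2.inner_def]
  refine integral_congr_ae ?_
  filter_upwards [weyl_coeFn ξ ψ] with x hx
  rw [hx]
  rfl

/-- The canonical commutation relations in Weyl form: the phase is the symplectic form of the two
phase space vectors. -/
theorem weyl_comm (η ξ : ι ⊕ ι → ℝ) (ψ : ModeSpace ι) :
    weyl η (weyl ξ ψ) = Complex.exp (Complex.I * ((∑ i, (ξ (Sum.inl i) * η (Sum.inr i) -
      η (Sum.inl i) * ξ (Sum.inr i)) : ℝ) : ℂ)) • weyl ξ (weyl η ψ) := by
  refine weyl_eq_of_ae (weyl_coeFn ξ ψ) ?_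
  filter_upwards [Lp.coeFn_smul (Complex.exp (Complex.I * ((∑ i, (ξ (Sum.inl i) * η (Sum.inr i) -
      η (Sum.inl i) * ξ (Sum.inr i)) : ℝ) : ℂ))) (weyl ξ (weyl η ψ)), weyl_coeFn ξ (weyl η ψ),
      weylFun_congr (weyl_coeFn η ψ) ξ] with x h1 h2 h3
  rw [h1, Pi.smul_apply, h2, h3, smul_eq_mul]
  simp only [weylFun]
  rw [add_right_comm x, ← mul_assoc, ← mul_assoc, ← mul_assoc, ← Complex.exp_add,
    ← Complex.exp_add, ← Complex.exp_add]
  congr 2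
  rw [← mul_add, ← mul_add, ← mul_add, ← Complex.ofReal_add, ← Complex.ofReal_add,
    ← Complex.ofReal_add]
  congr 2
  simp only [PiLp.add_apply, mul_add, Finset.sum_add_distrib, Finset.sum_sub_distrib]
  ring

/-- The characteristic function of `ψ` is that of a Gaussian with covariance matrix `V` and
displacement `d`. -/
def HasGaussianChar (ψ : ModeSpace ι) (V : Matrix (ι ⊕ ι) (ι ⊕ ι) ℝ) (d : ι ⊕ ι → ℝ) : Prop :=
  ∀ ξ : ι ⊕ ι → ℝ, inner ℂ ψ (weyl ξ ψ) = Complex.exp (Complex.I * ((ξ ⬝ᵥ d : ℝ) : ℂ)) *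
    ((Real.exp (-(1 / 4) * (ξ ⬝ᵥ (V *ᵥ ξ))) : ℝ) : ℂ)

theorem isPureGaussian_iff {ψ : ModeSpace ι} :
    IsPureGaussian ψ ↔ ∃ V : Matrix (ι ⊕ ι) (ι ⊕ ι) ℝ, V.IsSymm ∧ HasGaussianChar ψ V 0 := by
  simp [IsPureGaussian, HasGaussianChar]

theorem weyl_zero (ψ : ModeSpace ι) : weyl 0 ψ = ψ := by
  refine weyl_eq_of_ae (Filter.EventuallyEq.refl _ _) (Filter.Eventually.of_forall fun x => ?_)
  simp only [weylFun, Pi.zero_apply]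
  rw [show (WithLp.toLp 2 fun _ : ι => (0 : ℝ)) = 0 from rfl]
  simp

theorem HasGaussianChar.norm_eq_one {ψ : ModeSpace ι} {V : Matrix (ι ⊕ ι) (ι ⊕ ι) ℝ}
    {d : ι ⊕ ι → ℝ} (h : HasGaussianChar ψ V d) : ‖ψ‖ = 1 := by
  have h0 := h 0
  rw [weyl_zero, inner_self_eq_norm_sq_to_K] at h0
  simp only [zero_dotProduct, Complex.ofReal_zero, mul_zero, Complex.exp_zero, Real.exp_zero,
    Complex.ofReal_one, mul_one] at h0
  have : ‖ψ‖ ^ 2 = 1 := (RCLike.ofReal_inj (K := ℂ)).1 (by push_cast; exact h0)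
  exact (pow_eq_one_iff_of_nonneg (norm_nonneg _) two_ne_zero).1 this

/-- The covariance matrix of a Gaussian state is positive definite. -/
theorem HasGaussianChar.posDef {ψ : ModeSpace ι} {V : Matrix (ι ⊕ ι) (ι ⊕ ι) ℝ}
    (hV : V.IsSymm) (h : HasGaussianChar ψ V 0) : V.PosDef := by
  have hn := h.norm_eq_one
  refine .of_dotProduct_mulVec_pos (by simpa [IsHermitian] using hV.eq) fun {ξ} hξ => ?_
  rw [star_trivial]
  by_contra hle
  have h1 := h ξ
  simp only [dotProduct_zero, Complex.ofReal_zero, mul_zero, Complex.exp_zero, one_mul] at h1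
  have hle1 : Real.exp (-(1 / 4) * (ξ ⬝ᵥ (V *ᵥ ξ))) ≤ 1 := by
    have := norm_inner_le_norm (𝕜 := ℂ) ψ (weyl ξ ψ)
    rwa [norm_weyl, hn, h1, Complex.norm_real, Real.norm_eq_abs, Real.abs_exp, mul_one] at this
  have h0 : ξ ⬝ᵥ (V *ᵥ ξ) = 0 := by
    have := Real.exp_le_one_iff.1 hle1
    linarith [not_lt.1 hle]
  rw [h0, mul_zero, Real.exp_zero, Complex.ofReal_one] at h1
  -- If `ξᵀ V ξ ≤ 0`, the expectation is at least `1`; equality in Cauchy–Schwarz then makes `ψ` a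
  -- fixed vector of this Weyl operator.
  have hfix : ψ = weyl ξ ψ :=
    (inner_eq_one_iff_of_norm_eq_one hn (by rw [norm_weyl, hn])).1 h1
  have hpos : 0 < ξ ⬝ᵥ ξ := by
    rw [← star_trivial ξ]
    simpa using (dotProduct_star_self_pos_iff (v := ξ)).2 hξ
  -- `η` is `ξ` turned by the symplectic form and scaled so that the commutation phase is `exp (iπ)
  -- = -1`. The expectation at `η` then equals its own negative, while a Gaussian is positive.
  set r : ℝ := Real.pi / (ξ ⬝ᵥ ξ) with hr
  let η : ι ⊕ ι → ℝ := Sum.elim (fun i => -(r * ξ (Sum.inr i))) (fun i => r * ξ (Sum.inl i))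
  have hs : ∑ i, (ξ (Sum.inl i) * η (Sum.inr i) - η (Sum.inl i) * ξ (Sum.inr i)) = Real.pi := by
    have : ∑ i, (ξ (Sum.inl i) * η (Sum.inr i) - η (Sum.inl i) * ξ (Sum.inr i))
        = r * (ξ ⬝ᵥ ξ) := by
      simp only [η, Sum.elim_inl, Sum.elim_inr, dotProduct, Fintype.sum_sum_type, mul_add,
        Finset.mul_sum, ← Finset.sum_add_distrib]
      exact Finset.sum_congr rfl fun i _ => by ring
    rw [this, hr, div_mul_cancel₀ _ hpos.ne']
  have hc := weyl_comm η ξ ψ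
  rw [hs, mul_comm Complex.I, Complex.exp_pi_mul_I] at hc
  have h2 : inner ℂ ψ (weyl η ψ) = -inner ℂ ψ (weyl η ψ) := by
    conv_lhs => rw [hfix, hc, inner_smul_right, inner_weyl_weyl]
    simp
  have h3 := h η
  simp only [dotProduct_zero, Complex.ofReal_zero, mul_zero, Complex.exp_zero, one_mul] at h3
  rw [h3] at h2
  have h4 : Real.exp (-(1 / 4) * (η ⬝ᵥ (V *ᵥ η))) = -Real.exp (-(1 / 4) * (η ⬝ᵥ (V *ᵥ η))) := by
    exact_mod_cast h2
  have := Real.exp_pos (-(1 / 4) * (η ⬝ᵥ (V *ᵥ η)))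
  linarith

/-- `U` acts on the quadratures by `R ↦ S R + d`. -/
def Implements (U : ModeSpace ι ≃ₗᵢ[ℂ] ModeSpace ι) (S : Matrix (ι ⊕ ι) (ι ⊕ ι) ℝ)
    (d : ι ⊕ ι → ℝ) : Prop :=
  ∀ (ξ : ι ⊕ ι → ℝ) (φ : ModeSpace ι),
    weyl ξ (U φ) = Complex.exp (Complex.I * ((ξ ⬝ᵥ d : ℝ) : ℂ)) • U (weyl (Sᵀ *ᵥ ξ) φ)

theorem HasGaussianChar.map {ψ : ModeSpace ι} {V S : Matrix (ι ⊕ ι) (ι ⊕ ι) ℝ}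
    {d : ι ⊕ ι → ℝ} {U : ModeSpace ι ≃ₗᵢ[ℂ] ModeSpace ι}
    (h : HasGaussianChar ψ V 0) (hU : Implements U S d) :
    HasGaussianChar (U ψ) (S * V * Sᵀ) d := by
  intro ξ
  rw [hU, inner_smul_right, U.inner_map_map, h]
  simp only [dotProduct_zero, Complex.ofReal_zero, mul_zero, Complex.exp_zero, one_mul]
  congr 4
  rw [mulVec_transpose, ← dotProduct_mulVec, ← mulVec_transpose, mulVec_mulVec, mulVec_mulVec,
    Matrix.mul_assoc]

end Weyl

/-! ### Energy of Gaussian states -/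

section Energy

variable {ι : Type} [Fintype ι]

/-- The second moment of a distribution with Gaussian characteristic function. -/
theorem lintegral_sq_of_charFun_gaussian (φ : ModeSpace ι) (i : ι) (s m v : ℝ) (hv : 0 ≤ v)
    (h : ∀ t : ℝ, ∫ x : Config ι, Complex.exp (Complex.I * ((t * (s * x i) : ℝ) : ℂ)) *
        ((‖φ x‖ ^ 2 : ℝ) : ℂ) =
      Complex.exp (Complex.I * ((t * m : ℝ) : ℂ)) * ((Real.exp (-(1 / 4) * (v * t ^ 2)) : ℝ) : ℂ)) :
    ∫⁻ x : Config ι, ENNReal.ofReal ((1 / 2) * (s * x i) ^ 2 * ‖φ x‖ ^ 2) =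
      ENNReal.ofReal ((1 / 4) * v + (1 / 2) * m ^ 2) := by
  have hmeas : AEMeasurable (fun x : Config ι => ENNReal.ofReal (‖φ x‖ ^ 2)) volume :=
    ((Lp.aestronglyMeasurable φ).norm.aemeasurable.pow_const 2).ennreal_ofReal
  have hX : Measurable fun x : Config ι => s * x i := by fun_prop
  have hint : Integrable (fun x : Config ι => ‖φ x‖ ^ 2) volume := (Lp.memLp φ).integrable_norm_pow (by norm_num)
  set ν : Measure (Config ι) := volume.withDensity fun x => ENNReal.ofReal (‖φ x‖ ^ 2) with hν
  have hνfin : IsFiniteMeasure ν := isFiniteMeasure_withDensity_ofReal hint.2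
  -- `exp (-v t² / 4)` belongs to variance `v / 2`, since a Gaussian of variance `w` has `exp (-w t²
  -- / 2)`.
  set w : NNReal := ⟨v / 2, by positivity⟩ with hw
  have hmap : ν.map (fun x : Config ι => s * x i) = ProbabilityTheory.gaussianReal m w := by
    refine Measure.ext_of_charFun (funext fun t => ?_)
    rw [charFun_apply_real, ProbabilityTheory.charFun_gaussianReal,
      integral_map hX.aemeasurable (by fun_prop), hν,
      integral_withDensity_eq_integral_toReal_smul₀ hmeas (by simp)]
    have := h t
    rw [Complex.ofReal_exp, ← Complex.exp_add] at this
    refine Eq.trans (integral_congr_ae (Filter.Eventually.of_forall fun x => ?_))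
      (this.trans (congrArg Complex.exp ?_))
    · simp only []
      rw [ENNReal.toReal_ofReal (by positivity), Complex.real_smul, mul_comm]
      congr 2
      push_cast
      ring
    · have : ((w : ℝ) : ℂ) = ((v / 2 : ℝ) : ℂ) := rfl
      rw [this]
      push_cast
      ring
  have h1 : ∫⁻ y, ENNReal.ofReal ((1 / 2) * y ^ 2) ∂(ν.map fun x : Config ι => s * x i) =
      ∫⁻ x : Config ι, ENNReal.ofReal ((1 / 2) * (s * x i) ^ 2 * ‖φ x‖ ^ 2) := by
    rw [lintegral_map (by fun_prop) hX, hν, lintegral_withDensity_eq_lintegral_mul₀ hmeas (by fun_prop)]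
    refine lintegral_congr fun x => ?_
    rw [Pi.mul_apply, mul_comm, ← ENNReal.ofReal_mul (by positivity)]
  rw [← h1, hmap]
  have hmem : MemLp (id : ℝ → ℝ) 2 (ProbabilityTheory.gaussianReal m w) :=
    ProbabilityTheory.memLp_id_gaussianReal 2
  have hvar := ProbabilityTheory.variance_eq_sub hmem
  rw [ProbabilityTheory.variance_id_gaussianReal] at hvar
  have hmean : ∫ x, id x ∂(ProbabilityTheory.gaussianReal m w) = m := by
    simp
  rw [hmean] at hvar
  have hsq : Integrable (fun x : ℝ => x ^ 2) (ProbabilityTheory.gaussianReal m w) :=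
    hmem.integrable_sq
  rw [← ofReal_integral_eq_lintegral_ofReal (hsq.const_mul _)
    (Filter.Eventually.of_forall fun x => by positivity), integral_const_mul]
  congr 1
  have : ((w : ℝ)) = v / 2 := rfl
  rw [this] at hvar
  simp only [Pi.pow_apply, id] at hvar ⊢
  linarith

/-- On `L²`, the Fourier transform turns translations into modulations. -/
theorem fourier_weyl (b : ι → ℝ) (φ : ModeSpace ι) :
    (𝓕 (weyl (Sum.elim 0 b) φ) : ModeSpace ι) =
      weyl (Sum.elim (fun i => 2 * Real.pi * b i) 0) (𝓕 φ : ModeSpace ι) := by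
  refine DenseRange.induction_on (p := fun φ : ModeSpace ι =>
    (𝓕 (weyl (Sum.elim 0 b) φ) : ModeSpace ι) =
      weyl (Sum.elim (fun i => 2 * Real.pi * b i) 0) (𝓕 φ : ModeSpace ι))
    -- Both sides are continuous in `φ`, so Schwartz functions suffice, where the Fourier transform
    -- is an integral.
    (SchwartzMap.denseRange_toLpCLM (E := Config ι) (F := ℂ) (μ := volume) (p := 2)
      ENNReal.ofNat_ne_top) φ ?_ fun f => ?_
  · have hF : Continuous (fun φ : ModeSpace ι => (𝓕 φ : ModeSpace ι)) :=
      (Lp.fourierTransformₗᵢ (Config ι) ℂ).continuous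
    exact isClosed_eq (hF.comp (continuous_weyl _)) ((continuous_weyl _).comp hF)
  · have e1 : weyl (Sum.elim 0 b) (f.toLp 2 : ModeSpace ι) =
        ((SchwartzMap.compSubConstCLM ℂ (-(WithLp.toLp 2 b : Config ι)) f).toLp 2 : ModeSpace ι) := by
      refine weyl_eq_of_ae (f.coeFn_toLp 2 volume) ?_
      refine (SchwartzMap.coeFn_toLp _ 2 volume).trans (Filter.Eventually.of_forall fun x => ?_)
      simp [weylFun]
    change (𝓕 (weyl (Sum.elim 0 b) (f.toLp 2 : ModeSpace ι)) : ModeSpace ι) =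
      weyl _ (𝓕 (f.toLp 2 : ModeSpace ι))
    rw [e1, SchwartzMap.toLp_fourier_eq, SchwartzMap.toLp_fourier_eq]
    refine (weyl_eq_of_ae ((𝓕 f).coeFn_toLp 2 volume) ?_).symm
    refine (SchwartzMap.coeFn_toLp _ 2 volume).trans (Filter.Eventually.of_forall fun k => ?_)
    rw [SchwartzMap.fourier_coe]
    have e2 : ((SchwartzMap.compSubConstCLM ℂ (-(WithLp.toLp 2 b : Config ι)) f) : Config ι → ℂ) =
        fun x => f (x + WithLp.toLp 2 b) := by
      ext x; simp
    rw [e2]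
    have := congrFun (VectorFourier.fourierIntegral_comp_add_right Real.fourierChar volume
      (innerₗ (Config ι)) f (WithLp.toLp 2 b)) k
    refine Eq.trans this ?_
    rw [Circle.smul_def, Real.fourierChar_apply, smul_eq_mul]
    simp only [weylFun, Sum.elim_inl, Sum.elim_inr, Pi.zero_apply, mul_zero, Finset.sum_const_zero,
      add_zero]
    rw [show (WithLp.toLp 2 fun _ : ι => (0 : ℝ)) = 0 from rfl, add_zero, SchwartzMap.fourier_coe]
    congr 2
    rw [mul_comm Complex.I]
    congr 2
    simp only [innerₗ_apply_apply, PiLp.inner_apply, Finset.mul_sum]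
    refine Finset.sum_congr rfl fun i _ => ?_
    simp
    ring

/-- Without momentum part a Weyl operator is multiplication by a phase, so its expectation is the
characteristic function of the density `|φ|²`. -/
theorem inner_weyl_modulation (a : ι → ℝ) (φ : ModeSpace ι) :
    inner ℂ φ (weyl (Sum.elim a 0) φ) =
      ∫ x : Config ι, Complex.exp (Complex.I * ((∑ i, a i * x i : ℝ) : ℂ)) *
        ((‖φ x‖ ^ 2 : ℝ) : ℂ) := by
  rw [inner_weyl]
  refine integral_congr_ae (Filter.Eventually.of_forall fun x => ?_)
  simp only [weylFun, Sum.elim_inl, Sum.elim_inr, Pi.zero_apply, mul_zero, Finset.sum_const_zero,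
    add_zero]
  rw [show (WithLp.toLp 2 fun _ : ι => (0 : ℝ)) = 0 from rfl, add_zero, mul_assoc,
    Complex.mul_conj, Complex.normSq_eq_norm_sq]

/-- Each quadrature `x` has a Gaussian distribution with mean `d x` and variance `V x x / 2`.
Positions are read off `|ψ|²`; for momenta the Fourier transform turns translations into modulations
and reduces to the same case. -/
theorem HasGaussianChar.energy_eq {ψ : ModeSpace ι} {V : Matrix (ι ⊕ ι) (ι ⊕ ι) ℝ}
    {d : ι ⊕ ι → ℝ} (h : HasGaussianChar ψ V d) (hV : ∀ x, 0 ≤ V x x) :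
    energy ψ = ENNReal.ofReal ((1 / 4) * V.trace + (1 / 2) * (d ⬝ᵥ d)) := by
  classical
  have hq : ∀ (x : ι ⊕ ι) (t : ℝ), inner ℂ ψ (weyl (Pi.single x t) ψ) =
      Complex.exp (Complex.I * ((t * d x : ℝ) : ℂ)) *
        ((Real.exp (-(1 / 4) * (V x x * t ^ 2)) : ℝ) : ℂ) := fun x t => by
    rw [h, single_dotProduct, single_dotProduct, mulVec_single]
    congr 4
    simp
    ring
  have hinl : ∀ (i : ι) (t : ℝ), (Pi.single (Sum.inl i) t : ι ⊕ ι → ℝ) =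
      Sum.elim (Pi.single i t) 0 := fun i t => by
    ext (j | j) <;> simp [Pi.single_apply]
  have hinr : ∀ (i : ι) (t : ℝ), (Pi.single (Sum.inr i) t : ι ⊕ ι → ℝ) =
      Sum.elim (0 : ι → ℝ) (Pi.single i t) := fun i t => by
    ext (j | j) <;> simp [Pi.single_apply]
  have hpos : ∀ i : ι, ∫⁻ x : Config ι, ENNReal.ofReal ((1 / 2) * (x i) ^ 2 * ‖ψ x‖ ^ 2) =
      ENNReal.ofReal ((1 / 4) * V (Sum.inl i) (Sum.inl i) + (1 / 2) * d (Sum.inl i) ^ 2) := by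
    intro i
    have := lintegral_sq_of_charFun_gaussian ψ i 1 (d (Sum.inl i)) (V (Sum.inl i) (Sum.inl i))
      (hV _) fun t => by
        rw [← hq, hinl, inner_weyl_modulation]
        simp [Pi.single_apply]
    simpa using this
  have hmom : ∀ i : ι, ∫⁻ k : Config ι, ENNReal.ofReal
        ((1 / 2) * (2 * Real.pi * k i) ^ 2 * ‖(𝓕 ψ : ModeSpace ι) k‖ ^ 2) =
      ENNReal.ofReal ((1 / 4) * V (Sum.inr i) (Sum.inr i) + (1 / 2) * d (Sum.inr i) ^ 2) := by
    intro i
    refine lintegral_sq_of_charFun_gaussian (𝓕 ψ : ModeSpace ι) i (2 * Real.pi) (d (Sum.inr i))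
      (V (Sum.inr i) (Sum.inr i)) (hV _) fun t => ?_
    rw [← hq, hinr, ← Lp.inner_fourier_eq, fourier_weyl, inner_weyl_modulation]
    refine integral_congr_ae (Filter.Eventually.of_forall fun x => ?_)
    simp [Pi.single_apply]
    left
    ring_nf
  have hnn : ∀ x, 0 ≤ (1 / 4) * V x x + (1 / 2) * d x ^ 2 := fun x => by
    have := hV x
    positivity
  rw [energy]
  simp_rw [hpos, hmom]
  rw [Finset.sum_add_distrib, ← ENNReal.ofReal_sum_of_nonneg fun i _ => hnn _,
    ← ENNReal.ofReal_sum_of_nonneg fun i _ => hnn _,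
    ← ENNReal.ofReal_add (Finset.sum_nonneg fun i _ => hnn _) (Finset.sum_nonneg fun i _ => hnn _)]
  congr 1
  simp only [trace, diag, dotProduct, Fintype.sum_sum_type, Finset.sum_add_distrib,
    ← Finset.mul_sum, sq]
  ring

end Energy

/-! ### Gaussian unitaries of linear substitutions and chirps -/

section Shear

variable {ι : Type} [Fintype ι] [DecidableEq ι]

/-- The action of a matrix on configurations. -/
def configMap (A : Matrix ι ι ℝ) (x : Config ι) : Config ι := WithLp.toLp 2 (A *ᵥ x.ofLp)

theorem configMap_eq (A : Matrix ι ι ℝ) : configMap A = A.toEuclideanLin := rfl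

theorem configMap_configMap (A B : Matrix ι ι ℝ) (x : Config ι) :
    configMap A (configMap B x) = configMap (A * B) x := by
  simp [configMap, mulVec_mulVec]

theorem configMap_add (A : Matrix ι ι ℝ) (x y : Config ι) :
    configMap A (x + y) = configMap A x + configMap A y := by
  rw [configMap_eq, map_add]

theorem measurable_configMap (A : Matrix ι ι ℝ) : Measurable (configMap A) := by
  rw [configMap_eq]
  exact (LinearMap.continuous_of_finiteDimensional _).measurable

theorem map_configMap {A : Matrix ι ι ℝ} (hA : IsUnit A.det) :
    (volume : Measure (Config ι)).map (configMap A) = ENNReal.ofReal |A.det|⁻¹ • volume := by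
  have hdet : LinearMap.det A.toEuclideanLin = A.det := by
    rw [Matrix.toEuclideanLin_eq_toLin_orthonormal, LinearMap.det_toLin]
  rw [configMap_eq, Measure.map_linearMap_addHaar_eq_smul_addHaar _ (by rw [hdet]; exact hA.ne_zero),
    hdet, abs_inv]

theorem quasiMeasurePreserving_configMap {A : Matrix ι ι ℝ} (hA : IsUnit A.det) :
    Measure.QuasiMeasurePreserving (configMap A) (volume : Measure (Config ι)) volume :=
  ⟨measurable_configMap A, by
    rw [map_configMap hA]; exact Measure.smul_absolutelyContinuous⟩

/-- The wave function `√|det A| exp (i xᵀQx / 2) ψ (A x)`. -/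
def shearFun (A Q : Matrix ι ι ℝ) (ψ : Config ι → ℂ) (x : Config ι) : ℂ :=
  (Real.sqrt |A.det| : ℂ) *
    (Complex.exp (Complex.I * (((1 / 2) * (x.ofLp ⬝ᵥ (Q *ᵥ x.ofLp)) : ℝ) : ℂ)) * ψ (configMap A x))

theorem norm_shearFun (A Q : Matrix ι ι ℝ) (ψ : Config ι → ℂ) (x : Config ι) :
    ‖shearFun A Q ψ x‖ = ‖(Real.sqrt |A.det| : ℂ) • ψ (configMap A x)‖ := by
  rw [shearFun, norm_mul, norm_mul, mul_comm Complex.I, Complex.norm_exp_ofReal_mul_I, one_mul,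
    norm_smul]

theorem shearFun_congr {A : Matrix ι ι ℝ} (hA : IsUnit A.det) (Q : Matrix ι ι ℝ)
    {f g : Config ι → ℂ} (h : f =ᵐ[volume] g) : shearFun A Q f =ᵐ[volume] shearFun A Q g := by
  filter_upwards [(quasiMeasurePreserving_configMap hA).ae h] with x hx
  simp only [shearFun, hx]

/-- The chirp has modulus one, and the factor `√|det A|` cancels the Jacobian of the substitution.
-/
theorem eLpNorm_shearFun {A : Matrix ι ι ℝ} (hA : IsUnit A.det) (Q : Matrix ι ι ℝ)
    (ψ : ModeSpace ι) : eLpNorm (shearFun A Q ψ) 2 volume = eLpNorm ψ 2 volume := by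
  have hpos : 0 < |A.det| := abs_pos.2 hA.ne_zero
  rw [eLpNorm_congr_norm_ae (Filter.Eventually.of_forall fun x => norm_shearFun A Q ψ x)]
  change eLpNorm ((Real.sqrt |A.det| : ℂ) • fun x => ψ (configMap A x)) 2 volume = _
  rw [eLpNorm_const_smul]
  have h1 : eLpNorm (fun x => ψ (configMap A x)) 2 volume =
      eLpNorm ψ 2 (volume.map (configMap A)) := by
    rw [eLpNorm_map_measure _ (measurable_configMap A).aemeasurable]
    · rfl
    · rw [map_configMap hA]
      exact (Lp.aestronglyMeasurable ψ).smul_measure _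
  rw [h1, map_configMap hA, eLpNorm_smul_measure_of_ne_top (by norm_num), smul_eq_mul, ← mul_assoc]
  have h2 : ‖(Real.sqrt |A.det| : ℂ)‖ₑ * ENNReal.ofReal |A.det|⁻¹ ^ ((1 / 2 : ℝ≥0∞)).toReal = 1 := by
    rw [← ofReal_norm, Complex.norm_real, Real.norm_of_nonneg (Real.sqrt_nonneg _),
      ENNReal.ofReal_rpow_of_pos (by positivity), ← ENNReal.ofReal_mul (Real.sqrt_nonneg _)]
    rw [ENNReal.toReal_div, ENNReal.toReal_one, ENNReal.toReal_ofNat, ← Real.sqrt_eq_rpow, ← Real.sqrt_mul hpos.le, mul_inv_cancel₀ hpos.ne', Real.sqrt_one,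
      ENNReal.ofReal_one]
  rw [h2, one_mul]

theorem memLp_shearFun {A : Matrix ι ι ℝ} (hA : IsUnit A.det) (Q : Matrix ι ι ℝ)
    (ψ : ModeSpace ι) : MemLp (shearFun A Q ψ) 2 (volume : Measure (Config ι)) := by
  refine ⟨?_, by rw [eLpNorm_shearFun hA]; exact Lp.eLpNorm_lt_top ψ⟩
  have h1 : AEStronglyMeasurable (fun x : Config ι => ψ (configMap A x)) volume :=
    (Lp.aestronglyMeasurable ψ).comp_quasiMeasurePreserving (quasiMeasurePreserving_configMap hA)
  have h2 : Continuous fun x : Config ι =>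
      Complex.exp (Complex.I * (((1 / 2) * (x.ofLp ⬝ᵥ (Q *ᵥ x.ofLp)) : ℝ) : ℂ)) := by
    have : Continuous fun x : Config ι => x.ofLp ⬝ᵥ (Q *ᵥ x.ofLp) := by
      simp only [dotProduct, mulVec]
      fun_prop
    fun_prop
  exact aestronglyMeasurable_const.mul (h2.aestronglyMeasurable.mul h1)

/-- The inverse is again of the same kind, which yields surjectivity of the isometry. -/
theorem shearFun_shearFun {A : Matrix ι ι ℝ} (hA : IsUnit A.det) (Q : Matrix ι ι ℝ)
    (f : Config ι → ℂ) (x : Config ι) :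
    shearFun A Q (shearFun A⁻¹ (-((A⁻¹)ᵀ * Q * A⁻¹)) f) x = f x := by
  have hpos : 0 < |A.det| := abs_pos.2 hA.ne_zero
  have h1 : (x.ofLp ⬝ᵥ (Q *ᵥ x.ofLp)) = -((configMap A x).ofLp ⬝ᵥ
      ((-((A⁻¹)ᵀ * Q * A⁻¹)) *ᵥ (configMap A x).ofLp)) := by
    have e : A⁻¹ *ᵥ (A *ᵥ x.ofLp) = x.ofLp := by
      rw [mulVec_mulVec, nonsing_inv_mul _ hA, one_mulVec]
    change _ = -((A *ᵥ x.ofLp) ⬝ᵥ ((-((A⁻¹)ᵀ * Q * A⁻¹)) *ᵥ (A *ᵥ x.ofLp)))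
    rw [neg_mulVec, dotProduct_neg, neg_neg, ← mulVec_mulVec, e, ← mulVec_mulVec,
      dotProduct_mulVec (A *ᵥ x.ofLp), vecMul_transpose, e]
  have h2 : configMap A⁻¹ (configMap A x) = x := by
    rw [configMap_configMap, nonsing_inv_mul _ hA]
    simp [configMap]
  have h3 : ((Real.sqrt |A.det| : ℝ) : ℂ) * (Real.sqrt |A⁻¹.det| : ℝ) = 1 := by
    rw [← Complex.ofReal_mul, det_nonsing_inv, Ring.inverse_eq_inv', abs_inv,
      ← Real.sqrt_mul hpos.le, mul_inv_cancel₀ hpos.ne', Real.sqrt_one, Complex.ofReal_one]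
  simp only [shearFun, h2]
  rw [h1]
  set r := (configMap A x).ofLp ⬝ᵥ ((-((A⁻¹)ᵀ * Q * A⁻¹)) *ᵥ (configMap A x).ofLp)
  have h4 : Complex.exp (Complex.I * (((1 / 2) * -r : ℝ) : ℂ)) *
      Complex.exp (Complex.I * (((1 / 2) * r : ℝ) : ℂ)) = 1 := by
    rw [← Complex.exp_add, ← mul_add, ← Complex.ofReal_add]
    simp
  linear_combination (f x) * (Complex.exp (Complex.I * (((1 / 2) * -r : ℝ) : ℂ)) *
      Complex.exp (Complex.I * (((1 / 2) * r : ℝ) : ℂ))) * h3 + (f x) * h4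

/-- The unitary `ψ ↦ √|det A| exp (i xᵀQx / 2) ψ (A x)` as a linear isometry. -/
def shearIsometry {A : Matrix ι ι ℝ} (hA : IsUnit A.det) (Q : Matrix ι ι ℝ) :
    ModeSpace ι →ₗᵢ[ℂ] ModeSpace ι where
  toFun ψ := (memLp_shearFun hA Q ψ).toLp (shearFun A Q ψ)
  map_add' ψ φ := by
    refine Lp.ext ((MemLp.coeFn_toLp _).trans ((shearFun_congr hA Q (Lp.coeFn_add ψ φ)).trans ?_))
    filter_upwards [Lp.coeFn_add ((memLp_shearFun hA Q ψ).toLp (shearFun A Q ψ))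
      ((memLp_shearFun hA Q φ).toLp (shearFun A Q φ)), (memLp_shearFun hA Q ψ).coeFn_toLp,
      (memLp_shearFun hA Q φ).coeFn_toLp] with x h1 h2 h3
    rw [h1, Pi.add_apply, h2, h3]
    simp only [shearFun, Pi.add_apply]
    ring
  map_smul' c ψ := by
    refine Lp.ext ((MemLp.coeFn_toLp _).trans ((shearFun_congr hA Q (Lp.coeFn_smul c ψ)).trans ?_))
    filter_upwards [Lp.coeFn_smul c ((memLp_shearFun hA Q ψ).toLp (shearFun A Q ψ)),
      (memLp_shearFun hA Q ψ).coeFn_toLp] with x h1 h2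
    rw [RingHom.id_apply, h1, Pi.smul_apply, h2]
    simp only [shearFun, Pi.smul_apply, smul_eq_mul]
    ring
  norm_map' ψ := by
    change ‖(memLp_shearFun hA Q ψ).toLp (shearFun A Q ψ)‖ = _
    rw [Lp.norm_toLp, eLpNorm_shearFun hA, Lp.norm_def]

theorem shearIsometry_coeFn {A : Matrix ι ι ℝ} (hA : IsUnit A.det) (Q : Matrix ι ι ℝ)
    (ψ : ModeSpace ι) : (shearIsometry hA Q ψ : Config ι → ℂ) =ᵐ[volume] shearFun A Q ψ :=
  (memLp_shearFun hA Q ψ).coeFn_toLp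

theorem shearIsometry_surjective {A : Matrix ι ι ℝ} (hA : IsUnit A.det) (Q : Matrix ι ι ℝ) :
    Function.Surjective (shearIsometry hA Q) := fun g => by
  have hA' : IsUnit A⁻¹.det := by
    rw [det_nonsing_inv]; exact hA.ringInverse
  refine ⟨shearIsometry hA' (-((A⁻¹)ᵀ * Q * A⁻¹)) g, Lp.ext ?_⟩
  refine (shearIsometry_coeFn hA Q _).trans
    ((shearFun_congr hA Q (shearIsometry_coeFn hA' _ g)).trans ?_)
  exact Filter.Eventually.of_forall fun x => shearFun_shearFun hA Q g x

/-- The unitary `ψ ↦ √|det A| exp (i xᵀQx / 2) ψ (A x)`. -/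
def shearUnitary {A : Matrix ι ι ℝ} (hA : IsUnit A.det) (Q : Matrix ι ι ℝ) :
    ModeSpace ι ≃ₗᵢ[ℂ] ModeSpace ι :=
  LinearIsometryEquiv.ofSurjective (shearIsometry hA Q) (shearIsometry_surjective hA Q)

theorem shearUnitary_coeFn {A : Matrix ι ι ℝ} (hA : IsUnit A.det) (Q : Matrix ι ι ℝ)
    (ψ : ModeSpace ι) : (shearUnitary hA Q ψ : Config ι → ℂ) =ᵐ[volume] shearFun A Q ψ :=
  shearIsometry_coeFn hA Q ψ

/-- Translating the chirp by `b` produces the phase `xᵀQb + bᵀQb / 2`. The first term replaces `a`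
by `a + Q b`, and the second is absorbed by the half-product in the definition of the Weyl operator.
-/
theorem weylFun_shearFun {A Q : Matrix ι ι ℝ} (hA : IsUnit A.det) (hQ : Qᵀ = Q)
    (ξ : ι ⊕ ι → ℝ) (f : Config ι → ℂ) (x : Config ι) :
    weylFun ξ (shearFun A Q f) x =
      shearFun A Q (weylFun ((shearMatrix A Q)ᵀ *ᵥ ξ) f) x := by
  set a : ι → ℝ := fun i => ξ (Sum.inl i) with ha
  set b : ι → ℝ := fun i => ξ (Sum.inr i) with hb
  set a' : ι → ℝ := (A⁻¹)ᵀ *ᵥ (a + Q *ᵥ b) with ha'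
  have hξ : (shearMatrix A Q)ᵀ *ᵥ ξ = Sum.elim a' (A *ᵥ b) := by
    rw [shearMatrix, fromBlocks_transpose, fromBlocks_mulVec]
    simp only [transpose_mul, hQ, transpose_zero, zero_mulVec, zero_add, transpose_transpose]
    congr 1
    rw [ha', mulVec_add, mulVec_mulVec]
    rfl
  have hdot : ∀ y : ι → ℝ, a' ⬝ᵥ (A *ᵥ y) = (a + Q *ᵥ b) ⬝ᵥ y := fun y => by
    rw [ha', dotProduct_mulVec, ← mulVec_transpose, mulVec_mulVec, ← transpose_mul,
      nonsing_inv_mul _ hA, transpose_one, one_mulVec]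
  have hsymm : ∀ u v : ι → ℝ, (Q *ᵥ u) ⬝ᵥ v = u ⬝ᵥ (Q *ᵥ v) := fun u v => by
    rw [dotProduct_mulVec, ← mulVec_transpose, hQ]
  rw [hξ]
  simp only [weylFun, shearFun, Sum.elim_inl, Sum.elim_inr]
  change Complex.exp (Complex.I * (((a ⬝ᵥ x.ofLp) + (1 / 2) * (a ⬝ᵥ b) : ℝ) : ℂ)) *
      ((Real.sqrt |A.det| : ℂ) * (Complex.exp (Complex.I * (((1 / 2) *
        ((x.ofLp + b) ⬝ᵥ (Q *ᵥ (x.ofLp + b))) : ℝ) : ℂ)) *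
          f (configMap A (x + WithLp.toLp 2 b)))) =
    (Real.sqrt |A.det| : ℂ) * (Complex.exp (Complex.I * (((1 / 2) *
        (x.ofLp ⬝ᵥ (Q *ᵥ x.ofLp)) : ℝ) : ℂ)) *
      (Complex.exp (Complex.I * (((a' ⬝ᵥ (A *ᵥ x.ofLp)) + (1 / 2) * (a' ⬝ᵥ (A *ᵥ b)) : ℝ) : ℂ)) *
        f (configMap A x + configMap A (WithLp.toLp 2 b))))
  have hexp : Complex.exp (Complex.I * (((a ⬝ᵥ x.ofLp) + (1 / 2) * (a ⬝ᵥ b) : ℝ) : ℂ)) *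
      Complex.exp (Complex.I * (((1 / 2) * ((x.ofLp + b) ⬝ᵥ (Q *ᵥ (x.ofLp + b))) : ℝ) : ℂ)) =
      Complex.exp (Complex.I * (((1 / 2) * (x.ofLp ⬝ᵥ (Q *ᵥ x.ofLp)) : ℝ) : ℂ)) *
      Complex.exp (Complex.I *
        (((a' ⬝ᵥ (A *ᵥ x.ofLp)) + (1 / 2) * (a' ⬝ᵥ (A *ᵥ b)) : ℝ) : ℂ)) := by
    rw [← Complex.exp_add, ← Complex.exp_add, ← mul_add, ← mul_add, ← Complex.ofReal_add,
      ← Complex.ofReal_add]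
    congr 3
    rw [hdot, hdot]
    simp only [mulVec_add, dotProduct_add, add_dotProduct, hsymm]
    have : x.ofLp ⬝ᵥ (Q *ᵥ b) = b ⬝ᵥ (Q *ᵥ x.ofLp) := by rw [← hsymm, dotProduct_comm]
    rw [this]
    ring
  rw [configMap_add]
  linear_combination (Real.sqrt |A.det| : ℂ) *
    f (configMap A x + configMap A (WithLp.toLp 2 b)) * hexp

theorem implements_shearUnitary {A Q : Matrix ι ι ℝ} (hA : IsUnit A.det) (hQ : Qᵀ = Q) :
    Implements (shearUnitary hA Q) (shearMatrix A Q) 0 := by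
  intro ξ φ
  simp only [dotProduct_zero, Complex.ofReal_zero, mul_zero, Complex.exp_zero, one_smul]
  refine weyl_eq_of_ae (shearUnitary_coeFn hA Q φ) ?_
  refine (shearUnitary_coeFn hA Q _).trans ((shearFun_congr hA Q (weyl_coeFn _ φ)).trans ?_)
  exact Filter.Eventually.of_forall fun x => (weylFun_shearFun hA hQ ξ φ x).symm

theorem isGaussianUnitary_iff {U : ModeSpace ι ≃ₗᵢ[ℂ] ModeSpace ι} :
    IsGaussianUnitary U ↔ ∃ S ∈ symplecticGroup ι ℝ, ∃ d, Implements U S d := Iff.rfl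

theorem isGaussianUnitary_shearUnitary {A Q : Matrix ι ι ℝ} (hA : IsUnit A.det) (hQ : Qᵀ = Q) :
    IsGaussianUnitary (shearUnitary hA Q) :=
  ⟨_, shearMatrix_mem hA hQ, 0, implements_shearUnitary hA hQ⟩

end Shear

/-! ### Product vectors -/

section Product

variable {ι : Type} [Fintype ι] {k : ℕ}

/-- The modes of `x` in the part `j`. -/
abbrev part (P : ι → Fin k) (x : Config ι) (j : Fin k) : Config (ModesOf P j) :=
  WithLp.toLp 2 fun i : ModesOf P j => x i.1

theorem sum_fiber {M : Type*} [AddCommMonoid M] (P : ι → Fin k) (f : ι → M) :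
    ∑ i, f i = ∑ j, ∑ i : ModesOf P j, f i.1 := by
  rw [← (Equiv.sigmaFiberEquiv P).sum_comp f, Fintype.sum_sigma]
  rfl

theorem prod_fiber {M : Type*} [CommMonoid M] (P : ι → Fin k) (f : ι → M) :
    ∏ i, f i = ∏ j, ∏ i : ModesOf P j, f i.1 := by
  rw [← (Equiv.sigmaFiberEquiv P).prod_comp f, Fintype.prod_sigma]
  rfl

theorem measurePreserving_unfiber (P : ι → Fin k) :
    MeasurePreserving (fun (y : (j : Fin k) → ModesOf P j → ℝ) (i : ι) => y (P i) ⟨i, rfl⟩)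
      (Measure.pi fun j => (volume : Measure (ModesOf P j → ℝ))) volume := by
  have hm : Measurable fun (y : (j : Fin k) → ModesOf P j → ℝ) (i : ι) => y (P i) ⟨i, rfl⟩ := by
    fun_prop
  refine ⟨hm, ?_⟩
  rw [volume_pi (α := fun _ : ι => ℝ)]
  refine (Measure.pi_eq fun s hs => ?_).symm
  rw [Measure.map_apply hm (MeasurableSet.univ_pi hs)]
  have : (fun (y : (j : Fin k) → ModesOf P j → ℝ) (i : ι) => y (P i) ⟨i, rfl⟩) ⁻¹' Set.univ.pi s =
      Set.univ.pi fun j => Set.univ.pi fun i : ModesOf P j => s i.1 := by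
    ext y
    simp only [Set.mem_preimage, Set.mem_univ_pi]
    constructor
    · rintro h j ⟨i, rfl⟩
      exact h i
    · intro h i
      exact h (P i) ⟨i, rfl⟩
  rw [this, Measure.pi_pi, prod_fiber P]
  refine Finset.prod_congr rfl fun j _ => ?_
  rw [volume_pi, Measure.pi_pi]

/-- The identification of a configuration with the family of its parts. -/
def partsEquiv (P : ι → Fin k) : Config ι ≃ᵐ ((j : Fin k) → Config (ModesOf P j)) where
  toFun := part P
  invFun y := WithLp.toLp 2 fun i => y (P i) ⟨i, rfl⟩
  left_inv x := rfl
  right_inv y := by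
    ext j ⟨i, rfl⟩
    rfl
  measurable_toFun := by
    change Measurable (part P)
    fun_prop
  measurable_invFun := by
    change Measurable fun y : (j : Fin k) → Config (ModesOf P j) =>
      (WithLp.toLp 2 fun i => y (P i) ⟨i, rfl⟩ : Config ι)
    fun_prop

theorem measurePreserving_partsEquiv (P : ι → Fin k) :
    MeasurePreserving (partsEquiv P) volume
      (Measure.pi fun j => (volume : Measure (Config (ModesOf P j)))) := by
  have h : MeasurePreserving (partsEquiv P).symm
      (Measure.pi fun j => (volume : Measure (Config (ModesOf P j)))) volume :=
    (PiLp.volume_preserving_toLp ι).comp ((measurePreserving_unfiber P).comp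
      (measurePreserving_pi _ _ fun j => PiLp.volume_preserving_ofLp (ModesOf P j)))
  exact h.symm

theorem memLp_prod (P : ι → Fin k) (φ : (j : Fin k) → ModeSpace (ModesOf P j)) :
    MemLp (fun x : Config ι => ∏ j, φ j (part P x j)) 2 volume := by
  have key : MemLp (fun y : (j : Fin k) → Config (ModesOf P j) => ∏ j, φ j (y j)) 2
      (Measure.pi fun j => (volume : Measure (Config (ModesOf P j)))) := by
    have hm : AEStronglyMeasurable
        (fun y : (j : Fin k) → Config (ModesOf P j) => ∏ j, φ j (y j))
        (Measure.pi fun j => (volume : Measure (Config (ModesOf P j)))) :=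
      Finset.aestronglyMeasurable_fun_prod _ fun j _ =>
        (Lp.aestronglyMeasurable (φ j)).comp_quasiMeasurePreserving
          (Measure.quasiMeasurePreserving_eval _ j)
    refine (memLp_two_iff_integrable_sq_norm hm).2 ?_
    have : (fun y : (j : Fin k) → Config (ModesOf P j) => ‖∏ j, φ j (y j)‖ ^ 2) =
        fun y => ∏ j, ‖φ j (y j)‖ ^ 2 := by
      ext y
      rw [norm_prod, Finset.prod_pow]
    rw [this]
    exact Integrable.fintype_prod_dep fun j => (Lp.memLp (φ j)).integrable_norm_pow (by norm_num)
  exact key.comp_measurePreserving (measurePreserving_partsEquiv P)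

/-- The product vector `⨂ j, φ j`. -/
def productVec (P : ι → Fin k) (φ : (j : Fin k) → ModeSpace (ModesOf P j)) : ModeSpace ι :=
  (memLp_prod P φ).toLp _

theorem productVec_coeFn (P : ι → Fin k) (φ : (j : Fin k) → ModeSpace (ModesOf P j)) :
    (productVec P φ : Config ι → ℂ) =ᵐ[volume] fun x => ∏ j, φ j (part P x j) :=
  MemLp.coeFn_toLp _

theorem isProductOf_iff {P : ι → Fin k} {φ : (j : Fin k) → ModeSpace (ModesOf P j)}
    {Ψ : ModeSpace ι} : IsProductOf P φ Ψ ↔ Ψ = productVec P φ :=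
  ⟨fun h => Lp.ext (h.trans (productVec_coeFn P φ).symm), fun h => h ▸ productVec_coeFn P φ⟩

theorem ae_part {P : ι → Fin k} {p : (j : Fin k) → Config (ModesOf P j) → Prop}
    (h : ∀ j, ∀ᵐ y, p j y) : ∀ᵐ x : Config ι, ∀ j, p j (part P x j) := by
  refine ae_all_iff.2 fun j => ?_
  exact ((Measure.quasiMeasurePreserving_eval
    (fun j => (volume : Measure (Config (ModesOf P j)))) j).comp
      (measurePreserving_partsEquiv P).quasiMeasurePreserving).ae (h j)

theorem productVec_eq_of_ae {P : ι → Fin k} {φ : (j : Fin k) → ModeSpace (ModesOf P j)}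
    {f : (j : Fin k) → Config (ModesOf P j) → ℂ} (h : ∀ j, (φ j : _ → ℂ) =ᵐ[volume] f j)
    {Ψ : ModeSpace ι} (hΨ : (Ψ : Config ι → ℂ) =ᵐ[volume] fun x => ∏ j, f j (part P x j)) :
    productVec P φ = Ψ := by
  refine Lp.ext ((productVec_coeFn P φ).trans (Filter.EventuallyEq.trans ?_ hΨ.symm))
  filter_upwards [ae_part h] with x hx
  exact Finset.prod_congr rfl fun j _ => hx j

theorem inner_productVec (P : ι → Fin k) (φ φ' : (j : Fin k) → ModeSpace (ModesOf P j)) :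
    inner ℂ (productVec P φ) (productVec P φ') = ∏ j, inner ℂ (φ j) (φ' j) := by
  simp only [L2.inner_def]
  have h1 : ∫ x : Config ι, inner ℂ (productVec P φ x) (productVec P φ' x) =
      ∫ x : Config ι, ∏ j, inner ℂ (φ j (part P x j)) (φ' j (part P x j)) := by
    refine integral_congr_ae ?_
    filter_upwards [productVec_coeFn P φ, productVec_coeFn P φ'] with x h1 h2
    rw [h1, h2]
    simp only [RCLike.inner_apply, map_prod, Finset.prod_mul_distrib]
  rw [h1, ← integral_fintype_prod_eq_prod (fun j y => inner ℂ (φ j y) (φ' j y))]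
  exact (measurePreserving_partsEquiv P).integral_comp'
    (g := fun y => ∏ j, inner ℂ (φ j (y j)) (φ' j (y j)))

theorem productVec_smul (P : ι → Fin k) (c : Fin k → ℂ)
    (φ : (j : Fin k) → ModeSpace (ModesOf P j)) :
    productVec P (fun j => c j • φ j) = (∏ j, c j) • productVec P φ := by
  refine productVec_eq_of_ae (fun j => Lp.coeFn_smul (c j) (φ j)) ?_
  filter_upwards [Lp.coeFn_smul (∏ j, c j) (productVec P φ), productVec_coeFn P φ] with x h1 h2
  rw [h1, Pi.smul_apply, h2]
  simp only [Pi.smul_apply, smul_eq_mul, Finset.prod_mul_distrib]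

/-- The restriction of a phase space vector to the quadratures of the part `j`. -/
def phasePart (P : ι → Fin k) (ξ : ι ⊕ ι → ℝ) (j : Fin k) : ModesOf P j ⊕ ModesOf P j → ℝ :=
  fun x => ξ (Sum.map Subtype.val Subtype.val x)

theorem weyl_productVec (P : ι → Fin k) (ξ : ι ⊕ ι → ℝ)
    (φ : (j : Fin k) → ModeSpace (ModesOf P j)) :
    weyl ξ (productVec P φ) = productVec P fun j => weyl (phasePart P ξ j) (φ j) := by
  refine weyl_eq_of_ae (productVec_coeFn P φ)
    ((productVec_coeFn P _).trans ?_)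
  filter_upwards [ae_part (P := P) fun j => weyl_coeFn (phasePart P ξ j) (φ j)] with x hx
  rw [Finset.prod_congr rfl fun j _ => hx j]
  simp only [weylFun, Finset.prod_mul_distrib, ← Complex.exp_sum, ← Finset.mul_sum,
    ← Complex.ofReal_sum]
  congr 4
  simp only [Finset.sum_add_distrib, ← Finset.mul_sum]
  rw [sum_fiber P fun i => ξ (Sum.inl i) * x i,
    sum_fiber P fun i => ξ (Sum.inl i) * ξ (Sum.inr i)]
  rfl

variable [DecidableEq ι]

/-- The real labelling of the modes that belongs to a partition. -/
def label (P : ι → Fin k) (i : ι) : ℝ := ((P i : ℕ) : ℝ)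

theorem label_eq_iff {P : ι → Fin k} {i i' : ι} : label P i = label P i' ↔ P i = P i' := by
  simp [label, Fin.ext_iff]

theorem sum_fiber_of_block {P : ι → Fin k} {A : Matrix ι ι ℝ} (hA : IsBlock (label P) A)
    (x : ι → ℝ) {j : Fin k} (i : ModesOf P j) :
    (A *ᵥ x) i.1 = ((A.toSquareBlock P j) *ᵥ fun i : ModesOf P j => x i.1) i := by
  rw [mulVec, dotProduct, sum_fiber P, Finset.sum_eq_single j]
  · rfl
  · intro l _ hl
    refine Finset.sum_eq_zero fun i' _ => ?_
    rw [isBlock_iff.1 hA i.1 i'.1 (fun e => hl ?_), zero_mul]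
    rw [← i'.2, ← i.2, label_eq_iff.1 e]
  · simp

theorem det_eq_prod_of_block {P : ι → Fin k} {A : Matrix ι ι ℝ} (hA : IsBlock (label P) A) :
    A.det = ∏ j, (A.toSquareBlock P j).det := by
  refine BlockTriangular.det_fintype fun x y h => isBlock_iff.1 hA x y fun e => ?_
  exact h.ne' (label_eq_iff.1 e)

theorem isUnit_det_toSquareBlock {P : ι → Fin k} {A : Matrix ι ι ℝ} (hA : IsBlock (label P) A)
    (h : IsUnit A.det) (j : Fin k) : IsUnit (A.toSquareBlock P j).det := by
  rw [det_eq_prod_of_block hA] at h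
  exact isUnit_of_dvd_unit (Finset.dvd_prod_of_mem
    (fun j => (A.toSquareBlock P j).det) (Finset.mem_univ j)) h

/-- For block matrices determinants multiply, quadratic forms add and the substitution acts
separately on each part. -/
theorem shearFun_prod {P : ι → Fin k} {A Q : Matrix ι ι ℝ} (hA : IsBlock (label P) A)
    (hQ : IsBlock (label P) Q) (f : (j : Fin k) → Config (ModesOf P j) → ℂ) (x : Config ι) :
    shearFun A Q (fun x => ∏ j, f j (part P x j)) x =
      ∏ j, shearFun (A.toSquareBlock P j) (Q.toSquareBlock P j) (f j) (part P x j) := by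
  simp only [shearFun, Finset.prod_mul_distrib, ← Complex.exp_sum, ← Finset.mul_sum,
    ← Complex.ofReal_sum, ← Complex.ofReal_prod]
  congr 1
  · rw [det_eq_prod_of_block hA, Finset.abs_prod, Real.sqrt_prod _ fun _ _ => abs_nonneg _]
  congr 1
  · congr 4
    rw [dotProduct, sum_fiber P]
    refine Finset.sum_congr rfl fun j _ => Finset.sum_congr rfl fun i _ => ?_
    rw [sum_fiber_of_block hQ]
  · refine Finset.prod_congr rfl fun j _ => congrArg (f j) ?_
    ext i
    exact sum_fiber_of_block hA x.ofLp i

theorem isLocalGaussianUnitary_shearUnitary {P : ι → Fin k} {A Q : Matrix ι ι ℝ}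
    (hA : IsUnit A.det) (hQ : Qᵀ = Q) (hAb : IsBlock (label P) A) (hQb : IsBlock (label P) Q) :
    IsLocalGaussianUnitary P (shearUnitary hA Q) := by
  refine ⟨fun j => shearUnitary (isUnit_det_toSquareBlock hAb hA j) (Q.toSquareBlock P j),
    fun j => isGaussianUnitary_shearUnitary _ ?_, fun φ => ⟨productVec P φ, productVec_coeFn P φ, ?_⟩⟩
  · ext x y
    exact congrFun₂ hQ x.1 y.1
  · refine isProductOf_iff.2 (productVec_eq_of_ae (fun j => shearUnitary_coeFn _ _ (φ j)) ?_).symm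
    refine (shearUnitary_coeFn hA Q _).trans ((shearFun_congr hA Q (productVec_coeFn P φ)).trans ?_)
    exact Filter.Eventually.of_forall fun x => shearFun_prod hAb hQb _ x

end Product

/-! ### The vacuum and the density of product vectors -/

section Vacuum

variable {ι : Type} [Fintype ι]

/-- An integrable function whose characteristic function vanishes is zero. -/
theorem ae_eq_zero_of_integral_exp_eq_zero {f : Config ι → ℂ} (hf : Integrable f volume)
    (h : ∀ a : ι → ℝ, ∫ x : Config ι,
      Complex.exp (Complex.I * ((∑ i, a i * x i : ℝ) : ℂ)) * f x = 0) : f =ᵐ[volume] 0 := by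
  have hF : ∀ w : Config ι, VectorFourier.fourierIntegral Real.fourierChar volume
      (innerₗ (Config ι)).flip f w = 0 := fun w => by
    refine Eq.trans ?_ (h fun i => -(2 * Real.pi * w i))
    rw [VectorFourier.fourierIntegral]
    refine integral_congr_ae (Filter.Eventually.of_forall fun x => ?_)
    simp only [Circle.smul_def, Real.fourierChar_apply, smul_eq_mul]
    congr 2
    rw [mul_comm Complex.I]
    congr 2
    simp only [LinearMap.flip_apply, innerₗ_apply_apply, PiLp.inner_apply, Finset.mul_sum,
      mul_neg, neg_mul, Finset.sum_neg_distrib]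
    congr 1
    refine Finset.sum_congr rfl fun i _ => ?_
    simp
    ring
  refine ae_eq_zero_of_integral_contDiff_smul_eq_zero hf.locallyIntegrable fun g hg hgc => ?_
  have hg1 : HasCompactSupport (Complex.ofRealCLM ∘ g) := hgc.comp_left rfl
  have hg2 : ContDiff ℝ (⊤ : ℕ∞) (Complex.ofRealCLM ∘ g) := by fun_prop
  set s : SchwartzMap (Config ι) ℂ := hg1.toSchwartzMap hg2 with hs
  -- The Fourier transform can be moved across the pairing: writing the test function as `𝓕 (𝓕⁻ s)`
  -- shifts the transform onto `f`, where it vanishes.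
  have hflip := VectorFourier.integral_fourierIntegral_smul_eq_flip (L := innerₗ (Config ι))
    (μ := volume) (ν := volume) Real.continuous_fourierChar (by
      change Continuous fun p : Config ι × Config ι => inner ℝ p.1 p.2
      fun_prop) (𝓕⁻ s).integrable hf
  simp only [hF, smul_zero, integral_zero] at hflip
  refine Eq.trans (integral_congr_ae (Filter.Eventually.of_forall fun x => ?_)) hflip
  have e : VectorFourier.fourierIntegral Real.fourierChar volume (innerₗ (Config ι))
      ((𝓕⁻ s : SchwartzMap (Config ι) ℂ) : Config ι → ℂ) x = s x := by
    have h1 : (𝓕 (𝓕⁻ s : SchwartzMap (Config ι) ℂ) : SchwartzMap (Config ι) ℂ) x = s x := by rw [FourierTransform.fourier_fourierInv_eq]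
    rw [SchwartzMap.fourier_coe] at h1
    exact h1
  simp only [e]
  rfl

theorem ae_eq_of_integral_exp_eq {f g : Config ι → ℂ} (hf : Integrable f volume)
    (hg : Integrable g volume)
    (h : ∀ a : ι → ℝ, ∫ x : Config ι, Complex.exp (Complex.I * ((∑ i, a i * x i : ℝ) : ℂ)) * f x =
      ∫ x : Config ι, Complex.exp (Complex.I * ((∑ i, a i * x i : ℝ) : ℂ)) * g x) :
    f =ᵐ[volume] g := by
  have hi : ∀ {f : Config ι → ℂ}, Integrable f volume → ∀ a : ι → ℝ, Integrable (fun x : Config ι =>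
      Complex.exp (Complex.I * ((∑ i, a i * x i : ℝ) : ℂ)) * f x) volume := fun {f} hf a => by
    refine hf.bdd_mul (c := 1) (Continuous.aestronglyMeasurable (by fun_prop))
      (Filter.Eventually.of_forall fun x => ?_)
    rw [mul_comm Complex.I, Complex.norm_exp_ofReal_mul_I]
  have h0 := ae_eq_zero_of_integral_exp_eq_zero (hf.sub hg) fun a => by
    simp only [Pi.sub_apply, mul_sub]
    rw [integral_sub (hi hf a) (hi hg a), h a, sub_self]
  filter_upwards [h0] with x hx
  exact sub_eq_zero.1 hx

/-- The amplitude of the ground state of the harmonic oscillator. -/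
def vacReal (x : Config ι) : ℝ :=
  Real.pi ^ (-(Fintype.card ι : ℝ) / 4) * Real.exp (-(1 / 2) * ‖x‖ ^ 2)

theorem vacReal_pos (x : Config ι) : 0 < vacReal x := by
  unfold vacReal
  have := Real.pi_pos
  positivity

theorem vacReal_mul (x y : Config ι) : vacReal x * vacReal y =
    Real.pi ^ (-(Fintype.card ι : ℝ) / 2) * Real.exp (-(1 / 2) * ‖x‖ ^ 2 - (1 / 2) * ‖y‖ ^ 2) := by
  rw [vacReal, vacReal, show -(1 / 2) * ‖x‖ ^ 2 - (1 / 2) * ‖y‖ ^ 2 =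
    -(1 / 2) * ‖x‖ ^ 2 + -(1 / 2) * ‖y‖ ^ 2 by ring, Real.exp_add,
    show -(Fintype.card ι : ℝ) / 2 = -(Fintype.card ι : ℝ) / 4 + -(Fintype.card ι : ℝ) / 4 by ring,
    Real.rpow_add Real.pi_pos]
  ring

theorem continuous_vacReal : Continuous (vacReal (ι := ι)) := by
  unfold vacReal
  fun_prop

theorem integrable_exp_neg_norm_sq : Integrable (fun x : Config ι => Real.exp (-‖x‖ ^ 2)) volume := by
  have := (GaussianFourier.integrable_cexp_neg_mul_sq_norm_add (b := 1) (by simp) 0 (0 : Config ι)).norm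
  refine this.congr (Filter.Eventually.of_forall fun x => ?_)
  simp only [Complex.norm_exp]
  congr 1
  simp [← Complex.ofReal_pow]

theorem vacReal_sq (x : Config ι) :
    vacReal x ^ 2 = Real.pi ^ (-(Fintype.card ι : ℝ) / 2) * Real.exp (-‖x‖ ^ 2) := by
  rw [sq, vacReal_mul]
  congr 2
  ring

theorem memLp_vac : MemLp (fun x : Config ι => (vacReal x : ℂ)) 2 volume := by
  refine (memLp_two_iff_integrable_sq_norm
    (Complex.continuous_ofReal.comp continuous_vacReal).aestronglyMeasurable).2 ?_
  refine (integrable_exp_neg_norm_sq.const_mul (Real.pi ^ (-(Fintype.card ι : ℝ) / 2))).congr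
    (Filter.Eventually.of_forall fun x => ?_)
  simp only [Function.comp_apply, Complex.norm_real, Real.norm_eq_abs, sq_abs, vacReal_sq]

variable (ι) in
/-- The vacuum state. -/
def vacuum : ModeSpace ι := memLp_vac.toLp _

theorem vacuum_coeFn : (vacuum ι : Config ι → ℂ) =ᵐ[volume] fun x => (vacReal x : ℂ) :=
  MemLp.coeFn_toLp _

theorem norm_vacuum : ‖vacuum ι‖ = 1 := by
  have h : ‖vacuum ι‖ ^ 2 = 1 := by
    rw [← inner_self_eq_norm_sq (𝕜 := ℂ), L2.inner_def]
    have : ∫ x : Config ι, inner ℂ (vacuum ι x) (vacuum ι x) =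
        ((∫ x : Config ι, vacReal x ^ 2 : ℝ) : ℂ) := by
      rw [← integral_complex_ofReal]
      refine integral_congr_ae ?_
      filter_upwards [vacuum_coeFn (ι := ι)] with x hx
      rw [hx]
      simp only [RCLike.inner_apply, Complex.conj_ofReal, sq, Complex.ofReal_mul]
    rw [this]
    simp_rw [vacReal_sq]
    rw [integral_const_mul]
    have h2 := GaussianFourier.integral_rexp_neg_mul_sq_norm (V := Config ι) (b := 1) one_pos
    simp only [neg_mul, one_mul, div_one, finrank_euclideanSpace] at h2
    rw [h2, ← Real.rpow_add Real.pi_pos]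
    simp [neg_div]
  exact (pow_eq_one_iff_of_nonneg (norm_nonneg _) two_ne_zero).1 h

theorem vacReal_eq_prod {k : ℕ} (P : ι → Fin k) (x : Config ι) :
    vacReal x = ∏ j, vacReal (part P x j) := by
  simp only [vacReal, Finset.prod_mul_distrib, ← Real.exp_sum, EuclideanSpace.real_norm_sq_eq]
  congr 1
  · rw [← Real.rpow_sum_of_pos Real.pi_pos, ← Finset.sum_div, Finset.sum_neg_distrib]
    congr 3
    have := sum_fiber P fun _ => (1 : ℝ)
    simpa using this
  · rw [← Finset.mul_sum, sum_fiber P]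

theorem vacuum_eq_productVec {k : ℕ} (P : ι → Fin k) :
    productVec P (fun j => vacuum (ModesOf P j)) = vacuum ι := by
  refine productVec_eq_of_ae (fun j => vacuum_coeFn) (vacuum_coeFn.trans ?_)
  refine Filter.Eventually.of_forall fun x => ?_
  simp only []
  rw [vacReal_eq_prod P x, Complex.ofReal_prod]

/-- The span of the product vectors is dense. -/
theorem dense_span_productVec {k : ℕ} (P : ι → Fin k) :
    (Submodule.span ℂ (Set.range (productVec P))).topologicalClosure = ⊤ := by
  rw [Submodule.topologicalClosure_eq_top_iff, Submodule.eq_bot_iff]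
  intro Ψ hΨ
  rw [Submodule.mem_orthogonal] at hΨ
  -- Modulated vacua are product vectors. Orthogonality to all of them says that the product of the
  -- vacuum with `conj Ψ` has zero Fourier transform, and the vacuum has no zeros.
  have h0 : ∀ a : ι → ℝ, inner ℂ Ψ (weyl (Sum.elim a 0) (vacuum ι)) = 0 := fun a => by
    rw [← inner_conj_symm, hΨ, map_zero]
    refine Submodule.subset_span ?_
    rw [← vacuum_eq_productVec P, weyl_productVec]
    exact ⟨_, rfl⟩
  have hint : Integrable (fun x : Config ι => vacuum ι x * starRingEnd ℂ (Ψ x)) volume :=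
    L2.integrable_inner Ψ (vacuum ι)
  have hz := ae_eq_zero_of_integral_exp_eq_zero hint fun a => by
    rw [← h0 a, inner_weyl]
    refine integral_congr_ae (Filter.Eventually.of_forall fun x => ?_)
    simp only [weylFun, Sum.elim_inl, Sum.elim_inr, Pi.zero_apply, mul_zero, Finset.sum_const_zero,
      add_zero]
    rw [show (WithLp.toLp 2 fun _ : ι => (0 : ℝ)) = 0 from rfl, add_zero, mul_assoc]
  refine (Lp.eq_zero_iff_ae_eq_zero).2 ?_
  filter_upwards [hz, vacuum_coeFn (ι := ι)] with x hx hv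
  rw [hv] at hx
  have := (mul_eq_zero.1 hx).resolve_left (Complex.ofReal_ne_zero.2 (vacReal_pos x).ne')
  simpa using this

end Vacuum

/-! ### Local unitaries act by block matrices -/

section Local

variable {ι : Type} [Fintype ι] [DecidableEq ι] {k : ℕ}

/-- The quadratures grouped by parts. -/
def phaseEquiv (P : ι → Fin k) : ι ⊕ ι ≃ (j : Fin k) × (ModesOf P j ⊕ ModesOf P j) where
  toFun := Sum.elim (fun i => ⟨P i, Sum.inl ⟨i, rfl⟩⟩) (fun i => ⟨P i, Sum.inr ⟨i, rfl⟩⟩)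
  invFun y := Sum.map Subtype.val Subtype.val y.2
  left_inv := by rintro (x | x) <;> rfl
  right_inv := by rintro ⟨_, ⟨x, rfl⟩ | ⟨x, rfl⟩⟩ <;> rfl

/-- The block matrix with given blocks. -/
def assemble (P : ι → Fin k)
    (S : (j : Fin k) → Matrix (ModesOf P j ⊕ ModesOf P j) (ModesOf P j ⊕ ModesOf P j) ℝ) :
    Matrix (ι ⊕ ι) (ι ⊕ ι) ℝ :=
  (blockDiagonal' S).submatrix (phaseEquiv P) (phaseEquiv P)

theorem assemble_J (P : ι → Fin k) : assemble P (fun j => J (ModesOf P j) ℝ) = J ι ℝ := by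
  have : blockDiagonal' (fun j => J (ModesOf P j) ℝ) =
      (J ι ℝ).submatrix (phaseEquiv P).symm (phaseEquiv P).symm := by
    ext ⟨j, x⟩ ⟨l, y⟩
    by_cases h : j = l
    · subst h
      rw [blockDiagonal'_apply_eq]
      rcases x with x | x <;> rcases y with y | y <;>
        simp [J, phaseEquiv, one_apply, Subtype.ext_iff]
    · rw [blockDiagonal'_apply_ne _ _ _ h]
      rcases x with ⟨x, rfl⟩ | ⟨x, rfl⟩ <;> rcases y with ⟨y, rfl⟩ | ⟨y, rfl⟩ <;>
        simp [J, phaseEquiv, one_apply] <;> exact fun e => h (by rw [e])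
  rw [assemble, this]
  simp

theorem assemble_mem {P : ι → Fin k}
    {S : (j : Fin k) → Matrix (ModesOf P j ⊕ ModesOf P j) (ModesOf P j ⊕ ModesOf P j) ℝ}
    (hS : ∀ j, S j ∈ symplecticGroup (ModesOf P j) ℝ) : assemble P S ∈ symplecticGroup ι ℝ := by
  rw [SymplecticGroup.mem_iff, ← assemble_J P]
  simp only [assemble, transpose_submatrix, submatrix_mul_equiv, blockDiagonal'_transpose,
    ← blockDiagonal'_mul]
  congr 2
  ext1 j
  exact SymplecticGroup.mem_iff.1 (hS j)

theorem isBlock_assemble (P : ι → Fin k)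
    (S : (j : Fin k) → Matrix (ModesOf P j ⊕ ModesOf P j) (ModesOf P j ⊕ ModesOf P j) ℝ) :
    IsBlock (Sum.elim (label P) (label P)) (assemble P S) := by
  refine isBlock_iff.2 fun x y h => ?_
  rw [assemble, submatrix_apply]
  refine blockDiagonal'_apply_ne _ _ _ fun e => h ?_
  rcases x with x | x <;> rcases y with y | y <;> exact label_eq_iff.2 e

theorem phasePart_assemble (P : ι → Fin k)
    (S : (j : Fin k) → Matrix (ModesOf P j ⊕ ModesOf P j) (ModesOf P j ⊕ ModesOf P j) ℝ)
    (ξ : ι ⊕ ι → ℝ) (j : Fin k) :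
    phasePart P ((assemble P S)ᵀ *ᵥ ξ) j = (S j)ᵀ *ᵥ phasePart P ξ j := by
  ext x
  have hx : phaseEquiv P (Sum.map Subtype.val Subtype.val x) = ⟨j, x⟩ :=
    (phaseEquiv P).apply_symm_apply ⟨j, x⟩
  simp only [phasePart, mulVec, dotProduct, transpose_apply, assemble, submatrix_apply, hx]
  rw [← (phaseEquiv P).symm.sum_comp, Fintype.sum_sigma, Finset.sum_eq_single j]
  · refine Finset.sum_congr rfl fun y _ => ?_
    rw [Equiv.apply_symm_apply, blockDiagonal'_apply_eq]
    rfl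
  · intro l _ hl
    refine Finset.sum_eq_zero fun y _ => ?_
    rw [Equiv.apply_symm_apply, blockDiagonal'_apply_ne _ _ _ hl, zero_mul]
  · simp

/-- On product vectors the intertwining relation is the product of the relations of the factors.
Both sides are continuous and linear, so density extends it to the whole space. -/
theorem IsLocalGaussianUnitary.exists_implements {P : ι → Fin k}
    {U : ModeSpace ι ≃ₗᵢ[ℂ] ModeSpace ι} (hU : IsLocalGaussianUnitary P U) :
    ∃ S ∈ symplecticGroup ι ℝ, IsBlock (Sum.elim (label P) (label P)) S ∧
      ∃ d, Implements U S d := by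
  obtain ⟨u, hu, hprod⟩ := hU
  choose S hS d hd using hu
  have hUp : ∀ φ, U (productVec P φ) = productVec P fun j => u j (φ j) := fun φ => by
    obtain ⟨Ψ, h1, h2⟩ := hprod φ
    rw [← isProductOf_iff.1 h1, isProductOf_iff.1 h2]
  refine ⟨assemble P S, assemble_mem hS, isBlock_assemble P S,
    fun x => d _ (phaseEquiv P x).2, fun ξ Φ => ?_⟩
  set D : ι ⊕ ι → ℝ := fun x => d _ (phaseEquiv P x).2 with hD
  set c : ℂ := Complex.exp (Complex.I * ((ξ ⬝ᵥ D : ℝ) : ℂ)) with hc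
  have hcprod : c = ∏ j, Complex.exp (Complex.I * ((phasePart P ξ j ⬝ᵥ d j : ℝ) : ℂ)) := by
    rw [← Complex.exp_sum, ← Finset.mul_sum, ← Complex.ofReal_sum, hc, dotProduct,
      ← (phaseEquiv P).symm.sum_comp, Fintype.sum_sigma]
    refine congrArg (fun r : ℝ => Complex.exp (Complex.I * (r : ℂ)))
      (Finset.sum_congr rfl fun j _ => Finset.sum_congr rfl fun x _ => ?_)
    rcases x with ⟨x, rfl⟩ | ⟨x, rfl⟩ <;> rfl
  let L : ModeSpace ι →L[ℂ] ModeSpace ι :=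
    (weylIsometry ξ).toContinuousLinearMap.comp (U.toContinuousLinearEquiv : _ →L[ℂ] _) -
      c • (U.toContinuousLinearEquiv : ModeSpace ι →L[ℂ] ModeSpace ι).comp
        (weylIsometry ((assemble P S)ᵀ *ᵥ ξ)).toContinuousLinearMap
  have hL : ∀ Φ, L Φ = weyl ξ (U Φ) - c • U (weyl ((assemble P S)ᵀ *ᵥ ξ) Φ) := fun Φ => rfl
  have hker : (Submodule.span ℂ (Set.range (productVec P))).topologicalClosure ≤
      LinearMap.ker (L : ModeSpace ι →ₗ[ℂ] ModeSpace ι) := by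
    refine Submodule.topologicalClosure_minimal _ (Submodule.span_le.2 ?_) L.isClosed_ker
    rintro _ ⟨φ, rfl⟩
    change L _ = 0
    rw [hL, hUp, weyl_productVec, weyl_productVec, hUp, sub_eq_zero, hcprod, ← productVec_smul]
    congr 1
    ext1 j
    rw [phasePart_assemble]
    exact hd j _ _
  have : L Φ = 0 := hker (by rw [dense_span_productVec]; trivial)
  rw [hL, sub_eq_zero] at this
  exact this

end Local

/-! ### Purity -/

section Purity

variable {ι : Type} [Fintype ι] [DecidableEq ι]

theorem norm_sq_eq_dotProduct (x : Config ι) : ‖x‖ ^ 2 = x.ofLp ⬝ᵥ x.ofLp := by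
  rw [EuclideanSpace.real_norm_sq_eq, dotProduct]
  exact Finset.sum_congr rfl fun i _ => sq _

/-- The correlation kernel `ψ (x + b) * conj (ψ x)` of a Gaussian state whose covariance matrix has
position block `1` and the remaining blocks `Y` and `Z`. -/
def gaussKernel (Y Z : Matrix ι ι ℝ) (b x : ι → ℝ) : ℂ :=
  ((Real.pi ^ (-(Fintype.card ι : ℝ) / 2) * Real.exp (-(1 / 4) * (b ⬝ᵥ (Z *ᵥ b)) +
      (1 / 4) * ((Y *ᵥ b) ⬝ᵥ (Y *ᵥ b)) -
        (x + (1 / 2 : ℝ) • b) ⬝ᵥ (x + (1 / 2 : ℝ) • b)) : ℝ) : ℂ) *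
    Complex.exp (Complex.I * (((x + (1 / 2 : ℝ) • b) ⬝ᵥ (Y *ᵥ b) : ℝ) : ℂ))

theorem norm_gaussKernel (Y Z : Matrix ι ι ℝ) (b x : ι → ℝ) :
    ‖gaussKernel Y Z b x‖ = Real.pi ^ (-(Fintype.card ι : ℝ) / 2) *
      Real.exp (-(1 / 4) * (b ⬝ᵥ (Z *ᵥ b)) + (1 / 4) * ((Y *ᵥ b) ⬝ᵥ (Y *ᵥ b)) -
        (x + (1 / 2 : ℝ) • b) ⬝ᵥ (x + (1 / 2 : ℝ) • b)) := by
  have := Real.pi_pos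
  rw [gaussKernel, norm_mul, mul_comm Complex.I, Complex.norm_exp_ofReal_mul_I, mul_one,
    Complex.norm_real, Real.norm_of_nonneg (by positivity)]

theorem integrable_gaussKernel (Y Z : Matrix ι ι ℝ) (b : ι → ℝ) :
    Integrable (fun x : Config ι => gaussKernel Y Z b x.ofLp) volume := by
  have h1 : Integrable (fun x : Config ι =>
      Real.exp (-‖x + WithLp.toLp 2 ((1 / 2 : ℝ) • b)‖ ^ 2)) volume :=
    integrable_exp_neg_norm_sq.comp_add_right _
  refine (h1.const_mul (Real.pi ^ (-(Fintype.card ι : ℝ) / 2) *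
    Real.exp (-(1 / 4) * (b ⬝ᵥ (Z *ᵥ b)) + (1 / 4) * ((Y *ᵥ b) ⬝ᵥ (Y *ᵥ b))))).mono' ?_
    (Filter.Eventually.of_forall fun x => ?_)
  · refine Continuous.aestronglyMeasurable ?_
    unfold gaussKernel
    simp only [dotProduct]
    fun_prop
  · rw [norm_gaussKernel, mul_assoc, ← Real.exp_add, norm_sq_eq_dotProduct]
    rfl

/-- The Gaussian integral that identifies the kernel; the recentring by `b / 2` produces the phase
`exp (-i a·b / 2)`. -/
theorem integral_exp_mul_gaussKernel (Y Z : Matrix ι ι ℝ) (a b : ι → ℝ) :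
    ∫ x : Config ι, Complex.exp (Complex.I * ((∑ i, a i * x i : ℝ) : ℂ)) *
        gaussKernel Y Z b x.ofLp =
      Complex.exp (-(Complex.I * (((1 / 2) * (a ⬝ᵥ b) : ℝ) : ℂ))) *
        ((Real.exp (-(1 / 4) * (a ⬝ᵥ a + 2 * (a ⬝ᵥ (Y *ᵥ b)) + b ⬝ᵥ (Z *ᵥ b))) : ℝ) : ℂ) := by
  set r : ℝ := -(1 / 4) * (b ⬝ᵥ (Z *ᵥ b)) + (1 / 4) * ((Y *ᵥ b) ⬝ᵥ (Y *ᵥ b)) with hr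
  set C : ℂ := ((Real.pi ^ (-(Fintype.card ι : ℝ) / 2) : ℝ) : ℂ) *
    (Complex.exp (r : ℂ) * Complex.exp (-(Complex.I * (((1 / 2) * (a ⬝ᵥ b) : ℝ) : ℂ)))) with hC
  have key : ∀ x : Config ι, Complex.exp (Complex.I * ((∑ i, a i * x i : ℝ) : ℂ)) *
        gaussKernel Y Z b x.ofLp =
      (fun v : Config ι => C * Complex.exp (-1 * (‖v‖ : ℂ) ^ 2 + Complex.I *
        ((inner ℝ (WithLp.toLp 2 (a + Y *ᵥ b) : Config ι) v : ℝ) : ℂ)))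
        (x + WithLp.toLp 2 ((1 / 2 : ℝ) • b)) := by
    intro x
    have e1 : (‖x + WithLp.toLp 2 ((1 / 2 : ℝ) • b)‖ : ℂ) ^ 2 =
        (((x.ofLp + (1 / 2 : ℝ) • b) ⬝ᵥ (x.ofLp + (1 / 2 : ℝ) • b) : ℝ) : ℂ) := by
      rw [← Complex.ofReal_pow, norm_sq_eq_dotProduct]
      rfl
    have e2 : inner ℝ (WithLp.toLp 2 (a + Y *ᵥ b) : Config ι)
        (x + WithLp.toLp 2 ((1 / 2 : ℝ) • b)) =
        (x.ofLp + (1 / 2 : ℝ) • b) ⬝ᵥ (a + Y *ᵥ b) := by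
      rw [EuclideanSpace.inner_eq_star_dotProduct]
      rfl
    have e3 : ∑ i, a i * x i = x.ofLp ⬝ᵥ a := by
      rw [dotProduct_comm]; rfl
    simp only [gaussKernel, hC]
    rw [e1, e2, e3, Complex.ofReal_mul, Complex.ofReal_exp, mul_left_comm, mul_assoc, mul_assoc,
      mul_left_comm, mul_assoc, ← Complex.exp_add, ← Complex.exp_add, ← Complex.exp_add,
      mul_left_comm, ← Complex.exp_add]
    congr 2
    rw [dotProduct_add _ a, add_dotProduct _ _ a, smul_dotProduct, dotProduct_comm b a]
    simp only [← hr, smul_eq_mul]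
    push_cast
    ring
  simp_rw [key]
  rw [integral_add_right_eq_self (fun v : Config ι => C * Complex.exp (-1 * (‖v‖ : ℂ) ^ 2 +
    Complex.I * ((inner ℝ (WithLp.toLp 2 (a + Y *ᵥ b) : Config ι) v : ℝ) : ℂ))),
    integral_const_mul, GaussianFourier.integral_cexp_neg_mul_sq_norm_add (by simp)]
  have e4 : (‖(WithLp.toLp 2 (a + Y *ᵥ b) : Config ι)‖ : ℂ) ^ 2 =
      (((a + Y *ᵥ b) ⬝ᵥ (a + Y *ᵥ b) : ℝ) : ℂ) := by
    rw [← Complex.ofReal_pow, norm_sq_eq_dotProduct]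
  have e5 : ((Real.pi ^ (-(Fintype.card ι : ℝ) / 2) : ℝ) : ℂ) *
      ((Real.pi : ℂ) / 1) ^ ((Module.finrank ℝ (Config ι) : ℂ) / 2) = 1 := by
    rw [finrank_euclideanSpace, div_one]
    have : ((Fintype.card ι : ℂ) / 2) = (((Fintype.card ι : ℝ) / 2 : ℝ) : ℂ) := by push_cast; rfl
    rw [this, ← Complex.ofReal_cpow Real.pi_pos.le, ← Complex.ofReal_mul,
      ← Real.rpow_add Real.pi_pos, neg_div, neg_add_cancel, Real.rpow_zero, Complex.ofReal_one]
  rw [hC, e4, Complex.I_sq, Complex.ofReal_exp]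
  have e6 : Complex.exp (r : ℂ) * Complex.exp (-1 *
      (((a + Y *ᵥ b) ⬝ᵥ (a + Y *ᵥ b) : ℝ) : ℂ) / (4 * 1)) =
      Complex.exp ((-(1 / 4) * (a ⬝ᵥ a + 2 * (a ⬝ᵥ (Y *ᵥ b)) + b ⬝ᵥ (Z *ᵥ b)) : ℝ) : ℂ) := by
    rw [← Complex.exp_add, hr]
    congr 1
    simp only [dotProduct_add, add_dotProduct, dotProduct_comm (Y *ᵥ b) a]
    push_cast
    ring
  linear_combination (Complex.exp (r : ℂ) * Complex.exp (-(Complex.I *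
      (((1 / 2) * (a ⬝ᵥ b) : ℝ) : ℂ))) * Complex.exp (-1 *
      (((a + Y *ᵥ b) ⬝ᵥ (a + Y *ᵥ b) : ℝ) : ℂ) / (4 * 1))) * e5 +
    Complex.exp (-(Complex.I * (((1 / 2) * (a ⬝ᵥ b) : ℝ) : ℂ))) * e6

/-- The correlation kernel of a Gaussian state in normal form. -/
theorem HasGaussianChar.ae_eq_gaussKernel {φ : ModeSpace ι} {Y Z : Matrix ι ι ℝ}
    (h : HasGaussianChar φ (fromBlocks 1 Y Yᵀ Z) 0) (b : ι → ℝ) :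
    ∀ᵐ x : Config ι, φ (x + WithLp.toLp 2 b) * starRingEnd ℂ (φ x) = gaussKernel Y Z b x.ofLp := by
  have hshift : MemLp (fun x : Config ι => φ (x + WithLp.toLp 2 b)) 2 volume :=
    (Lp.memLp φ).comp_measurePreserving (measurePreserving_add_right volume _)
  have hint : Integrable (fun x : Config ι => φ (x + WithLp.toLp 2 b) * starRingEnd ℂ (φ x))
      volume := hshift.integrable_mul (Lp.memLp φ).star
  -- For fixed `b`, the characteristic function at `(a, b)` is, up to the phase `exp (i a·b / 2)`,
  -- the Fourier transform in `a` of the correlation kernel, which it therefore determines.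
  refine ae_eq_of_integral_exp_eq hint (integrable_gaussKernel Y Z b) fun a => ?_
  rw [integral_exp_mul_gaussKernel]
  have h1 := h (Sum.elim a b)
  rw [inner_weyl] at h1
  simp only [dotProduct_zero, Complex.ofReal_zero, mul_zero, Complex.exp_zero, one_mul] at h1
  have e1 : Sum.elim a b ⬝ᵥ (fromBlocks 1 Y Yᵀ Z *ᵥ Sum.elim a b) =
      a ⬝ᵥ a + 2 * (a ⬝ᵥ (Y *ᵥ b)) + b ⬝ᵥ (Z *ᵥ b) := by
    rw [fromBlocks_mulVec, sumElim_dotProduct_sumElim]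
    simp only [Sum.elim_comp_inl, Sum.elim_comp_inr, one_mulVec, dotProduct_add]
    rw [mulVec_transpose, dotProduct_comm b (a ᵥ* Y), ← dotProduct_mulVec]
    ring
  rw [e1] at h1
  rw [← h1, ← integral_const_mul]
  refine integral_congr_ae (Filter.Eventually.of_forall fun x => ?_)
  simp only [weylFun, Sum.elim_inl, Sum.elim_inr]
  rw [← mul_assoc, ← mul_assoc, ← mul_assoc, ← Complex.exp_add]
  congr 3
  simp only [dotProduct]
  push_cast
  ring

theorem exp_eq_one_of_mul_exp_eq {r s α β : ℝ} (hr : 0 < r) (hs : 0 < s)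
    (h : (r : ℂ) * Complex.exp (Complex.I * (α : ℂ)) = s * Complex.exp (Complex.I * (β : ℂ))) :
    r = s ∧ Complex.exp (Complex.I * ((α - β : ℝ) : ℂ)) = 1 := by
  have h1 : r = s := by
    have := congrArg norm h
    rwa [norm_mul, norm_mul, mul_comm Complex.I, mul_comm Complex.I, Complex.norm_exp_ofReal_mul_I,
      Complex.norm_exp_ofReal_mul_I, mul_one, mul_one, Complex.norm_real, Complex.norm_real,
      Real.norm_of_nonneg hr.le, Real.norm_of_nonneg hs.le] at this
  refine ⟨h1, ?_⟩
  rw [h1] at h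
  have h2 := mul_left_cancel₀ (Complex.ofReal_ne_zero.2 hs.ne') h
  rw [Complex.ofReal_sub, mul_sub, Complex.exp_sub, h2, div_self (Complex.exp_ne_zero _)]

theorem mul_exp_mul_mul_exp (r s α β : ℝ) :
    (r : ℂ) * Complex.exp (Complex.I * (α : ℂ)) * (s * Complex.exp (Complex.I * (β : ℂ))) =
      ((r * s : ℝ) : ℂ) * Complex.exp (Complex.I * ((α + β : ℝ) : ℂ)) := by
  rw [Complex.ofReal_mul, Complex.ofReal_add, mul_add, Complex.exp_add, mul_mul_mul_comm]

/-- This is where purity enters: both sides are the same four factors `φ (x + b)`, `conj (φ x)`, `φ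
(x + b + b')`, `conj (φ (x + b))`, grouped differently. One point common to four sets of full
measure suffices. -/
theorem HasGaussianChar.exists_gaussKernel_mul {φ : ModeSpace ι} {Y Z : Matrix ι ι ℝ}
    (h : HasGaussianChar φ (fromBlocks 1 Y Yᵀ Z) 0) (b b' : ι → ℝ) :
    ∃ x : ι → ℝ, gaussKernel Y Z b x * gaussKernel Y Z b' (x + b) =
      gaussKernel Y Z 0 (x + b) * gaussKernel Y Z (b + b') x := by
  have h1 := h.ae_eq_gaussKernel b
  have h2 := ae_shift (h.ae_eq_gaussKernel b') (WithLp.toLp 2 b)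
  have h3 := ae_shift (h.ae_eq_gaussKernel 0) (WithLp.toLp 2 b)
  have h4 := h.ae_eq_gaussKernel (b + b')
  obtain ⟨x, h1, h2, h3, h4⟩ := (h1.and (h2.and (h3.and h4))).exists
  refine ⟨x.ofLp, ?_⟩
  have e : x + WithLp.toLp 2 b + WithLp.toLp 2 b' = x + WithLp.toLp 2 (b + b') := by
    rw [add_assoc, WithLp.toLp_add]
  rw [WithLp.toLp_zero, add_zero] at h3
  rw [e] at h2
  change _ = gaussKernel Y Z _ (x.ofLp + b) at h2
  change _ = gaussKernel Y Z _ (x.ofLp + b) at h3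
  rw [← h1, ← h2, ← h3, ← h4]
  ring

theorem eq_zero_of_forall_dotProduct {M : Matrix ι ι ℝ}
    (h : ∀ b b' : ι → ℝ, b ⬝ᵥ (M *ᵥ b') = 0) : M = 0 := by
  ext i j
  have := h (Pi.single i 1) (Pi.single j 1)
  rw [mulVec_single_one, single_one_dotProduct] at this
  exact this

/-- A pure Gaussian state in normal form is the vacuum. -/
theorem HasGaussianChar.eq_one_of_normalForm {φ : ModeSpace ι} {Y Z : Matrix ι ι ℝ}
    (h : HasGaussianChar φ (fromBlocks 1 Y Yᵀ Z) 0) (hY : Yᵀ = -Y) (hZ : Zᵀ = Z) :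
    Y = 0 ∧ Z = 1 := by
  have hpi : 0 < Real.pi ^ (-(Fintype.card ι : ℝ) / 2) := Real.rpow_pos_of_pos Real.pi_pos _
  have hcomm : ∀ r s : ℝ, Real.pi ^ (-(Fintype.card ι : ℝ) / 2) * r *
      (Real.pi ^ (-(Fintype.card ι : ℝ) / 2) * s) = Real.pi ^ (-(Fintype.card ι : ℝ) / 2) *
        Real.pi ^ (-(Fintype.card ι : ℝ) / 2) * (r * s) := fun r s => mul_mul_mul_comm _ _ _ _
  have hanti : ∀ u v : ι → ℝ, u ⬝ᵥ (Y *ᵥ v) = -(v ⬝ᵥ (Y *ᵥ u)) := fun u v => by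
    rw [dotProduct_mulVec, ← mulVec_transpose, hY, neg_mulVec, neg_dotProduct, dotProduct_comm]
  have hself : ∀ v : ι → ℝ, v ⬝ᵥ (Y *ᵥ v) = 0 := fun v => by linarith [hanti v v]
  have key : ∀ b b' : ι → ℝ, ∃ x : ι → ℝ, _ := fun b b' => h.exists_gaussKernel_mul b b'
  simp only [gaussKernel] at key
  -- Comparing phases, the dependence on `x` cancels and `b ⬝ᵥ (Y *ᵥ b')` remains, by antisymmetry
  -- of `Y`.
  have hphase : ∀ b b' : ι → ℝ, Complex.exp (Complex.I * ((b ⬝ᵥ (Y *ᵥ b') : ℝ) : ℂ)) = 1 := by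
    intro b b'
    obtain ⟨x, hx⟩ := key b b'
    rw [mul_exp_mul_mul_exp, mul_exp_mul_mul_exp] at hx
    have := (exp_eq_one_of_mul_exp_eq (by positivity) (by positivity) hx).2
    rw [← this]
    congr 3
    simp only [mulVec_zero, dotProduct_zero, mulVec_add, dotProduct_add, add_dotProduct,
      smul_dotProduct, smul_eq_mul, hself, hanti b' b]
    ring
  have hY0 : Y = 0 := by
    refine eq_zero_of_forall_dotProduct fun b b' => ?_
    by_contra hne
    -- Rescaling `b` makes the phase equal to `π`, contradicting `exp (iπ) = -1`.
    have := hphase ((Real.pi / (b ⬝ᵥ (Y *ᵥ b'))) • b) b'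
    rw [smul_dotProduct, smul_eq_mul, div_mul_cancel₀ _ hne, mul_comm Complex.I,
      Complex.exp_pi_mul_I] at this
    norm_num at this
  refine ⟨hY0, ?_⟩
  have hquad : ∀ b : ι → ℝ, b ⬝ᵥ (Z *ᵥ b) = b ⬝ᵥ b := by
    intro b
    -- With `b' = -b` the right side involves only the density, and the moduli compare the quadratic
    -- form of `Z` with that of `1`.
    obtain ⟨x, hx⟩ := key b (-b)
    rw [mul_exp_mul_mul_exp, mul_exp_mul_mul_exp] at hx
    have := (exp_eq_one_of_mul_exp_eq (by positivity) (by positivity) hx).1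
    rw [hcomm, hcomm, ← Real.exp_add, ← Real.exp_add] at this
    have := Real.exp_injective (mul_left_cancel₀ (mul_pos hpi hpi).ne' this)
    simp only [hY0, zero_mulVec, mulVec_neg, dotProduct_neg, neg_dotProduct, smul_neg,
      dotProduct_add, add_dotProduct, smul_dotProduct, dotProduct_smul, smul_eq_mul, add_neg_cancel,
      dotProduct_zero, zero_dotProduct, mulVec_zero, smul_zero, dotProduct_comm b x] at this
    linarith
  have hsymm : ∀ u v : ι → ℝ, u ⬝ᵥ (Z *ᵥ v) = v ⬝ᵥ (Z *ᵥ u) := fun u v => by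
    rw [dotProduct_mulVec, ← mulVec_transpose, hZ, dotProduct_comm]
  refine sub_eq_zero.1 (eq_zero_of_forall_dotProduct fun b b' => ?_)
  have := hquad (b + b')
  simp only [mulVec_add, dotProduct_add, add_dotProduct, hquad, hsymm b' b,
    dotProduct_comm b' b] at this
  rw [sub_mulVec, one_mulVec, dotProduct_sub]
  linarith

/-- The covariance matrix of a pure Gaussian state is symplectically congruent to `1`. -/
theorem HasGaussianChar.exists_symplectic_eq_one {ψ : ModeSpace ι}
    {V : Matrix (ι ⊕ ι) (ι ⊕ ι) ℝ} (hV : V.IsSymm) (h : HasGaussianChar ψ V 0) :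
    ∃ S ∈ symplecticGroup ι ℝ, S * V * Sᵀ = 1 := by
  have hpos := h.posDef hV
  have hX : V.toBlocks₁₁.PosDef := hpos.submatrix Sum.inl_injective
  obtain ⟨A, -, hAs, hAA⟩ := (isBlock_const (0 : ℝ) V.toBlocks₁₁).exists_sqrt hX
  have hA : IsUnit A.det := by
    have : IsUnit (A * A).det := by rw [hAA]; exact (isUnit_iff_isUnit_det _).1 hX.isUnit
    rw [det_mul] at this
    exact isUnit_of_mul_isUnit_left this
  have hAis : (A⁻¹)ᵀ = A⁻¹ := by rw [transpose_nonsing_inv, hAs]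
  have h1 := h.map (implements_shearUnitary hA (Q := 0) (by simp))
  set V₁ := shearMatrix A 0 * V * (shearMatrix A 0)ᵀ with hV₁
  have hs₁ : V₁ᵀ = V₁ := by simp [hV₁, Matrix.mul_assoc, hV.eq]
  have h11 : V₁.toBlocks₁₁ = 1 := by
    rw [hV₁, ← fromBlocks_toBlocks V, shearMatrix, fromBlocks_transpose, fromBlocks_multiply,
      fromBlocks_multiply, toBlocks_fromBlocks₁₁, ← hAA]
    simp only [hAis, Matrix.zero_mul, Matrix.mul_zero, transpose_zero, add_zero]
    rw [← Matrix.mul_assoc A⁻¹, nonsing_inv_mul _ hA, Matrix.one_mul, mul_nonsing_inv _ hA]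
  have hQ : ((-(1 / 2) : ℝ) • (V₁.toBlocks₁₂ + V₁.toBlocks₁₂ᵀ))ᵀ =
      (-(1 / 2) : ℝ) • (V₁.toBlocks₁₂ + V₁.toBlocks₁₂ᵀ) := by
    simp [add_comm]
  -- Once the position block is `1`, the chirp adds `Q` to the position-momentum block. Minus the
  -- symmetric part leaves an antisymmetric block, which is the normal form.
  set Q := (-(1 / 2) : ℝ) • (V₁.toBlocks₁₂ + V₁.toBlocks₁₂ᵀ) with hQdef
  have hone : IsUnit (1 : Matrix ι ι ℝ).det := by simp
  have h2 := h1.map (implements_shearUnitary hone hQ)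
  set V₂ := shearMatrix 1 Q * V₁ * (shearMatrix 1 Q)ᵀ with hV₂
  have hs₂ : V₂ᵀ = V₂ := by simp [hV₂, Matrix.mul_assoc, hs₁]
  have h11' : V₂.toBlocks₁₁ = 1 := by
    rw [hV₂, ← fromBlocks_toBlocks V₁, shearMatrix, fromBlocks_transpose, fromBlocks_multiply,
      fromBlocks_multiply, toBlocks_fromBlocks₁₁, h11]
    simp
  have h12' : V₂.toBlocks₁₂ = Q + V₁.toBlocks₁₂ := by
    rw [hV₂, ← fromBlocks_toBlocks V₁, shearMatrix, fromBlocks_transpose, fromBlocks_multiply,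
      fromBlocks_multiply, toBlocks_fromBlocks₁₂, h11]
    simp [hQ]
  have hsb := hs₂
  rw [← fromBlocks_toBlocks V₂, fromBlocks_transpose, fromBlocks_inj] at hsb
  have hform : V₂ = fromBlocks 1 V₂.toBlocks₁₂ V₂.toBlocks₁₂ᵀ V₂.toBlocks₂₂ := by
    conv_lhs => rw [← fromBlocks_toBlocks V₂, h11', ← hsb.2.2.1]
  have hYa : V₂.toBlocks₁₂ᵀ = -V₂.toBlocks₁₂ := by
    rw [h12', transpose_add, hQ, hQdef]
    module
  rw [hform] at h2
  obtain ⟨hY, hZ⟩ := h2.eq_one_of_normalForm hYa hsb.2.2.2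
  refine ⟨shearMatrix 1 Q * shearMatrix A 0, Submonoid.mul_mem _ (shearMatrix_mem hone hQ)
    (shearMatrix_mem hA (by simp)), ?_⟩
  have : V₂ = 1 := by rw [hform, hY, hZ, transpose_zero, fromBlocks_one]
  rw [← this, hV₂, hV₁, transpose_mul]
  simp only [Matrix.mul_assoc]

/-- A Gaussian state with covariance matrix `1` is the vacuum. -/
theorem HasGaussianChar.eq_smul_vacuum {φ : ModeSpace ι} (h : HasGaussianChar φ 1 0) :
    ∃ c : ℂ, ‖c‖ = 1 ∧ φ = c • vacuum ι := by
  have h' : HasGaussianChar φ (fromBlocks 1 0 (0 : Matrix ι ι ℝ)ᵀ 1) 0 := by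
    rw [transpose_zero, fromBlocks_one]
    exact h
  have hk : ∀ b : Config ι, ∀ᵐ x : Config ι,
      φ (x + b) * starRingEnd ℂ (φ x) = ((vacReal (x + b) * vacReal x : ℝ) : ℂ) := fun b => by
    filter_upwards [h'.ae_eq_gaussKernel b.ofLp] with x hx
    refine hx.trans ?_
    rw [gaussKernel, vacReal_mul]
    simp only [zero_mulVec, dotProduct_zero, Complex.ofReal_zero, mul_zero, Complex.exp_zero,
      mul_one, one_mulVec, add_zero]
    congr 3
    rw [norm_sq_eq_dotProduct, norm_sq_eq_dotProduct]
    simp only [WithLp.ofLp_add, dotProduct_add, add_dotProduct, smul_dotProduct, dotProduct_smul,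
      smul_eq_mul, dotProduct_comm b.ofLp x.ofLp]
    ring
  have hφ : Measurable (φ : Config ι → ℂ) := (Lp.stronglyMeasurable φ).measurable
  have hvm : Measurable (vacReal (ι := ι)) := continuous_vacReal.measurable
  have hms : MeasurableSet {p : Config ι × Config ι | φ (p.2 + p.1) * starRingEnd ℂ (φ p.2) =
      ((vacReal (p.2 + p.1) * vacReal p.2 : ℝ) : ℂ)} := by
    refine measurableSet_eq_fun ?_ ?_
    · exact (hφ.comp (measurable_snd.add measurable_fst)).mul
        (Complex.continuous_conj.measurable.comp (hφ.comp measurable_snd))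
    · exact Complex.measurable_ofReal.comp ((hvm.comp (measurable_snd.add measurable_fst)).mul
        (hvm.comp measurable_snd))
  -- Fubini exchanges the order of the almost-everywhere quantifiers, so one base point `x₀` serves
  -- almost all translations and `φ` is recovered from a single slice.
  have hswap : ∀ᵐ x : Config ι, ∀ᵐ b : Config ι,
      φ (x + b) * starRingEnd ℂ (φ x) = ((vacReal (x + b) * vacReal x : ℝ) : ℂ) :=
    (Measure.ae_ae_comm (p := fun b x : Config ι => φ (x + b) * starRingEnd ℂ (φ x) =
      ((vacReal (x + b) * vacReal x : ℝ) : ℂ)) hms).1 (Filter.Eventually.of_forall hk)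
  obtain ⟨x₀, hx₀⟩ := hswap.exists
  have hne : starRingEnd ℂ (φ x₀) ≠ 0 := by
    intro h0
    obtain ⟨b, hb⟩ := hx₀.exists
    rw [h0, mul_zero] at hb
    exact (mul_pos (vacReal_pos (x₀ + b)) (vacReal_pos x₀)).ne' (Complex.ofReal_eq_zero.1 hb.symm)
  set c : ℂ := (vacReal x₀ : ℂ) / starRingEnd ℂ (φ x₀) with hc
  have heq : φ = c • vacuum ι := by
    refine Lp.ext ?_
    have h1 : ∀ᵐ y : Config ι, φ y = c * (vacReal y : ℂ) := by
      have := ae_shift hx₀ (-x₀)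
      filter_upwards [this] with y hy
      have e : x₀ + (y + -x₀) = y := by abel
      rw [e] at hy
      rw [hc, div_mul_eq_mul_div, eq_div_iff hne, hy]
      push_cast
      ring
    filter_upwards [h1, Lp.coeFn_smul c (vacuum ι), vacuum_coeFn (ι := ι)] with y h1 h2 h3
    rw [h1, h2, Pi.smul_apply, h3, smul_eq_mul]
  refine ⟨c, ?_, heq⟩
  have := h.norm_eq_one
  rwa [heq, norm_smul, norm_vacuum, mul_one] at this

end Purity

/-! ### Characteristic functions of tensor products -/

section TensorChar

variable {ι ι' : Type} [Fintype ι] [Fintype ι']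

theorem tensor_coeFn (ψ : ModeSpace ι) (ψ' : ModeSpace ι') :
    (tensor ψ ψ' : Config (ι ⊕ ι') → ℂ) =ᵐ[volume] tensorFun ψ ψ' :=
  (memLp_tensorFun ψ ψ').coeFn_toLp

theorem weylFun_tensorFun (ξ : (ι ⊕ ι') ⊕ (ι ⊕ ι') → ℝ) (f : Config ι → ℂ) (f' : Config ι' → ℂ)
    (x : Config (ι ⊕ ι')) :
    weylFun ξ (tensorFun f f') x =
      weylFun (fun a => ξ (Sum.map Sum.inl Sum.inl a)) f (WithLp.toLp 2 fun i => x (Sum.inl i)) *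
      weylFun (fun a => ξ (Sum.map Sum.inr Sum.inr a)) f'
        (WithLp.toLp 2 fun i => x (Sum.inr i)) := by
  simp only [weylFun, tensorFun, Fintype.sum_sum_type, Sum.map_inl, Sum.map_inr]
  rw [mul_mul_mul_comm, ← Complex.exp_add]
  congr 2
  push_cast
  ring

/-- The Weyl operator of the composite factors over the two systems, and Fubini splits the integral.
-/
theorem inner_weyl_tensor (ξ : (ι ⊕ ι') ⊕ (ι ⊕ ι') → ℝ) (ψ : ModeSpace ι) (ψ' : ModeSpace ι') :
    inner ℂ (tensor ψ ψ') (weyl ξ (tensor ψ ψ')) =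
      inner ℂ ψ (weyl (fun a => ξ (Sum.map Sum.inl Sum.inl a)) ψ) *
      inner ℂ ψ' (weyl (fun a => ξ (Sum.map Sum.inr Sum.inr a)) ψ') := by
  rw [inner_weyl, inner_weyl, inner_weyl]
  set F : Config ι → ℂ := fun x =>
    weylFun (fun a => ξ (Sum.map Sum.inl Sum.inl a)) ψ x * starRingEnd ℂ (ψ x)
  set F' : Config ι' → ℂ := fun x =>
    weylFun (fun a => ξ (Sum.map Sum.inr Sum.inr a)) ψ' x * starRingEnd ℂ (ψ' x)
  have hF : AEStronglyMeasurable F volume :=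
    (memLp_weylFun _ ψ).1.mul (Complex.continuous_conj.comp_aestronglyMeasurable (Lp.memLp ψ).1)
  have hF' : AEStronglyMeasurable F' volume :=
    (memLp_weylFun _ ψ').1.mul (Complex.continuous_conj.comp_aestronglyMeasurable (Lp.memLp ψ').1)
  have h : (fun x => weylFun ξ (tensor ψ ψ') x * starRingEnd ℂ (tensor ψ ψ' x)) =ᵐ[volume]
      fun x : Config (ι ⊕ ι') => F (WithLp.toLp 2 fun i => x (Sum.inl i)) *
        F' (WithLp.toLp 2 fun i => x (Sum.inr i)) := by
    filter_upwards [tensor_coeFn ψ ψ', weylFun_congr (tensor_coeFn ψ ψ') ξ] with x h1 h2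
    rw [h1, h2, weylFun_tensorFun]
    simp only [F, F', tensorFun, map_mul]
    ring
  rw [integral_congr_ae h, ← integral_prod_mul F F',
    ← (measurePreserving_split (ι := ι) (ι' := ι')).map_eq, integral_map]
  · exact measurePreserving_split.measurable.aemeasurable
  · rw [measurePreserving_split.map_eq]
    exact hF.comp_fst.mul hF'.comp_snd

theorem dotProduct_phaseSum_mulVec (V : Matrix (ι ⊕ ι) (ι ⊕ ι) ℝ)
    (V' : Matrix (ι' ⊕ ι') (ι' ⊕ ι') ℝ) (ξ : (ι ⊕ ι') ⊕ (ι ⊕ ι') → ℝ) :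
    ξ ⬝ᵥ (phaseSum V V' *ᵥ ξ) =
      (fun a => ξ (Sum.map Sum.inl Sum.inl a)) ⬝ᵥ
        (V *ᵥ fun a => ξ (Sum.map Sum.inl Sum.inl a)) +
      (fun a => ξ (Sum.map Sum.inr Sum.inr a)) ⬝ᵥ
        (V' *ᵥ fun a => ξ (Sum.map Sum.inr Sum.inr a)) := by
  simp [dotProduct, mulVec, phaseSum, quadEquiv, Fintype.sum_sum_type, Matrix.fromBlocks]
  ring

theorem HasGaussianChar.tensor {ψ : ModeSpace ι} {ψ' : ModeSpace ι'}
    {V : Matrix (ι ⊕ ι) (ι ⊕ ι) ℝ} {V' : Matrix (ι' ⊕ ι') (ι' ⊕ ι') ℝ}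
    (h : HasGaussianChar ψ V 0) (h' : HasGaussianChar ψ' V' 0) :
    HasGaussianChar (_root_.tensor ψ ψ') (phaseSum V V') 0 := fun ξ => by
  rw [inner_weyl_tensor, h, h', dotProduct_phaseSum_mulVec]
  simp only [dotProduct_zero, Complex.ofReal_zero, mul_zero, Complex.exp_zero, one_mul]
  rw [mul_add, Real.exp_add, Complex.ofReal_mul]

theorem isSymm_phaseSum {V : Matrix (ι ⊕ ι) (ι ⊕ ι) ℝ} {V' : Matrix (ι' ⊕ ι') (ι' ⊕ ι') ℝ}
    (h : V.IsSymm) (h' : V'.IsSymm) : (phaseSum V V').IsSymm := by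
  rw [phaseSum]
  exact (h.fromBlocks (by simp) h').submatrix _

end TensorChar

/-! ### The ergotropic gap as a difference of least traces -/

section GapFormula

variable {ι : Type} [Fintype ι] [DecidableEq ι] {k : ℕ} {P : ι → Fin k}
  {ψ : ModeSpace ι} {V : Matrix (ι ⊕ ι) (ι ⊕ ι) ℝ}

theorem isBlock_elim_const (M : Matrix (ι ⊕ ι) (ι ⊕ ι) ℝ) :
    IsBlock (Sum.elim (fun _ : ι => 0) (fun _ : ι => 0)) M :=
  isBlock_iff.2 fun x y h => by cases x <;> cases y <;> simp at h

theorem HasGaussianChar.energy_map (hV : V.IsSymm) (h : HasGaussianChar ψ V 0)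
    {U : ModeSpace ι ≃ₗᵢ[ℂ] ModeSpace ι} {S : Matrix (ι ⊕ ι) (ι ⊕ ι) ℝ} {d : ι ⊕ ι → ℝ}
    (hU : Implements U S d) :
    energy (U ψ) = ENNReal.ofReal ((1 / 4) * (S * V * Sᵀ).trace + (1 / 2) * (d ⬝ᵥ d)) := by
  refine (h.map hU).energy_eq fun x => ?_
  have := (h.posDef hV).posSemidef.mul_mul_conjTranspose_same S
  rw [conjTranspose_eq_transpose_of_trivial] at this
  exact this.diag_nonneg

theorem IsMinTrace.nonneg {c : ι → ℝ} {m : ℝ} (hV : V.PosSemidef) (h : IsMinTrace c V m) :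
    0 ≤ m := by
  obtain ⟨S, -, -, rfl⟩ := h.1
  have := hV.mul_mul_conjTranspose_same S
  rw [conjTranspose_eq_transpose_of_trivial] at this
  exact this.trace_nonneg

/-- The least energy over a class of Gaussian unitaries which contains the shear unitaries of the
block structure `c` and consists of implementers of symplectic matrices with that structure. -/
theorem iInf_energy_eq (hV : V.IsSymm) (h : HasGaussianChar ψ V 0) {c : ι → ℝ} {m : ℝ}
    (hm : IsMinTrace c V m) {C : (ModeSpace ι ≃ₗᵢ[ℂ] ModeSpace ι) → Prop}
    (hC : ∀ U, C U → ∃ S ∈ symplecticGroup ι ℝ, IsBlock (Sum.elim c c) S ∧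
      ∃ d, Implements U S d)
    (hC' : ∀ {A Q : Matrix ι ι ℝ} (hA : IsUnit A.det), Qᵀ = Q → IsBlock c A → IsBlock c Q →
      C (shearUnitary hA Q)) :
    ⨅ (U : ModeSpace ι ≃ₗᵢ[ℂ] ModeSpace ι) (_ : C U), energy (U ψ) = ENNReal.ofReal (m / 4) := by
  refine le_antisymm ?_ (le_iInf₂ fun U hU => ?_)
  · obtain ⟨S, hS, hSb, hSm⟩ := hm.1
    obtain ⟨A, Q, hA, hQ, hAb, hQb, hT⟩ := exists_shearMatrix hS hSb
    -- The minimiser itself need not be implemented: the shear matrix with the same `Sᵀ S` gives the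
    -- same trace.
    refine (iInf₂_le (shearUnitary hA Q) (hC' hA hQ hAb hQb)).trans_eq ?_
    rw [h.energy_map hV (implements_shearUnitary hA hQ), trace_conj_eq, hT, ← trace_conj_eq, hSm,
      dotProduct_zero]
    congr 1
    ring
  · obtain ⟨S, hS, hSb, d, hd⟩ := hC U hU
    rw [h.energy_map hV hd]
    refine ENNReal.ofReal_le_ofReal ?_
    have h1 := hm.2 ⟨S, hS, hSb, rfl⟩
    -- A displacement can only raise the energy.
    have h2 : 0 ≤ d ⬝ᵥ d := Finset.sum_nonneg fun i _ => mul_self_nonneg (d i)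
    linarith

/-- The energy of `ψ` cancels between the two ergotropies. The global minimum is the case of a
constant label, for which the block condition is empty. -/
theorem ergotropicGap_eq (hV : V.IsSymm) (h : HasGaussianChar ψ V 0) {m m₀ : ℝ}
    (hm : IsMinTrace (label P) V m) (hm₀ : IsMinTrace (fun _ => 0) V m₀) :
    ergotropicGap P ψ = (m - m₀) / 4 := by
  have hp := (h.posDef hV).posSemidef
  have h1 := hm.nonneg hp
  have h2 := hm₀.nonneg hp
  rw [ergotropicGap, globalErgotropy, localErgotropy,
    iInf_energy_eq hV h hm (fun U hU => hU.exists_implements)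
      (fun hA hQ hAb hQb => isLocalGaussianUnitary_shearUnitary hA hQ hAb hQb),
    iInf_energy_eq hV h hm₀ (C := IsGaussianUnitary) (fun U hU => ?_)
      (fun hA hQ _ _ => isGaussianUnitary_shearUnitary hA hQ),
    ENNReal.toReal_ofReal (by positivity), ENNReal.toReal_ofReal (by positivity)]
  · ring
  · obtain ⟨S, hS, d, hd⟩ := isGaussianUnitary_iff.1 hU
    exact ⟨S, hS, isBlock_elim_const S, d, hd⟩

theorem IsMinTrace.const_le {c : ι → ℝ} {m m₀ : ℝ} (hm : IsMinTrace c V m)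
    (hm₀ : IsMinTrace (fun _ => 0) V m₀) : m₀ ≤ m := by
  obtain ⟨S, hS, -, hSm⟩ := hm.1
  exact hm₀.2 ⟨S, hS, isBlock_elim_const S, hSm⟩

theorem ergotropicGap_nonneg (h : IsPureGaussian ψ) : 0 ≤ ergotropicGap P ψ := by
  obtain ⟨V, hV, h⟩ := isPureGaussian_iff.1 h
  obtain ⟨m, hm⟩ := exists_isMinTrace (c := label P) (h.posDef hV)
  obtain ⟨m₀, hm₀⟩ := exists_isMinTrace (c := fun _ => 0) (h.posDef hV)
  rw [ergotropicGap_eq hV h hm hm₀]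
  have := hm.const_le hm₀
  linarith

theorem ergotropicGap_tensor {ι' : Type} [Fintype ι'] [DecidableEq ι'] {P' : ι' → Fin k}
    {ψ' : ModeSpace ι'} (h : IsPureGaussian ψ) (h' : IsPureGaussian ψ') :
    ergotropicGap (Sum.elim P P') (tensor ψ ψ') = ergotropicGap P ψ + ergotropicGap P' ψ' := by
  obtain ⟨V, hV, h⟩ := isPureGaussian_iff.1 h
  obtain ⟨V', hV', h'⟩ := isPureGaussian_iff.1 h'
  obtain ⟨m, hm⟩ := exists_isMinTrace (c := label P) (h.posDef hV)
  obtain ⟨m₀, hm₀⟩ := exists_isMinTrace (c := fun _ => 0) (h.posDef hV)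
  obtain ⟨m', hm'⟩ := exists_isMinTrace (c := label P') (h'.posDef hV')
  obtain ⟨m₀', hm₀'⟩ := exists_isMinTrace (c := fun _ => 0) (h'.posDef hV')
  have e : Sum.elim (label P) (label P') = label (Sum.elim P P') := by
    ext x; cases x <;> rfl
  have e₀ : Sum.elim (fun _ : ι => (0 : ℝ)) (fun _ : ι' => 0) = fun _ => 0 := by
    ext x; cases x <;> rfl
  have t := hm.phaseSum (h.posDef hV) (h'.posDef hV') hm'
  have t₀ := hm₀.phaseSum (h.posDef hV) (h'.posDef hV') hm₀'
  rw [e] at t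
  rw [e₀] at t₀
  rw [ergotropicGap_eq hV h hm hm₀, ergotropicGap_eq hV' h' hm' hm₀',
    ergotropicGap_eq (isSymm_phaseSum hV hV') (h.tensor h') t t₀]
  ring

end GapFormula

/-! ### Vanishing gap and product states -/

section Faithful

variable {ι : Type} [Fintype ι] [DecidableEq ι] {k : ℕ} {P : ι → Fin k}
  {ψ : ModeSpace ι} {V : Matrix (ι ⊕ ι) (ι ⊕ ι) ℝ}

/-- The characteristic function factors over the parts. For quadratures `x`, `y` in different parts
its value at the sum of the unit vectors is the product of the values, and logarithms give `V x y +
V y x = 0`. -/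
theorem HasGaussianChar.isBlock_of_isProductAcross (hV : V.IsSymm) (h : HasGaussianChar ψ V 0)
    (hP : IsProductAcross P ψ) : IsBlock (Sum.elim (label P) (label P)) V := by
  obtain ⟨φ, hφ, hprod⟩ := hP
  rw [isProductOf_iff] at hprod
  have hχ : ∀ ξ, inner ℂ ψ (weyl ξ ψ) = ∏ j, inner ℂ (φ j) (weyl (phasePart P ξ j) (φ j)) :=
    fun ξ => by rw [hprod, weyl_productVec, inner_productVec]
  refine isBlock_iff.2 fun x y hxy => ?_
  have hne : Sum.elim P P x ≠ Sum.elim P P y := by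
    cases x <;> cases y <;> simpa [label_eq_iff] using hxy
  have hzero : ∀ (z : ι ⊕ ι) (j : Fin k), Sum.elim P P z ≠ j →
      phasePart P (Pi.single z 1) j = 0 := fun z j hz => by
    ext a
    rw [phasePart, Pi.single_apply, if_neg, Pi.zero_apply]
    rintro rfl
    rcases a with a | a <;> exact hz a.2
  have hadd : ∀ (ξ η : ι ⊕ ι → ℝ) (j : Fin k),
      phasePart P (ξ + η) j = phasePart P ξ j + phasePart P η j := fun _ _ _ => rfl
  have hone : ∀ j, inner ℂ (φ j) (weyl 0 (φ j)) = 1 := fun j => by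
    rw [weyl_zero, inner_self_eq_norm_sq_to_K, hφ j]
    simp
  have hmul : inner ℂ ψ (weyl (Pi.single x 1 + Pi.single y 1) ψ) =
      inner ℂ ψ (weyl (Pi.single x 1) ψ) * inner ℂ ψ (weyl (Pi.single y 1) ψ) := by
    rw [hχ, hχ, hχ, ← Finset.prod_mul_distrib]
    refine Finset.prod_congr rfl fun j _ => ?_
    rw [hadd]
    by_cases hx : Sum.elim P P x = j
    · rw [hzero y j (fun hy => hne (hx.trans hy.symm)), add_zero, hone, mul_one]
    · rw [hzero x j hx, zero_add, hone, one_mul]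
  rw [h, h, h] at hmul
  simp only [dotProduct_zero, Complex.ofReal_zero, mul_zero, Complex.exp_zero, one_mul] at hmul
  rw [← Complex.ofReal_mul, ← Real.exp_add] at hmul
  have := Real.exp_injective (Complex.ofReal_injective hmul)
  simp only [mulVec_add, dotProduct_add, add_dotProduct, single_one_dotProduct,
    mulVec_single_one, col_apply] at this
  have hs : V y x = V x y := hV.apply x y
  linarith

/-- A block congruence of a block matrix equals its own pinching, so the local and the global
criterion coincide at `S`. -/
theorem HasGaussianChar.ergotropicGap_eq_zero_of_isBlock (hV : V.IsSymm)
    (h : HasGaussianChar ψ V 0) (hb : IsBlock (Sum.elim (label P) (label P)) V) :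
    ergotropicGap P ψ = 0 := by
  have hp := h.posDef hV
  obtain ⟨S, hS, hSb, hJ⟩ := exists_isBlock_commute_pinch (c := label P) hp
  have hm := isMinTrace_of_commute hp.posSemidef hS hSb hJ
  rw [((hSb.mul hb).mul hSb.transpose).pinch_eq] at hJ
  have hm₀ := isMinTrace_of_commute (c := fun _ => 0) hp.posSemidef hS (isBlock_elim_const S)
    (by rwa [(isBlock_elim_const _).pinch_eq])
  rw [ergotropicGap_eq hV h hm hm₀, sub_self, zero_div]

/-- A positive definite symplectic matrix that commutes with the symplectic form is trivial. -/
theorem eq_one_of_posDef_of_commute_J {W : Matrix (ι ⊕ ι) (ι ⊕ ι) ℝ} (hW : W.PosDef)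
    (hS : W ∈ symplecticGroup ι ℝ) (hJ : Commute W (J ι ℝ)) : W = 1 := by
  have hsymm : Wᵀ = W := by
    have := hW.1
    rwa [IsHermitian, conjTranspose_eq_transpose_of_trivial] at this
  have h1 : W * J ι ℝ * W = J ι ℝ := by
    have := SymplecticGroup.mem_iff.1 hS
    rwa [hsymm] at this
  have h2 : W * W = 1 := by
    have hu : IsUnit (J ι ℝ) := (isUnit_iff_isUnit_det _).2 (isUnit_det_J ι ℝ)
    refine hu.mul_left_cancel ?_
    rw [mul_one, ← mul_assoc, ← hJ.eq, h1]
  -- `W² = 1` reads `(W + 1) (W - 1) = 0`, and positivity makes the first factor invertible.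
  have hu : IsUnit (W + 1) := (hW.add PosDef.one).isUnit
  refine sub_eq_zero.1 (hu.mul_left_cancel ?_)
  rw [mul_zero, add_mul, mul_sub, one_mul, h2, mul_one, sub_add_sub_cancel', sub_self]

/-- With zero gap a local minimiser is a global one, so `S V Sᵀ` commutes with `J`; purity makes it
symplectic, hence equal to `1`. -/
theorem HasGaussianChar.exists_shear_eq_one (hV : V.IsSymm) (h : HasGaussianChar ψ V 0)
    (hgap : ergotropicGap P ψ = 0) :
    ∃ A Q : Matrix ι ι ℝ, IsUnit A.det ∧ Qᵀ = Q ∧ IsBlock (label P) A ∧ IsBlock (label P) Q ∧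
      shearMatrix A Q * V * (shearMatrix A Q)ᵀ = 1 := by
  have hp := h.posDef hV
  obtain ⟨m, hm⟩ := exists_isMinTrace (c := label P) hp
  obtain ⟨m₀, hm₀⟩ := exists_isMinTrace (c := fun _ => 0) hp
  rw [ergotropicGap_eq hV h hm hm₀] at hgap
  obtain ⟨S, hS, hSb, hSm⟩ := hm.1
  obtain ⟨S₀, hS₀, hS₀V⟩ := h.exists_symplectic_eq_one hV
  have hdet : ∀ {T : Matrix (ι ⊕ ι) (ι ⊕ ι) ℝ}, T ∈ symplecticGroup ι ℝ → IsUnit T.det :=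
    fun hT => SymplecticGroup.symplectic_det hT
  have hSu := hdet hS
  have hS₀u := hdet hS₀
  have hW : (S * V * Sᵀ).PosDef := by
    have := hp.mul_mul_conjTranspose_same (B := S)
      (vecMul_injective_of_isUnit ((isUnit_iff_isUnit_det S).2 hSu))
    rwa [conjTranspose_eq_transpose_of_trivial] at this
  have hWt : (S * V * Sᵀ)ᵀ = S * V * Sᵀ := by
    rw [transpose_mul, transpose_mul, transpose_transpose, hV.eq, mul_assoc]
  have hJ : Commute (S * V * Sᵀ) (J ι ℝ) := by
    rw [← (isBlock_elim_const (S * V * Sᵀ)).pinch_eq]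
    refine commute_pinch_of_isMin hWt fun T hT _ => ?_
    have := hm₀.2 ⟨T * S, mul_mem hT hS, isBlock_elim_const _, rfl⟩
    have e : T * S * V * (T * S)ᵀ = T * (S * V * Sᵀ) * Tᵀ := by
      simp only [transpose_mul, mul_assoc]
    rw [e] at this
    linarith
  have hWS : S * V * Sᵀ ∈ symplecticGroup ι ℝ := by
    have hR : S * S₀⁻¹ ∈ symplecticGroup ι ℝ := mul_mem hS (inv_mem_symplectic hS₀)
    -- Purity gives `V = S₀⁻¹ (S₀⁻¹)ᵀ`, so the matrix is `R Rᵀ` with `R = S S₀⁻¹` symplectic.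
    have e : S * V * Sᵀ = S * S₀⁻¹ * (S * S₀⁻¹)ᵀ := by
      have : V = S₀⁻¹ * (S₀⁻¹)ᵀ := by
        calc V = S₀⁻¹ * (S₀ * V * S₀ᵀ) * (S₀⁻¹)ᵀ := by
              rw [transpose_nonsing_inv, mul_assoc S₀ V, nonsing_inv_mul_cancel_left _ _ hS₀u,
                mul_nonsing_inv_cancel_right]
              rwa [det_transpose]
          _ = _ := by rw [hS₀V, mul_one]
      rw [this, transpose_mul]
      simp only [mul_assoc]
    rw [e]
    exact mul_mem hR (SymplecticGroup.transpose_mem hR)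
  have hone := eq_one_of_posDef_of_commute_J hW hWS hJ
  obtain ⟨A, Q, hA, hQ, hAb, hQb, hT⟩ := exists_shearMatrix hS hSb
  refine ⟨A, Q, hA, hQ, hAb, hQb, ?_⟩
  set T := shearMatrix A Q
  -- Being taken to `1` is a condition on `Sᵀ S` alone, so it transfers to the shear matrix.
  have hVS : V * (Sᵀ * S) = 1 := by
    refine ((isUnit_iff_isUnit_det S).2 hSu).mul_left_cancel ?_
    rw [← mul_assoc, ← mul_assoc, hone, one_mul, mul_one]
  rw [← hT] at hVS
  refine ((isUnit_iff_isUnit_det T).2 (hdet (shearMatrix_mem hA hQ))).mul_right_cancel ?_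
  rw [mul_assoc, mul_assoc, hVS, mul_one, one_mul]

theorem IsLocalGaussianUnitary.isProductAcross_symm_vacuum {U : ModeSpace ι ≃ₗᵢ[ℂ] ModeSpace ι}
    (hU : IsLocalGaussianUnitary P U) : IsProductAcross P (U.symm (vacuum ι)) := by
  obtain ⟨u, -, hu⟩ := hU
  refine ⟨fun j => (u j).symm (vacuum (ModesOf P j)), fun j => ?_, ?_⟩
  · rw [LinearIsometryEquiv.norm_map, norm_vacuum]
  · obtain ⟨Ψ, h1, h2⟩ := hu fun j => (u j).symm (vacuum (ModesOf P j))
    simp only [LinearIsometryEquiv.apply_symm_apply] at h2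
    rw [isProductOf_iff, vacuum_eq_productVec] at h2
    rwa [← h2, LinearIsometryEquiv.symm_apply_apply]

/-- One factor absorbs the phase; `1 ≤ k` provides that factor. -/
theorem IsProductAcross.smul (hk : 1 ≤ k) (h : IsProductAcross P ψ) {c : ℂ} (hc : ‖c‖ = 1) :
    IsProductAcross P (c • ψ) := by
  obtain ⟨φ, hφ, hprod⟩ := h
  rw [isProductOf_iff] at hprod
  let j₀ : Fin k := ⟨0, hk⟩
  refine ⟨fun j => (if j = j₀ then c else 1) • φ j, fun j => ?_, ?_⟩
  · rw [norm_smul, hφ j, mul_one]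
    split_ifs
    · exact hc
    · exact norm_one
  · rw [isProductOf_iff, productVec_smul P (fun j => if j = j₀ then c else 1),
      Finset.prod_ite_eq' Finset.univ j₀ (fun _ => c), if_pos (Finset.mem_univ _), hprod]

theorem ergotropicGap_eq_zero_iff (hk : 1 ≤ k) (h : IsPureGaussian ψ) :
    ergotropicGap P ψ = 0 ↔ IsProductAcross P ψ := by
  obtain ⟨V, hV, h⟩ := isPureGaussian_iff.1 h
  refine ⟨fun hgap => ?_, fun hprod =>
    h.ergotropicGap_eq_zero_of_isBlock hV (h.isBlock_of_isProductAcross hV hprod)⟩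
  obtain ⟨A, Q, hA, hQ, hAb, hQb, hone⟩ := h.exists_shear_eq_one hV hgap
  have hmap := h.map (implements_shearUnitary hA hQ)
  rw [hone] at hmap
  obtain ⟨c, hc, hcv⟩ := hmap.eq_smul_vacuum
  have hU := isLocalGaussianUnitary_shearUnitary hA hQ hAb hQb
  have e : ψ = c • (shearUnitary hA Q).symm (vacuum ι) := by
    rw [← map_smul, ← hcv, LinearIsometryEquiv.symm_apply_apply]
  rw [e]
  exact hU.isProductAcross_symm_vacuum.smul hk hc

end Faithful

/-! ### Minimisation over partitions -/

section Score

variable {ι ι' : Type} [Fintype ι] [DecidableEq ι] [Fintype ι'] [DecidableEq ι'] {k : ℕ}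

/-- There are finitely many partitions, so the infimum is attained; nonemptiness excludes the
default value `sInf ∅ = 0`. -/
theorem isLeast_minGap {C : Set (ι → Fin k)} (hC : C.Nonempty) (ψ : ModeSpace ι) :
    IsLeast ((fun P => ergotropicGap P ψ) '' C) (minGap C ψ) :=
  have hfin : ((fun P => ergotropicGap P ψ) '' C).Finite := C.toFinite.image _
  ⟨(hC.image _).csInf_mem hfin, fun _ hr => csInf_le hfin.bddBelow hr⟩

theorem minGap_anti {C D : Set (ι → Fin k)} (hC : C.Nonempty) (h : C ⊆ D) (ψ : ModeSpace ι) :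
    minGap D ψ ≤ minGap C ψ :=
  (isLeast_minGap (hC.mono h) ψ).2 (Set.image_mono h (isLeast_minGap hC ψ).1)

theorem pooledPartitions_subset_kPartitions :
    pooledPartitions ι ι' k ⊆ kPartitions (ι ⊕ ι') k := by
  rintro _ ⟨P, hP, P', -, rfl⟩ j
  obtain ⟨i, hi⟩ := hP j
  exact ⟨Sum.inl i, hi⟩

theorem kPartitions_fin_nonempty {N : ℕ} (hk : 1 ≤ k) (hN : k ≤ N) :
    (kPartitions (Fin N) k).Nonempty :=
  haveI : Nonempty (Fin k) := ⟨⟨0, hk⟩⟩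
  ⟨_, Function.invFun_surjective (Fin.castLE_injective hN)⟩

/-- On pooled partitions the gap is a function of `P` plus a function of `P'`, with `P` and `P'`
chosen independently, so the minima add. -/
theorem pooledErgotropicScore_tensor {ψ : ModeSpace ι} {ψ' : ModeSpace ι'}
    (hne : (kPartitions ι k).Nonempty) (hne' : (kPartitions ι' k).Nonempty)
    (h : IsPureGaussian ψ) (h' : IsPureGaussian ψ') :
    pooledErgotropicScore k (tensor ψ ψ') = ergotropicScore k ψ + ergotropicScore k ψ' := by
  have hl := isLeast_minGap hne ψ
  have hl' := isLeast_minGap hne' ψ'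
  refine IsLeast.csInf_eq ⟨?_, ?_⟩
  · obtain ⟨P, hP, e⟩ := hl.1
    obtain ⟨P', hP', e'⟩ := hl'.1
    refine ⟨Sum.elim P P', ⟨P, hP, P', hP', rfl⟩, ?_⟩
    simp only at e e' ⊢
    rw [ergotropicGap_tensor h h', e, e', ergotropicScore, ergotropicScore]
  · rintro _ ⟨_, ⟨P, hP, P', hP', rfl⟩, rfl⟩
    simp only
    rw [ergotropicGap_tensor h h']
    exact add_le_add (hl.2 ⟨P, hP, rfl⟩) (hl'.2 ⟨P', hP', rfl⟩)

theorem ergotropicScore_tensor_le {ψ : ModeSpace ι} {ψ' : ModeSpace ι'}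
    (hne : (kPartitions ι k).Nonempty) (hne' : (kPartitions ι' k).Nonempty)
    (h : IsPureGaussian ψ) (h' : IsPureGaussian ψ') :
    ergotropicScore k (tensor ψ ψ') ≤ ergotropicScore k ψ + ergotropicScore k ψ' := by
  rw [← pooledErgotropicScore_tensor hne hne' h h']
  obtain ⟨P, hP⟩ := hne
  obtain ⟨P', hP'⟩ := hne'
  exact minGap_anti (C := pooledPartitions ι ι' k) ⟨_, P, hP, P', hP', rfl⟩
    pooledPartitions_subset_kPartitions _

/-- Gaps are nonnegative and the minimum is attained, so the score vanishes exactly when some gap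
does. -/
theorem ergotropicScore_eq_zero_iff {ψ : ModeSpace ι} (hk : 1 ≤ k)
    (hne : (kPartitions ι k).Nonempty) (h : IsPureGaussian ψ) :
    ergotropicScore k ψ = 0 ↔ ∃ P ∈ kPartitions ι k, IsProductAcross P ψ := by
  have hl := isLeast_minGap hne ψ
  constructor
  · intro h0
    obtain ⟨P, hP, e⟩ := hl.1
    exact ⟨P, hP, (ergotropicGap_eq_zero_iff hk h).1 (e.trans h0)⟩
  · rintro ⟨P, hP, hprod⟩
    have h1 := hl.2 ⟨P, hP, (ergotropicGap_eq_zero_iff hk h).2 hprod⟩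
    obtain ⟨P', -, e⟩ := hl.1
    exact le_antisymm h1 ((ergotropicGap_nonneg h).trans_eq e)

end Score

end

theorem corollary4 (k : ℕ) (hk : 1 ≤ k) :
    -- faithfulness
    (∀ (N : ℕ) (_ : k ≤ N) (ψ : ModeSpace (Fin N)), IsPureGaussian ψ →
      (ergotropicScore k ψ = 0 ↔ ∃ P ∈ kPartitions (Fin N) k, IsProductAcross P ψ)) ∧
    -- additivity
    (∀ (N N' : ℕ) (_ : k ≤ N) (_ : k ≤ N') (ψ : ModeSpace (Fin N)) (ψ' : ModeSpace (Fin N')),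
      IsPureGaussian ψ → IsPureGaussian ψ' →
      (∀ P ∈ kPartitions (Fin N) k, ∀ P' ∈ kPartitions (Fin N') k,
        ergotropicGap (Sum.elim P P') (tensor ψ ψ') =
          ergotropicGap P ψ + ergotropicGap P' ψ') ∧
      pooledErgotropicScore k (tensor ψ ψ') = ergotropicScore k ψ + ergotropicScore k ψ' ∧
      ergotropicScore k (tensor ψ ψ') ≤ ergotropicScore k ψ + ergotropicScore k ψ') := by

  refine ⟨fun N hN ψ h => ergotropicScore_eq_zero_iff hk (kPartitions_fin_nonempty hk hN) h,
    fun N N' hN hN' ψ ψ' h h' => ⟨fun P _ P' _ => ergotropicGap_tensor h h', ?_, ?_⟩⟩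
  · exact pooledErgotropicScore_tensor (kPartitions_fin_nonempty hk hN)
      (kPartitions_fin_nonempty hk hN') h h'
  · exact ergotropicScore_tensor_le (kPartitions_fin_nonempty hk hN)
      (kPartitions_fin_nonempty hk hN') h h'
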